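/- **Setting.** A vocabulary $\sigma$ is a finite set of relation symbols of positive arity. Formulas of $\mathrm{FO}(\perp,\mathrm{dep},\subseteq)$ are built from $x=y$, $x\neq y$, $R(\bar x)$, $\neg R(\bar x)$, dependence atoms $\mathrm{dep}(\bar x,\bar y)$, inclusion atoms $\bar x\subseteq\bar y$ (tuples of equal length) and independence atoms $\bar x\perp_{\bar z}\bar y$ by $\wedge,\vee,\exists x,\forall x$. A team $X$ of a structure $\mathcal A$ with universe $A$ is a set of assignments $s\colon D\to A$ with a common finite domain $D$ of variables. Lax team semantics: an $\mathrm{FO}$-literal holds in $X$ iff it holds under every $s\in X$; $\mathcal A\models_X\varphi\wedge\psi$ iff $\mathcal A\models_X\varphi$ and $\mathcal A\models_X\psi$; $\mathcal A\models_X\varphi\vee\psi$ iff $X=Y\cup Z$ with $\mathcal A\models_Y\varphi$ and $\mathcal A\models_Z\psi$; $\mathcal A\models_X\forall x\,\varphi$ iff $\mathcal A\models_{X'}\varphi$ for $X'=\{s(a/x): s\in X, a\in A\}$; $\mathcal A\models_X\exists x\,\varphi$ iff there is $F\colon X\to\mathcal P(A)\setminus\{\emptyset\}$ with $\mathcal A\models_{X'}\varphi$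 for $X'=\{s(a/x): s\in X, a\in F(s)\}$; $\mathcal A\models_X\mathrm{dep}(\bar x,\bar y)$ iff all $s,t\in X$ with $s(\bar x)=t(\bar x)$ satisfy $s(\bar y)=t(\bar y)$; $\mathcal A\models_X\bar x\subseteq\bar y$ iff for every $s\in X$ there is $t\in X$ with $s(\bar x)=t(\bar y)$; $\mathcal A\models_X\bar x\perp_{\bar z}\bar y$ iff for all $s,t\in X$ with $s(\bar z)=t(\bar z)$ there is $u\in X$ with $u(\bar x)=s(\bar x)$, $u(\bar y)=t(\bar y)$, $u(\bar z)=s(\bar z)$. An enumeration problem assigns to each input word $x$ a set $S(x)$ of words (the solutions). It belongs to $\mathrm{DelNP}$ iff there are a language $L\in\mathrm{NP}$, a random access machine $M$ with oracle $L$ (unit-cost addition and subtraction, indirect addressing) and a polynomial $p$ such that on every input $x$ the machine outputs each element of $S(x)$ exactly once and nothing else and then halts; the times before the first output, between two consecutive outputs, and between the last output (or the start, if there is none) and halting are at most $p(|x|)$; every oracle question has length at most $p(|x|)$; and all register contents have at most $p(|x|)$ bits. **Theorem.** Let $\sigma$ be a vocabulary and let $\varphi\in\mathrm{FO}(\perp,\mathrm{dep},\subseteq)$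 be a fixed formula over $\sigma$. Then the following enumeration problem belongs to $\mathrm{DelNP}$: given (the encoding of) a finite $\sigma$-structure $\mathcal A$, enumerate (the encodings of) all teams $X\neq\emptyset$ of $\mathcal A$, with domain the set of free variables of $\varphi$, such that $\mathcal A\models_X\varphi$ and $\mathcal A\not\models_{X'}\varphi$ for every team $X'$ over the same domain with $|X'|>|X|$. (Structures on $\{0,\dots,n-1\}$ are encoded by $n$ in unary followed by the characteristic words of their relations, teams by their characteristic words; words that encode no structure have no solutions.) -/

import Mathlib

namespace TeamEnum

/-! ## First-order team logic -/

/-- A vocabulary: finitely many relation symbols `0, …, numRel - 1` with positive arities. -/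
structure Vocabulary where
  numRel : ℕ
  arity : Fin numRel → ℕ
  arity_pos : ∀ i, 0 < arity i

/-- A `σ`-structure with universe `A`. -/
structure Structure (σ : Vocabulary) (A : Type*) where
  rel : ∀ i : Fin σ.numRel, Set (Fin (σ.arity i) → A)

/-- Formulas of `FO(⊥, dep, ⊆)` over `σ`. First-order variables are natural numbers and a tuple of
`k` variables is a function `Fin k → ℕ`. -/
inductive Formula (σ : Vocabulary) : Type
  | eq (x y : ℕ)
  | neq (x y : ℕ)
  | rel (i : Fin σ.numRel) (xs : Fin (σ.arity i) → ℕ)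
  | nrel (i : Fin σ.numRel) (xs : Fin (σ.arity i) → ℕ)
  | and (φ ψ : Formula σ)
  | or (φ ψ : Formula σ)
  | ex (x : ℕ) (φ : Formula σ)
  | all (x : ℕ) (φ : Formula σ)
  /-- the dependence atom `dep(xs, ys)` -/
  | dep {k l : ℕ} (xs : Fin k → ℕ) (ys : Fin l → ℕ)
  /-- the inclusion atom `xs ⊆ ys` -/
  | inc {k : ℕ} (xs ys : Fin k → ℕ)
  /-- the independence atom `xs ⊥_zs ys` -/
  | indep {k l m : ℕ} (xs : Fin k → ℕ) (ys : Fin l → ℕ) (zs : Fin m → ℕ)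

/-- The variables occurring in a tuple. -/
def tupleVars {k : ℕ} (xs : Fin k → ℕ) : Finset ℕ := Finset.univ.image xs

/-- The free variables of a formula. -/
def Formula.free {σ : Vocabulary} : Formula σ → Finset ℕ
  | .eq x y => {x, y}
  | .neq x y => {x, y}
  | .rel _ xs => tupleVars xs
  | .nrel _ xs => tupleVars xs
  | .and φ ψ => φ.free ∪ ψ.free
  | .or φ ψ => φ.free ∪ ψ.free
  | .ex x φ => φ.free.erase x
  | .all x φ => φ.free.erase x
  | .dep xs ys => tupleVars xs ∪ tupleVars ys
  | .inc xs ys => tupleVars xs ∪ tupleVars ys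
  | .indep xs ys zs => tupleVars xs ∪ tupleVars ys ∪ tupleVars zs

/-- An assignment with values in `A` is a partial function from variables to `A`; its domain is
the set of variables at which it is not `none`. -/
abbrev Assignment (A : Type*) := ℕ → Option A

/-- `s(a/x)`. -/
def Assignment.subst {A : Type*} (s : Assignment A) (a : A) (x : ℕ) : Assignment A :=
  Function.update s x (some a)

/-- `X` is a set of assignments which all have domain `D`. -/
def IsTeam {A : Type*} (D : Finset ℕ) (X : Set (Assignment A)) : Prop :=
  ∀ s ∈ X, ∀ x, (s x).isSome = true ↔ x ∈ D

/-- `X[F/x]`. -/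
def supplement {A : Type*} (X : Set (Assignment A)) (F : Assignment A → Set A) (x : ℕ) :
    Set (Assignment A) :=
  {t | ∃ s ∈ X, ∃ a ∈ F s, t = s.subst a x}

/-- `X[A/x]`. -/
def duplicate {A : Type*} (X : Set (Assignment A)) (x : ℕ) : Set (Assignment A) :=
  {t | ∃ s ∈ X, ∃ a : A, t = s.subst a x}

/-- (Lax) team semantics: `Sat 𝔄 φ X` is `𝔄 ⊨_X φ`. The value of a tuple `xs` under `s` is
`s ∘ xs`. -/
def Sat {σ : Vocabulary} {A : Type*} (𝔄 : Structure σ A) :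
    Formula σ → Set (Assignment A) → Prop
  | .eq x y, X => ∀ s ∈ X, s x = s y
  | .neq x y, X => ∀ s ∈ X, s x ≠ s y
  | .rel i xs, X => ∀ s ∈ X, ∃ a ∈ 𝔄.rel i, s ∘ xs = some ∘ a
  | .nrel i xs, X => ∀ s ∈ X, ∃ a ∉ 𝔄.rel i, s ∘ xs = some ∘ a
  | .and φ ψ, X => Sat 𝔄 φ X ∧ Sat 𝔄 ψ X
  | .or φ ψ, X => ∃ Y Z : Set (Assignment A), Y ∪ Z = X ∧ Sat 𝔄 φ Y ∧ Sat 𝔄 ψ Z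
  | .ex x φ, X => ∃ F : Assignment A → Set A,
      (∀ s ∈ X, (F s).Nonempty) ∧ Sat 𝔄 φ (supplement X F x)
  | .all x φ, X => Sat 𝔄 φ (duplicate X x)
  | .dep xs ys, X => ∀ s ∈ X, ∀ t ∈ X, s ∘ xs = t ∘ xs → s ∘ ys = t ∘ ys
  | .inc xs ys, X => ∀ s ∈ X, ∃ t ∈ X, s ∘ xs = t ∘ ys
  | .indep xs ys zs, X => ∀ s ∈ X, ∀ t ∈ X, s ∘ zs = t ∘ zs →
      ∃ u ∈ X, u ∘ xs = s ∘ xs ∧ u ∘ ys = t ∘ ys ∧ u ∘ zs = s ∘ zs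

/-! ## Random access machines with an oracle -/

/-- Instructions of a random access machine with registers `R 0, R 1, …` over `ℕ`, a read-only
input word, an oracle question word and an output word (which are written bit by bit). -/
inductive Instr : Type
  /-- `R r := k` -/
  | const (r k : ℕ)
  /-- `R r := R a + R b` -/
  | add (r a b : ℕ)
  /-- `R r := R a - R b` (truncated) -/
  | sub (r a b : ℕ)
  /-- `R r := R (R a)` -/
  | load (r a : ℕ)
  /-- `R (R a) := R b` -/
  | store (a b : ℕ)
  /-- if `R a = 0` then jump to instruction `l` -/
  | jz (a l : ℕ)
  /-- `R r := ` length of the input -/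
  | inputLength (r : ℕ)
  /-- `R r := ` bit number `R a` of the input -/
  | input (r a : ℕ)
  /-- append the bit `R a ≠ 0` to the oracle question -/
  | writeQuery (a : ℕ)
  /-- `R r := ` oracle answer to the current question; the question is cleared -/
  | ask (r : ℕ)
  /-- append the bit `R a ≠ 0` to the output word -/
  | writeOutput (a : ℕ)
  /-- output the current output word as the next solution; the output word is cleared -/
  | output

/-- A configuration: program counter, register contents, oracle question, output word. -/
structure Config where
  pc : ℕ
  reg : ℕ → ℕ
  query : List Bool
  out : List Bool

/-- The initial configuration. -/
def Config.init : Config := ⟨0, fun _ => 0, [], []⟩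

/-- `R r := v`, and proceed to the next instruction. -/
def Config.set (c : Config) (r v : ℕ) : Config :=
  { c with pc := c.pc + 1, reg := Function.update c.reg r v }

open Classical in
/-- The effect of one instruction, for the oracle `L` and the input `x`. -/
noncomputable def exec (L : Language Bool) (x : List Bool) (c : Config) : Instr → Config
  | .const r k => c.set r k
  | .add r a b => c.set r (c.reg a + c.reg b)
  | .sub r a b => c.set r (c.reg a - c.reg b)
  | .load r a => c.set r (c.reg (c.reg a))
  | .store a b => c.set (c.reg a) (c.reg b)
  | .jz a l => { c with pc := if c.reg a = 0 then l else c.pc + 1 }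
  | .inputLength r => c.set r x.length
  | .input r a => c.set r (if x[c.reg a]? = some true then 1 else 0)
  | .writeQuery a => { c with pc := c.pc + 1, query := c.query ++ [decide (c.reg a ≠ 0)] }
  | .ask r => { c.set r (if c.query ∈ L then 1 else 0) with query := [] }
  | .writeOutput a => { c with pc := c.pc + 1, out := c.out ++ [decide (c.reg a ≠ 0)] }
  | .output => { c with pc := c.pc + 1, out := [] }

/-- A program; the machine halts when the program counter leaves the program. -/
abbrev Program := List Instr

/-- One step (the identity on halted configurations). -/
noncomputable def step (M : Program) (L : Language Bool) (x : List Bool) (c : Config) : Config :=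
  match M[c.pc]? with
  | none => c
  | some i => exec L x c i

/-- The configuration of `M` with oracle `L` on input `x` after `t` steps. -/
noncomputable def run (M : Program) (L : Language Bool) (x : List Bool) (t : ℕ) : Config :=
  (step M L x)^[t] Config.init

/-- The machine has halted in the configuration `c`. -/
def Halted (M : Program) (c : Config) : Prop := M[c.pc]? = none

/-- The next step outputs the solution `y`. -/
def Outputs (M : Program) (c : Config) (y : List Bool) : Prop :=
  M[c.pc]? = some .output ∧ c.out = y

/-- The next step asks the oracle the question `q`. -/
def Asks (M : Program) (c : Config) (q : List Bool) : Prop :=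
  (∃ r, M[c.pc]? = some (.ask r)) ∧ c.query = q

/-! ## Complexity classes -/

/-- Polynomial time: the machine (with the empty oracle) halts within `p(|x|)` steps, and it accepts
iff register `0` is then nonzero. -/
def PTIME : Set (Language Bool) :=
  {L | ∃ (M : Program) (p : Polynomial ℕ), ∀ x : List Bool, ∃ t ≤ p.eval x.length,
    Halted M (run M 0 x t) ∧ (x ∈ L ↔ (run M 0 x t).reg 0 ≠ 0)}

/-- The pair of two words, as one word: the bits of `x` doubled, a separator, and `w`. -/
def pairWord (x w : List Bool) : List Bool :=
  x.flatMap (fun b => [b, b]) ++ [false, true] ++ w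

/-- Nondeterministic polynomial time, by polynomially bounded certificates that are verified in
polynomial time. -/
def NP : Set (Language Bool) :=
  {L | ∃ V ∈ PTIME, ∃ p : Polynomial ℕ, ∀ x : List Bool,
    x ∈ L ↔ ∃ w : List Bool, w.length ≤ p.eval x.length ∧ pairWord x w ∈ V}

/-- An enumeration problem assigns to each input word the set of its solutions. -/
abbrev EnumProblem := List Bool → Set (List Bool)

/-- On input `x`, the program `M` with oracle `L` outputs exactly the elements of `S`, each of them
once, and halts; the time before the first output, between two consecutive outputs, and between
the last output and halting is at most `d`. -/
def EnumeratesWithDelay (M : Program) (L : Language Bool) (x : List Bool) (S : Set (List Bool))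
    (d : ℕ) : Prop :=
  (∀ y, y ∈ S ↔ ∃ t, Outputs M (run M L x t) y) ∧
  (∀ y t t', Outputs M (run M L x t) y → Outputs M (run M L x t') y → t = t') ∧
  (∃ t, Halted M (run M L x t)) ∧
  (∀ t, ∃ t', t ≤ t' ∧ t' < t + d ∧
    (Halted M (run M L x t') ∨ ∃ y, Outputs M (run M L x t') y))

/-- The enumeration class `DelC` of a class `C` of decision problems: enumeration with polynomial
delay by a random access machine with an oracle in `C`, whose oracle questions have polynomial
length and whose registers contain numbers of polynomially many bits. -/
def Del (C : Set (Language Bool)) : Set EnumProblem :=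
  {E | ∃ L ∈ C, ∃ (M : Program) (p : Polynomial ℕ), ∀ x : List Bool,
    EnumeratesWithDelay M L x (E x) (p.eval x.length) ∧
    (∀ t q, Asks M (run M L x t) q → q.length ≤ p.eval x.length) ∧
    (∀ t r, (run M L x t).reg r < 2 ^ p.eval x.length)}

/-! ## The enumeration problem -/

open Classical in
/-- A `k`-ary relation on `{0, …, n - 1}` as a word of length `n ^ k`: the bit number
`∑ i, a i * n ^ i` tells whether the tuple `a` belongs to the relation. -/
noncomputable def encodeRel {n k : ℕ} (R : Set (Fin k → Fin n)) : List Bool :=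
  List.ofFn fun j : Fin (n ^ k) => decide (finFunctionFinEquiv.symm j ∈ R)

/-- A structure with universe `{0, …, n - 1}` as a word: `n` in unary, followed by its relations. -/
noncomputable def encodeStructure {σ : Vocabulary} {n : ℕ} (𝔄 : Structure σ (Fin n)) : List Bool :=
  List.replicate n true ++ [false] ++ (List.ofFn fun i => encodeRel (𝔄.rel i)).flatten

/-- A team with domain `D` as a word: it is read as a `|D|`-ary relation, with the variables
in increasing order. -/
noncomputable def encodeTeam {n : ℕ} (D : Finset ℕ) (X : Set (Assignment (Fin n))) : List Bool :=
  encodeRel {a : Fin D.card → Fin n | ∃ s ∈ X, s ∘ D.orderEmbOfFin rfl = some ∘ a}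

/-- `X` is a nonempty satisfying team (with the free variables of `φ` as its domain) of maximum
cardinality. -/
def IsMaxCardTeam {σ : Vocabulary} {n : ℕ} (φ : Formula σ) (𝔄 : Structure σ (Fin n))
    (X : Set (Assignment (Fin n))) : Prop :=
  IsTeam φ.free X ∧ Sat 𝔄 φ X ∧ X ≠ ∅ ∧
  ∀ X' : Set (Assignment (Fin n)), IsTeam φ.free X' → X.ncard < X'.ncard → ¬ Sat 𝔄 φ X'

/-- Enumeration of the nonempty satisfying teams of maximum cardinality of the fixed formula `φ` in a
given structure (a word that encodes no structure has no solutions). -/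
def ECardMaxSat {σ : Vocabulary} (φ : Formula σ) : EnumProblem := fun w =>
  {y | ∃ (n : ℕ) (𝔄 : Structure σ (Fin n)) (X : Set (Assignment (Fin n))),
    w = encodeStructure 𝔄 ∧ IsMaxCardTeam φ 𝔄 X ∧ y = encodeTeam φ.free X}

/-! ## Well-definedness of the encodings -/

theorem IsTeam.finite {n : ℕ} {D : Finset ℕ} {X : Set (Assignment (Fin n))} (h : IsTeam D X) :
    X.Finite := by
  refine Set.Finite.of_injOn (f := fun s (i : D) => s i) (t := Set.univ)
    (fun _ _ => Set.mem_univ _) ?_ Set.finite_univ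
  intro s hs t ht hst
  funext x
  by_cases hx : x ∈ D
  · exact congrFun hst ⟨x, hx⟩
  · have h1 := mt (h s hs x).1 hx
    have h2 := mt (h t ht x).1 hx
    simp only [Bool.not_eq_true, Option.isSome_eq_false_iff, Option.isNone_iff_eq_none] at h1 h2
    rw [h1, h2]

theorem encodeRel_injective {n k : ℕ} :
    Function.Injective (encodeRel : Set (Fin k → Fin n) → List Bool) := by
  intro R S h
  ext a
  have := congrFun (List.ofFn_injective h) (finFunctionFinEquiv a)
  simpa using this

theorem encodeRel_length {n k : ℕ} (R : Set (Fin k → Fin n)) :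
    (encodeRel R).length = n ^ k := by
  simp [encodeRel]

theorem encodeTeam_injOn {n : ℕ} (D : Finset ℕ) :
    Set.InjOn (encodeTeam (n := n) D) {X | IsTeam D X} := by
  have key : ∀ X Y : Set (Assignment (Fin n)), IsTeam D X → IsTeam D Y →
      encodeTeam D X = encodeTeam D Y → X ⊆ Y := by
    intro X Y hX hY h s hs
    have h' := encodeRel_injective h
    have hD : ∀ i, ∃ a, s (D.orderEmbOfFin rfl i) = some a := fun i =>
      Option.isSome_iff_exists.1 ((hX s hs _).2 (Finset.orderEmbOfFin_mem D rfl i))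
    choose a ha using hD
    have hmem : a ∈ {a : Fin D.card → Fin n | ∃ s ∈ X, s ∘ D.orderEmbOfFin rfl = some ∘ a} :=
      ⟨s, hs, funext ha⟩
    rw [h'] at hmem
    obtain ⟨t, ht, hta⟩ := hmem
    have : s = t := by
      funext x
      by_cases hx : x ∈ D
      · have : x ∈ Set.range (D.orderEmbOfFin rfl) := by simpa using hx
        obtain ⟨i, rfl⟩ := this
        rw [ha i]
        exact (congrFun hta i).symm
      · have h1 := mt (hX s hs x).1 hx
        have h2 := mt (hY t ht x).1 hx
        simp only [Bool.not_eq_true, Option.isSome_eq_false_iff,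
          Option.isNone_iff_eq_none] at h1 h2
        rw [h1, h2]
    exact this ▸ ht
  intro X hX Y hY h
  exact Set.Subset.antisymm (key X Y hX hY h) (key Y X hY hX h.symm)

theorem flatten_ofFn_injective {α : Type*} : ∀ {m : ℕ} (f g : Fin m → List α),
    (∀ i, (f i).length = (g i).length) →
    (List.ofFn f).flatten = (List.ofFn g).flatten → f = g := by
  intro m
  induction m with
  | zero => intro f g _ _; exact Subsingleton.elim _ _
  | succ m ih =>
    intro f g hl h
    rw [List.ofFn_succ, List.ofFn_succ, List.flatten_cons, List.flatten_cons] at h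
    obtain ⟨h0, h1⟩ := List.append_inj h (hl 0)
    have h2 := ih _ _ (fun i => hl i.succ) h1
    funext i
    refine Fin.cases h0 (fun j => congrFun h2 j) i

theorem encodeStructure_injective {σ : Vocabulary} :
    Function.Injective (fun p : Σ n, Structure σ (Fin n) => encodeStructure p.2) := by
  have hn : ∀ (n m : ℕ) (a b : List Bool), List.replicate n true ++ [false] ++ a =
      List.replicate m true ++ [false] ++ b → n = m ∧ a = b := by
    intro n
    induction n with
    | zero => intro m a b h; cases m <;> simp_all [List.replicate_succ]
    | succ n ih =>
      intro m a b h
      cases m with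
      | zero => simp [List.replicate_succ] at h
      | succ m =>
        have := ih m a b (by simpa [List.replicate_succ] using h)
        exact ⟨by omega, this.2⟩
  rintro ⟨n, ⟨R⟩⟩ ⟨m, ⟨S⟩⟩ h
  obtain ⟨rfl, h⟩ := hn _ _ _ _ h
  have h' := flatten_ofFn_injective _ _ (fun i => by simp [encodeRel_length]) h
  have : R = S := funext fun i => encodeRel_injective (congrFun h' i)
  rw [this]

end TeamEnum

/-! A team over the free variables D of φ is a word of N = n ^ |D| bits, and its cardinality is the
number of ones. The task is therefore to list the nonzero words with the most ones in a set S of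
N-bit words, where membership in S is satisfaction of a fixed formula. This is done by a
lexicographically decreasing prefix search with an NP oracle.

The search runs in rounds on an array of 3N bits: the maximum number of ones in unary, the solution
under construction, and the previous solution. In a round each bit is replaced by the answer to one
question about the array as it then stands (`fill`, `Extends`, `Answer`). Bit i < N asks whether
some member of S has more than i ones, so these answers spell the maximum in unary. Bit N + p asks
whether some member of S with at least that many ones agrees with the bits fixed so far, has a one
at p, and precedes the previous solution; the answers build the largest remaining solution
(`round_bit`, `round_of_max`). The last N bits copy it (`round_copy`). Since solutions are nonzero,
the zero word can mean both "no previous solution" and "nothing left". Each round thus removes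
exactly the largest remaining solution (`exists_rounds`).

The oracle is in NP because φ is fixed. Satisfaction is certified by the teams arising at the
disjunctions and quantifiers of φ (`Certifies`), a constant number of subsets of the (n + 1) ^ m
partial assignments to m variables. Once assignments are coded by numbers in base n + 1, checking a
certificate is a matter of bounded quantifiers (`verifies_iff`, `PP.verifies`), and the certificate
also carries the word z that the question asks for (`mem_oracle_iff`).

On the machine side, the needed polynomial-time functions are generated from input bits, array bits,
addition, subtraction and bounded sums, each compiled to a relocatable code fragment (`PF`,
`PF.sum`). The working registers are cleared after every output, so a round starts in a
configuration that depends only on the array (`roundConfig`, `exists_roundMachine`). The bounds on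
delay, question length and register size then follow from bounds for a single round, although the
number of rounds may be exponential (`mem_Del_of_rounds`). -/

namespace TeamEnum

/-! ## Execution of program fragments -/

/-- The code `P` stands at position `p` of the program `M`. -/
def Seg (M : Program) : ℕ → List Instr → Prop
  | _, [] => True
  | p, i :: P => M[p]? = some i ∧ Seg M (p + 1) P

theorem Seg.append {M : Program} {p : ℕ} {P Q : List Instr} :
    Seg M p (P ++ Q) ↔ Seg M p P ∧ Seg M (p + P.length) Q := by
  induction P generalizing p with
  | nil => simp [Seg]
  | cons i P ih => simp [Seg, ih, and_assoc, add_assoc, add_comm 1]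

theorem Seg.of_append (A P : List Instr) : Seg (A ++ P) A.length P := by
  induction P generalizing A with
  | nil => trivial
  | cons i P ih =>
    refine ⟨by simp, ?_⟩
    have := ih (A ++ [i])
    simpa using this

theorem Seg.self (P : List Instr) : Seg P 0 P := Seg.of_append [] P

/-- The machine neither halts nor outputs in the next step. -/
def Quiet (M : Program) (c : Config) : Prop := ∃ i, M[c.pc]? = some i ∧ i ≠ .output

/-- `M` moves from `c` to `c'` in `t` steps without halting or giving an output. -/
def Go (M : Program) (L : Language Bool) (x : List Bool) (c : Config) (t : ℕ) (c' : Config) :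
    Prop :=
  (step M L x)^[t] c = c' ∧ ∀ s < t, Quiet M ((step M L x)^[s] c)

section
variable {M : Program} {L : Language Bool} {x : List Bool}

theorem Go.refl (c : Config) : Go M L x c 0 c := ⟨rfl, by simp⟩

theorem Go.trans {c c' c'' : Config} {t u : ℕ} (h : Go M L x c t c') (h' : Go M L x c' u c'') :
    Go M L x c (t + u) c'' := by
  obtain ⟨rfl, h2⟩ := h
  obtain ⟨rfl, h3⟩ := h'
  refine ⟨by rw [add_comm, Function.iterate_add_apply], fun s hs => ?_⟩
  by_cases h : s < t
  · exact h2 s h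
  · have := h3 (s - t) (by omega)
    rwa [← Function.iterate_add_apply, Nat.sub_add_cancel (by omega)] at this

theorem step_eq {c : Config} {i : Instr} (h : M[c.pc]? = some i) :
    step M L x c = exec L x c i := by
  simp [step, h]

theorem Go.cons {c c' : Config} {t : ℕ} {i : Instr} (h : M[c.pc]? = some i) (hi : i ≠ .output)
    (h' : Go M L x (exec L x c i) t c') : Go M L x c (t + 1) c' := by
  have : Go M L x c 1 (exec L x c i) := by
    refine ⟨by simp [step_eq h], fun s hs => ?_⟩
    obtain rfl : s = 0 := by omega
    exact ⟨i, h, hi⟩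
  rw [add_comm]
  exact this.trans h'

/-- `for i < b do body`, with the scratch register `s`. -/
def loopCode (i b s p : ℕ) (P : List Instr) : List Instr :=
  [.const i 0, .sub s b i, .jz s (p + 3 + P.length + 4)] ++
    (P ++ [.const s 1, .add i i s, .const s 0, .jz s (p + 1)])

theorem loopCode_length (i b s p : ℕ) (P : List Instr) :
    (loopCode i b s p P).length = 3 + P.length + 4 := by
  simp [loopCode]; omega

/-- The loop control touches only the program counter, `i` and `s`, so the invariant has to be
insensitive to these (`hI`). A pass costs the body plus 2 steps for the test and 4 for the increment
and the jump back; the summand 3 is the initialization and the last test. -/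
theorem Go.loop {i b s p : ℕ} {P : List Instr} (hib : i ≠ b) (his : i ≠ s) (hbs : b ≠ s)
    (hM : Seg M p (loopCode i b s p P)) (I : ℕ → Config → Prop) (n τ : ℕ)
    (hI : ∀ k c c', I k c → c'.query = c.query → c'.out = c.out →
      (∀ r, r ≠ i → r ≠ s → c'.reg r = c.reg r) → I k c')
    (body : ∀ k < n, ∀ c, c.pc = p + 3 → c.reg i = k → c.reg b = n → I k c →
      ∃ u ≤ τ, ∃ c', Go M L x c u c' ∧ c'.pc = p + 3 + P.length ∧ c'.reg i = k ∧
        c'.reg b = n ∧ I (k + 1) c')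
    (c : Config) (hpc : c.pc = p) (hb : c.reg b = n) (h0 : I 0 c) :
    ∃ u ≤ n * (τ + 6) + 3, ∃ c', Go M L x c u c' ∧ c'.pc = p + (loopCode i b s p P).length ∧
      I n c' := by
  rw [loopCode_length]
  unfold loopCode at hM
  rw [Seg.append, Seg.append] at hM
  obtain ⟨⟨m0, m1, m2, -⟩, -, m3, m4, m5, m6, -⟩ := hM
  simp only [List.length_cons, List.length_nil, zero_add, Nat.reduceAdd] at m3 m4 m5 m6
  -- Induction on the number `d` of passes that remain, starting at the loop test.
  have key : ∀ d k, k + d = n → ∀ c, c.pc = p + 1 → c.reg i = k → c.reg b = n → I k c →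
      ∃ u ≤ d * (τ + 6) + 2, ∃ c', Go M L x c u c' ∧ c'.pc = p + (3 + P.length + 4) ∧ I n c' := by
    intro d
    induction d with
    | zero =>
      intro k hk c hpc hi hb hIk
      obtain rfl : k = n := by omega
      refine ⟨2, by simp, _, Go.cons (hpc ▸ m1) (by simp)
        (Go.cons (i := .jz s (p + 3 + P.length + 4)) ?_ (by simp) (Go.refl _)), ?_, ?_⟩
      · simpa [exec, Config.set, hpc] using m2
      · simp [exec, Config.set, hi, hb]; omega
      · refine hI _ _ _ hIk (by simp [exec, Config.set]) (by simp [exec, Config.set]) ?_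
        intro r hr hs
        simp [exec, Config.set, hs]
    | succ d ih =>
      intro k hk c hpc hi hb hIk
      have g1 : Go M L x c 2 { c with pc := p + 3, reg := Function.update c.reg s (n - k) } := by
        refine Go.cons (hpc ▸ m1) (by simp)
          (Go.cons (i := .jz s (p + 3 + P.length + 4)) ?_ (by simp) ?_)
        · simpa [exec, Config.set, hpc] using m2
        · have : n - k ≠ 0 := by omega
          convert Go.refl _ using 1
          simp [exec, Config.set, hi, hb, hpc, this]
      obtain ⟨u, hu, c2, g2, hpc2, hi2, hb2, hI2⟩ := body k (by omega)
        { c with pc := p + 3, reg := Function.update c.reg s (n - k) } rfl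
        (by simp [his, hi]) (by simp [hbs, hb])
        (hI _ _ _ hIk rfl rfl (by intro r _ hs; simp [hs]))
      have g3 : Go M L x c2 4 { c2 with
          pc := p + 1
          reg := Function.update (Function.update c2.reg i (k + 1)) s 0 } := by
        refine Go.cons (hpc2 ▸ m3) (by simp) (Go.cons (i := .add i i s) ?_ (by simp)
          (Go.cons (i := .const s 0) ?_ (by simp) (Go.cons (i := .jz s (p + 1)) ?_ (by simp) ?_)))
        · simpa [exec, Config.set, hpc2] using m4
        · simpa [exec, Config.set, hpc2] using m5
        · simpa [exec, Config.set, hpc2] using m6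
        · convert Go.refl _ using 1
          simp only [exec, Config.set, Function.update_self, Config.mk.injEq, and_true]
          refine ⟨by simp, ?_⟩
          funext r
          simp only [Function.update_apply, hi2]
          split_ifs <;> simp_all
      obtain ⟨v, hv, c', g4, hpc', hI'⟩ := ih (k + 1) (by omega)
        { c2 with
          pc := p + 1
          reg := Function.update (Function.update c2.reg i (k + 1)) s 0 } rfl (by simp [his])
        (by simp [hbs, hib.symm, hb2])
        (hI _ _ _ hI2 rfl rfl (by intro r hr hs; simp [hs, hr]))
      exact ⟨_, by nlinarith, c', ((g1.trans g2).trans g3).trans g4, hpc', hI'⟩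
  obtain ⟨u, hu, c', g, h⟩ := key n 0 (by omega)
    { c with pc := p + 1, reg := Function.update c.reg i 0 } rfl (by simp)
    (by simp [hib.symm, hb]) (hI _ _ _ h0 rfl rfl (by intro r hr hs; simp [hr]))
  refine ⟨u + 1, by omega, c', Go.cons (hpc ▸ m0) (by simp) ?_, h⟩
  simpa [exec, Config.set, hpc] using g

end

/-! ## Contexts and polynomial bounds -/

/-- A context provides the input word, an array of bits, and the values of some variables. -/
class Ctx (Γ : Type) where
  inp : Γ → List Bool
  mem : Γ → ℕ → Bool
  vars : Γ → List ℕ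

open Ctx

instance : Ctx (List Bool × (ℕ → Bool)) where
  inp c := c.1
  mem c := c.2
  vars _ := []

/-- A loop body is evaluated in the context of the loop extended by the counter; nested loops give
nested products, innermost counter first. -/
instance {Γ : Type} [Ctx Γ] : Ctx (Γ × ℕ) where
  inp c := inp c.1
  mem c := mem c.1
  vars c := c.2 :: vars c.1

/-- The size of a context. -/
def Ctx.size {Γ : Type} [Ctx Γ] (c : Γ) : ℕ := (inp c).length + (vars c).sum

section
variable {Γ : Type} [Ctx Γ]

/-- Variables count with their value rather than their binary length, so a loop up to a variable is
polynomial. The array does not count at all. -/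
theorem size_prod (c : Γ × ℕ) : size c = size c.1 + c.2 := by
  simp [size, inp, vars]; omega

/-- Polynomially bounded functions of a context. -/
def PB (f : Γ → ℕ) : Prop := ∃ k, ∀ c, f c ≤ (size c + 2) ^ k

theorem PB.mono {f g : Γ → ℕ} (hg : PB g) (h : ∀ c, f c ≤ g c) : PB f := by
  obtain ⟨k, hk⟩ := hg
  exact ⟨k, fun c => (h c).trans (hk c)⟩

theorem PB.const (n : ℕ) : PB (fun _ : Γ => n) :=
  ⟨n, fun c => Nat.lt_two_pow_self.le.trans (Nat.pow_le_pow_left (by omega) _)⟩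

theorem PB.size : PB (fun c : Γ => size c) := ⟨1, fun c => by simp⟩

theorem PB.mul {f g : Γ → ℕ} (hf : PB f) (hg : PB g) : PB (fun c => f c * g c) := by
  obtain ⟨k, hk⟩ := hf
  obtain ⟨l, hl⟩ := hg
  exact ⟨k + l, fun c => by rw [pow_add]; exact Nat.mul_le_mul (hk c) (hl c)⟩

theorem PB.add {f g : Γ → ℕ} (hf : PB f) (hg : PB g) : PB (fun c => f c + g c) := by
  obtain ⟨k, hk⟩ := hf
  obtain ⟨l, hl⟩ := hg
  -- The extra factor `size c + 2 ≥ 2` absorbs the sum of two terms bounded by the power `k + l`.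
  refine ⟨k + l + 1, fun c => ?_⟩
  have h1 : (Ctx.size c + 2) ^ k ≤ (Ctx.size c + 2) ^ (k + l) :=
    Nat.pow_le_pow_right (by omega) (by omega)
  have h2 : (Ctx.size c + 2) ^ l ≤ (Ctx.size c + 2) ^ (k + l) :=
    Nat.pow_le_pow_right (by omega) (by omega)
  have := hk c
  have := hl c
  rw [pow_succ]
  nlinarith

theorem PB.pow {f : Γ → ℕ} (hf : PB f) (n : ℕ) : PB (fun c => f c ^ n) := by
  obtain ⟨k, hk⟩ := hf
  exact ⟨k * n, fun c => by rw [pow_mul]; exact Nat.pow_le_pow_left (hk c) n⟩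

theorem PB.weaken {f : Γ → ℕ} (hf : PB f) : PB (fun c : Γ × ℕ => f c.1) := by
  obtain ⟨k, hk⟩ := hf
  exact ⟨k, fun c => (hk c.1).trans (Nat.pow_le_pow_left (by rw [size_prod]; omega) _)⟩

/-- A bound for all values of the last variable up to a polynomially bounded one. -/
theorem PB.sup {f : Γ × ℕ → ℕ} {b : Γ → ℕ} (hf : PB f) (hb : PB b) :
    ∃ g : Γ → ℕ, PB g ∧ ∀ c, ∀ i ≤ b c, f (c, i) ≤ g c := by
  obtain ⟨k, hk⟩ := hf
  refine ⟨fun c => (Ctx.size c + b c + 2) ^ k, ((PB.size.add hb).add (PB.const 2)).pow k,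
    fun c i hi => (hk _).trans (Nat.pow_le_pow_left (by rw [size_prod]; simp; omega) _)⟩

/-! ## Functions computed by fragments -/

/-- `code α t B p` (standing at position `p`) computes `f` in time `τ` into register `t`. The
variables are in the registers `α`, the array starts at register `B`, and at most the registers
in `[t, t + K)` are changed. -/
def Computes (f τ : Γ → ℕ) (K : ℕ) (code : List ℕ → ℕ → ℕ → ℕ → List Instr) : Prop :=
  ∀ (α : List ℕ) (t B p : ℕ) (M : Program) (L : Language Bool) (c : Γ) (e : Config),
    (∀ r ∈ α, r < t) → t + K ≤ B → Seg M p (code α t B p) → e.pc = p → α.map e.reg = vars c →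
    (∀ j, e.reg (B + j) = (mem c j).toNat) →
    ∃ s ≤ τ c, ∃ ρ, Go M L (inp c) e s { e with pc := p + (code α t B p).length, reg := ρ } ∧
      ρ t = f c ∧ ∀ r, r < t ∨ B ≤ r → ρ r = e.reg r

/-- The functions of a context which are computable in polynomial time. -/
def PF (f : Γ → ℕ) : Prop :=
  PB f ∧ ∃ τ K code, PB τ ∧ Computes f τ K code

theorem PF.const (n : ℕ) : PF (fun _ : Γ => n) := by
  refine ⟨PB.const n, fun _ => 1, 1, fun _ t _ _ => [.const t n], PB.const 1, ?_⟩
  intro α t B p M L c e hα hB hM hpc hv hm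
  refine ⟨1, le_rfl, Function.update e.reg t n, Go.cons (hpc ▸ hM.1) (by simp) ?_, by simp, ?_⟩
  · convert Go.refl _ using 1
    simp [exec, Config.set, hpc]
  · intro r hr
    rw [Function.update_of_ne (by omega)]

theorem PF.length : PF (fun c : Γ => (inp c).length) := by
  refine ⟨PB.size.mono (by simp [Ctx.size]), fun _ => 1, 1, fun _ t _ _ => [.inputLength t],
    PB.const 1, ?_⟩
  intro α t B p M L c e hα hB hM hpc hv hm
  refine ⟨1, le_rfl, Function.update e.reg t (inp c).length, Go.cons (hpc ▸ hM.1) (by simp) ?_,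
    by simp, ?_⟩
  · convert Go.refl _ using 1
    simp [exec, Config.set, hpc]
  · intro r hr
    rw [Function.update_of_ne (by omega)]

theorem PF.var : PF (fun c : Γ × ℕ => c.2) := by
  -- There is no move instruction, so the variable is copied by adding it to 0.
  refine ⟨PB.size.mono (by simp [size_prod]), fun _ => 2, 2,
    fun α t _ _ => [.const t 0, .add t t (α.headD 0)], PB.const 2, ?_⟩
  intro α t B p M L c e hα hB hM hpc hv hm
  cases α with
  | nil => simp [vars] at hv
  | cons a α =>
    have ha : a < t := hα a (by simp)
    have hv : e.reg a = c.2 := by simp [vars] at hv; exact hv.1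
    refine ⟨2, le_rfl, Function.update e.reg t c.2, Go.cons (hpc ▸ hM.1) (by simp)
      (Go.cons (i := .add t t a) ?_ (by simp) ?_), by simp, ?_⟩
    · simpa [exec, Config.set, hpc] using hM.2.1
    · convert Go.refl _ using 1
      simp [exec, Config.set, hpc, ha.ne, hv]
    · intro r hr
      rw [Function.update_of_ne (by omega)]

theorem PF.weaken {f : Γ → ℕ} (hf : PF f) : PF (fun c : Γ × ℕ => f c.1) := by
  obtain ⟨hb, τ, K, code, hτ, hc⟩ := hf
  refine ⟨hb.weaken, _, K, fun α => code α.tail, hτ.weaken, ?_⟩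
  intro α t B p M L c e hα hB hM hpc hv hm
  cases α with
  | nil => simp [vars] at hv
  | cons a α =>
    have hv : α.map e.reg = vars c.1 := by simp [vars] at hv; exact hv.2
    exact hc α t B p M L c.1 e (fun r hr => hα r (by simp [hr])) hB hM hpc hv hm

/-- A unary operation that is computed by a short piece of straight-line code. -/
theorem PF.unary {f : Γ → ℕ} (hf : PF f) {g : Γ → ℕ} (hg : PB g) (Q : ℕ → ℕ → List Instr) (n : ℕ)
    (hQ : ∀ (t B p : ℕ) (M : Program) (L : Language Bool) (c : Γ) (e : Config), t + 2 ≤ B →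
      Seg M p (Q t B) → e.pc = p → e.reg t = f c → (∀ j, e.reg (B + j) = (mem c j).toNat) →
      ∃ ρ, Go M L (inp c) e n { e with pc := p + (Q t B).length, reg := ρ } ∧
        ρ t = g c ∧ ∀ r, r < t ∨ B ≤ r → ρ r = e.reg r) : PF g := by
  obtain ⟨hb, τ, K, code, hτ, hc⟩ := hf
  refine ⟨hg, fun c => τ c + n, K + 2, fun α t B p => code α t B p ++ Q t B,
    hτ.add (PB.const n), ?_⟩
  intro α t B p M L c e hα hB hM hpc hv hm
  rw [Seg.append] at hM
  obtain ⟨s, hs, ρ, g1, h1, h2⟩ := hc α t B p M L c e hα (by omega) hM.1 hpc hv hm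
  obtain ⟨ρ', g2, h3, h4⟩ := hQ t B _ M L c
    { e with pc := p + (code α t B p).length, reg := ρ } (by omega) hM.2 rfl h1
    (fun j => by rw [← hm]; exact h2 _ (by omega))
  refine ⟨s + n, by beta_reduce; omega, ρ', ?_, h3, fun r hr => (h4 r hr).trans (h2 r hr)⟩
  simpa [add_assoc] using g1.trans g2

theorem PF.bit {f : Γ → ℕ} (hf : PF f) :
    PF (fun c => if (inp c)[f c]? = some true then 1 else 0) := by
  refine hf.unary ((PB.const 1).mono fun c => by split_ifs <;> simp) (fun t _ => [.input t t]) 1 ?_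
  intro t B p M L c e hB hM hpc ht hm
  refine ⟨Function.update e.reg t (if (inp c)[f c]? = some true then 1 else 0),
    Go.cons (hpc ▸ hM.1) (by simp) ?_, by simp, ?_⟩
  · convert Go.refl _ using 1
    simp [exec, Config.set, hpc, ht]
  · intro r hr
    rw [Function.update_of_ne (by omega)]

/-- The base `B` of the array is a constant of the code, so one addition gives the address. The
scratch registers `t` and `t + 1` lie below `B` and do not collide with it. -/
theorem PF.mem {f : Γ → ℕ} (hf : PF f) : PF (fun c => (mem c (f c)).toNat) := by
  refine hf.unary ((PB.const 1).mono fun c => Bool.toNat_le _)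
    (fun t B => [.const (t + 1) B, .add t (t + 1) t, .load t t]) 3 ?_
  intro t B p M L c e hB hM hpc ht hm
  refine ⟨Function.update (Function.update e.reg (t + 1) B) t (Ctx.mem c (f c)).toNat,
    Go.cons (hpc ▸ hM.1) (by simp) (Go.cons (i := .add t (t + 1) t) ?_ (by simp)
      (Go.cons (i := .load t t) ?_ (by simp) ?_)), by simp, ?_⟩
  · simpa [exec, Config.set, hpc] using hM.2.1
  · simpa [exec, Config.set, hpc] using hM.2.2.1
  · convert Go.refl _ using 1
    have h1 : B + f c ≠ t := by omega
    have h2 : B + f c ≠ t + 1 := by omega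
    simp [exec, Config.set, hpc, ht, h1, h2, hm]
  · intro r hr
    rw [Function.update_of_ne (by omega), Function.update_of_ne (by omega)]

theorem PF.binary {f g : Γ → ℕ} (hf : PF f) (hg : PF g) {h : Γ → ℕ} (hh : PB h)
    (i : ℕ → Instr) (hi : ∀ t, i t ≠ .output)
    (hQ : ∀ (t : ℕ) (L : Language Bool) (c : Γ) (e : Config), e.reg t = f c →
      e.reg (t + 1) = g c → exec L (inp c) e (i t) = e.set t (h c)) : PF h := by
  obtain ⟨hb, τ, K, code, hτ, hc⟩ := hf
  obtain ⟨hb', τ', K', code', hτ', hc'⟩ := hg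
  refine ⟨hh, fun c => τ c + τ' c + 1, K + K' + 2, fun α t B p => code α t B p ++
    (code' α (t + 1) B (p + (code α t B p).length) ++ [i t]), (hτ.add hτ').add (PB.const 1), ?_⟩
  intro α t B p M L c e hα hB hM hpc hv hm
  rw [Seg.append, Seg.append] at hM
  obtain ⟨s, hs, ρ, g1, h1, h2⟩ := hc α t B p M L c e hα (by omega) hM.1 hpc hv hm
  obtain ⟨s', hs', ρ', g2, h3, h4⟩ := hc' α (t + 1) B _ M L c
    { e with pc := p + (code α t B p).length, reg := ρ } (fun r hr => (hα r hr).trans (by omega))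
    (by omega) hM.2.1 rfl
    (by rw [← hv]; exact List.map_congr_left fun r hr => h2 r (Or.inl (hα r hr)))
    (fun j => by rw [← hm]; exact h2 _ (by omega))
  refine ⟨s + s' + 1, by beta_reduce; omega, Function.update ρ' t (h c),
    (g1.trans g2).trans (Go.cons hM.2.2.1 (hi t) ?_), by simp, fun r hr => ?_⟩
  · rw [hQ t L c _ ((h4 t (by omega)).trans h1) h3]
    convert Go.refl _ using 1
    simp [Config.set, add_assoc]
  · rw [Function.update_of_ne (by omega), h4 r (by omega)]
    exact h2 r hr

theorem PF.add {f g : Γ → ℕ} (hf : PF f) (hg : PF g) : PF (fun c => f c + g c) :=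
  hf.binary hg (hf.1.add hg.1) (fun t => .add t t (t + 1)) (by simp)
    (by intro t L c e h1 h2; simp [exec, h1, h2])

theorem PF.sub {f g : Γ → ℕ} (hf : PF f) (hg : PF g) : PF (fun c => f c - g c) :=
  hf.binary hg (hf.1.mono fun c => Nat.sub_le _ _) (fun t => .sub t t (t + 1)) (by simp)
    (by intro t L c e h1 h2; simp [exec, h1, h2])

/-- The only source of iteration for numerical functions: products, division, counting and bounded
quantifiers all reduce to it. Register `t` accumulates, `t + 1` counts, `t + 2` holds the bound, `t
+ 3` is scratch, and the summand is computed from `t + 4` on. -/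
theorem PF.sum {b : Γ → ℕ} {g : Γ → ℕ → ℕ} (hb : PF b) (hg : PF (fun c : Γ × ℕ => g c.1 c.2)) :
    PF (fun c => ∑ i ∈ Finset.range (b c), g c i) := by
  obtain ⟨hbb, τ, K, code, hτ, hc⟩ := hb
  obtain ⟨hgb, τ', K', code', hτ', hc'⟩ := hg
  -- One time bound for all passes, since the counter stays below the polynomially bounded `b c`.
  obtain ⟨σ, hσ, hσ'⟩ := hτ'.sup hbb
  refine ⟨?_, fun c => τ c + 1 + (b c * (σ c + 1 + 6) + 3), K + K' + 6, fun α t B p =>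
    code α (t + 2) B p ++ (.const t 0 :: loopCode (t + 1) (t + 2) (t + 3)
      (p + (code α (t + 2) B p).length + 1)
      (code' ((t + 1) :: α) (t + 4) B (p + (code α (t + 2) B p).length + 1 + 3) ++
        [.add t t (t + 4)])), ?_, ?_⟩
  · obtain ⟨s, hs, hs'⟩ := hgb.sup hbb
    refine (hbb.mul hs).mono fun c => ?_
    rw [← smul_eq_mul]
    refine (Finset.sum_le_card_nsmul _ _ (s c) fun i hi => ?_).trans_eq (by simp)
    exact hs' c i (Finset.mem_range.1 hi).le
  · exact (hτ.add (PB.const 1)).add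
      ((hbb.mul ((hσ.add (PB.const 1)).add (PB.const 6))).add (PB.const 3))
  intro α t B p M L c e hα hB hM hpc hv hm
  rw [Seg.append] at hM
  obtain ⟨hM1, hM2, hM3⟩ := hM
  obtain ⟨s, hs, ρ, g1, h1, h2⟩ := hc α (t + 2) B p M L c e
    (fun r hr => (hα r hr).trans (by omega)) (by omega) hM1 hpc hv hm
  set q := p + (code α (t + 2) B p).length + 1 with hq
  set P := code' ((t + 1) :: α) (t + 4) B (q + 3) with hP
  have g2 : Go M L (inp c) { e with pc := p + (code α (t + 2) B p).length, reg := ρ } 1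
      { e with pc := q, reg := Function.update ρ t 0 } := by
    refine Go.cons hM2 (by simp) ?_
    convert Go.refl _ using 1
    simp [exec, Config.set, hq]
  obtain ⟨u, hu, e', g3, hpc', hreg, hfr, hqu, hou⟩ := Go.loop (L := L) (x := inp c) (by omega)
    (by omega) (by omega) hM3 (fun k e' => e'.reg t = ∑ i ∈ Finset.range k, g c i ∧
      (∀ r, r < t ∨ B ≤ r → e'.reg r = e.reg r) ∧ e'.query = e.query ∧ e'.out = e.out)
    (b c) (σ c + 1) (by
      rintro k e1 e2 ⟨i1, i2, i3, i4⟩ j1 j2 j3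
      refine ⟨by rw [j3 _ (by omega) (by omega), i1], fun r hr => ?_, by rw [j1, i3],
        by rw [j2, i4]⟩
      rw [j3 _ (by omega) (by omega), i2 r hr]) (by
      rintro k hk e1 hpc1 hi1 hb1 ⟨i1, i2, i3, i4⟩
      rw [loopCode, Seg.append, Seg.append, Seg.append] at hM3
      obtain ⟨-, ⟨hM3, hM4, -⟩, -⟩ := hM3
      obtain ⟨s2, hs2, ρ2, g4, h5, h6⟩ := hc' ((t + 1) :: α) (t + 4) B (q + 3) M L (c, k) e1
        (by
          intro r hr
          rcases List.mem_cons.1 hr with rfl | hr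
          · omega
          · have := hα r hr
            omega) (by omega) hM3 hpc1
        (by
          simp only [List.map_cons, vars, hi1, List.cons.injEq, true_and]
          rw [← hv]
          exact List.map_congr_left fun r hr => i2 r (Or.inl (hα r hr)))
        (fun j => by rw [i2 _ (by omega)]; exact hm j)
      refine ⟨s2 + 1, by have := hσ' c k hk.le; omega, _,
        g4.trans (Go.cons hM4 (by simp) (Go.refl _)), ?_, ?_, ?_, ?_, ?_, ?_, ?_⟩
      · simp [exec, Config.set, hP, add_assoc]
      · simp [exec, Config.set]
        rw [h6 _ (by omega), hi1]
      · simp [exec, Config.set]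
        rw [h6 _ (by omega), hb1]
      · simp [exec, Config.set]
        rw [h6 _ (by omega), h5, i1, Finset.sum_range_succ]
      · intro r hr
        simp only [exec, Config.set]
        rw [Function.update_of_ne (by omega), h6 _ (by omega), i2 r hr]
      · exact i3
      · exact i4)
    { e with pc := q, reg := Function.update ρ t 0 } rfl (by simp [h1])
    ⟨by simp, fun r hr => by
      rw [← h2 r (by omega)]
      exact Function.update_of_ne (by omega) _ _, rfl, rfl⟩
  refine ⟨s + 1 + u, by beta_reduce; omega, e'.reg, ?_, hreg, hfr⟩
  convert (g1.trans g2).trans g3 using 1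
  obtain ⟨pc', reg', query', out'⟩ := e'
  simp only at hpc' hqu hou
  subst hpc' hqu hou
  simp only [List.length_append, List.length_cons, Config.mk.injEq, and_true]
  rw [← hq, ← hP]
  omega

end

/-- `Computes` holds for every oracle, in particular the empty one. The initial all-zero registers
represent the all-false array, and the result lands in register 0. -/
theorem PF.ptime {f : List Bool × (ℕ → Bool) → ℕ} (hf : PF f) :
    ({v | f (v, fun _ => false) ≠ 0} : Language Bool) ∈ PTIME := by
  obtain ⟨-, τ, K, code, ⟨k, hk⟩, hc⟩ := hf
  refine ⟨code [] 0 K 0, (Polynomial.X + Polynomial.C 2) ^ k, fun v => ?_⟩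
  obtain ⟨s, hs, ρ, g, h1, -⟩ := hc [] 0 K 0 (code [] 0 K 0) 0 (v, fun _ => false) Config.init
    (by simp) (by simp) (Seg.self _) rfl rfl (fun j => rfl)
  refine ⟨s, hs.trans ((hk _).trans_eq (by simp [Ctx.size, inp, vars])), ?_⟩
  have : run (code [] 0 K 0) 0 v s = _ := g.1
  rw [this]
  refine ⟨by simp [Halted], ?_⟩
  simp only [h1]
  rfl

/-! ### Fragments that write words -/

section
variable {Γ : Type} [Ctx Γ]

/-- Append a word to the oracle question (`q = true`) or to the output word (`q = false`). -/
def Config.emit (q : Bool) (e : Config) (w : List Bool) : Config :=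
  { e with query := bif q then e.query ++ w else e.query, out := bif q then e.out else e.out ++ w }

/-- The word of length `n` with the bits `g i ≠ 0`. -/
def bitWord (n : ℕ) (g : ℕ → ℕ) : List Bool := (List.range n).map fun i => decide (g i ≠ 0)

/-- The loop of `PF.sum` with a write instruction in place of the accumulation. The flag `q` lets
one proof serve both oracle questions and outputs. -/
theorem PF.emit {N : Γ → ℕ} {g : Γ → ℕ → ℕ} (hN : PF N) (hg : PF (fun c : Γ × ℕ => g c.1 c.2))
    (q : Bool) : ∃ (τ : Γ → ℕ) (K : ℕ) (code : List ℕ → ℕ → ℕ → ℕ → List Instr), PB τ ∧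
    ∀ (α : List ℕ) (t B p : ℕ) (M : Program) (L : Language Bool) (c : Γ) (e : Config),
    (∀ r ∈ α, r < t) → t + K ≤ B → Seg M p (code α t B p) → e.pc = p → α.map e.reg = vars c →
    (∀ j, e.reg (B + j) = (Ctx.mem c j).toNat) →
    ∃ s ≤ τ c, ∃ ρ, Go M L (inp c) e s
      ({ e with pc := p + (code α t B p).length, reg := ρ }.emit q (bitWord (N c) (g c))) ∧
      ∀ r, r < t ∨ B ≤ r → ρ r = e.reg r := by
  obtain ⟨hbb, τ, K, code, hτ, hc⟩ := hN
  obtain ⟨hgb, τ', K', code', hτ', hc'⟩ := hg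
  obtain ⟨σ, hσ, hσ'⟩ := hτ'.sup hbb
  refine ⟨fun c => τ c + (N c * (σ c + 1 + 6) + 3), K + K' + 6, fun α t B p =>
    code α (t + 1) B p ++ loopCode t (t + 1) (t + 2) (p + (code α (t + 1) B p).length)
      (code' (t :: α) (t + 3) B (p + (code α (t + 1) B p).length + 3) ++
        [bif q then .writeQuery (t + 3) else .writeOutput (t + 3)]),
    hτ.add ((hbb.mul ((hσ.add (PB.const 1)).add (PB.const 6))).add (PB.const 3)), ?_⟩
  intro α t B p M L c e hα hB hM hpc hv hm
  rw [Seg.append] at hM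
  obtain ⟨hM1, hM3⟩ := hM
  obtain ⟨s, hs, ρ, g1, h1, h2⟩ := hc α (t + 1) B p M L c e
    (fun r hr => (hα r hr).trans (by omega)) (by omega) hM1 hpc hv hm
  set p' := p + (code α (t + 1) B p).length with hq
  set P := code' (t :: α) (t + 3) B (p' + 3) with hP
  obtain ⟨u, hu, e', g3, hpc', hfr, hqu, hou⟩ := Go.loop (L := L) (x := inp c) (by omega)
    (by omega) (by omega) hM3 (fun k e' =>
      (∀ r, r < t ∨ B ≤ r → e'.reg r = e.reg r) ∧
      e'.query = (e.emit q (bitWord k (g c))).query ∧ e'.out = (e.emit q (bitWord k (g c))).out)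
    (N c) (σ c + 1) (by
      rintro k e1 e2 ⟨i2, i3, i4⟩ j1 j2 j3
      refine ⟨fun r hr => ?_, by rw [j1, i3], by rw [j2, i4]⟩
      rw [j3 _ (by omega) (by omega), i2 r hr]) (by
      rintro k hk e1 hpc1 hi1 hb1 ⟨i2, i3, i4⟩
      rw [loopCode, Seg.append, Seg.append, Seg.append] at hM3
      obtain ⟨-, ⟨hM3, hM4, -⟩, -⟩ := hM3
      obtain ⟨s2, hs2, ρ2, g4, h5, h6⟩ := hc' (t :: α) (t + 3) B (p' + 3) M L (c, k) e1
        (by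
          intro r hr
          rcases List.mem_cons.1 hr with rfl | hr
          · omega
          · have := hα r hr
            omega) (by omega) hM3 hpc1
        (by
          simp only [List.map_cons, vars, hi1, List.cons.injEq, true_and]
          rw [← hv]
          exact List.map_congr_left fun r hr => i2 r (Or.inl (hα r hr)))
        (fun j => by rw [i2 _ (by omega)]; exact hm j)
      refine ⟨s2 + 1, by have := hσ' c k hk.le; omega, _,
        g4.trans (Go.cons hM4 (by cases q <;> simp) (Go.refl _)), ?_⟩
      have h7 : ρ2 t = k := by rw [h6 _ (by omega), hi1]
      have h8 : ρ2 (t + 1) = N c := by rw [h6 _ (by omega), hb1]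
      have h9 : ∀ r, r < t ∨ B ≤ r → ρ2 r = e.reg r := fun r hr => by
        rw [h6 _ (by omega), i2 r hr]
      simp only [Config.emit] at i3 i4
      cases q <;> simp [exec, hP, add_assoc, h5, h7, h8, i3, i4, Config.emit, bitWord,
        List.range_succ] <;> simpa using h9)
    { e with pc := p', reg := ρ } rfl (by simp [h1])
    ⟨fun r hr => h2 r (by omega), by cases q <;> simp [Config.emit, bitWord],
      by cases q <;> simp [Config.emit, bitWord]⟩
  refine ⟨s + u, by beta_reduce; omega, e'.reg, ?_, hfr⟩
  convert g1.trans g3 using 1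
  obtain ⟨pc', reg', query', out'⟩ := e'
  simp only at hpc' hqu hou
  subst hpc' hqu hou
  simp only [List.length_append, Config.emit, Config.mk.injEq, and_true]
  rw [← hq, ← hP]
  omega

end

/-! ## The enumeration machine -/

/-- The input word and an array of bits. -/
abbrev Base := List Bool × (ℕ → Bool)

open Classical in
/-- The bits number `0, …, k - 1` of the array `a` are replaced, one after the other, by the truth
values of `P`. -/
noncomputable def fill (P : (ℕ → Bool) → ℕ → Prop) (a : ℕ → Bool) : ℕ → ℕ → Bool
  | 0 => a
  | k + 1 => Function.update (fill P a k) k (decide (P (fill P a k) k))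

/-- Each pass writes a question, asks it and stores the answer in the array, so the next question
already sees the updated bit; this is the recursion of `fill`. Only `T` is evaluated once, at the
old array. The size of a `Base` context is the input length whatever the array contains, so the time
bound is uniform over arrays. -/
theorem fill_phase {T l : Base → ℕ} {g : Base × ℕ → ℕ → ℕ} (hT : PF T) (hl : PF l)
    (hg : PF (fun c : (Base × ℕ) × ℕ => g c.1 c.2)) :
    ∃ (k K : ℕ) (code : ℕ → ℕ → List Instr), ∀ (B p : ℕ) (M : Program) (L : Language Bool)
      (x : List Bool) (a : ℕ → Bool) (e : Config), K ≤ B → Seg M p (code B p) → e.pc = p →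
      e.query = [] → (∀ j, e.reg (B + j) = (a j).toNat) →
      ∃ s ≤ (x.length + 2) ^ k, ∃ ρ, Go M L x e s
        { e with pc := p + (code B p).length, reg := ρ } ∧
        ∀ j, ρ (B + j) =
          (fill (fun a i => bitWord (l (x, a)) (g ((x, a), i)) ∈ L) a (T (x, a)) j).toNat := by
  obtain ⟨hbb, τ, K, code, hτ, hc⟩ := hT
  obtain ⟨τ', K', code', ⟨k', hτ'⟩, hc'⟩ := hl.weaken.emit hg true
  have hPB : PB (fun c : Base => τ c + (T c * ((size c + T c + 2) ^ k' + 4 + 6) + 3)) :=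
    hτ.add ((hbb.mul ((((((PB.size.add hbb).add (PB.const 2))).pow k').add (PB.const 4)).add
      (PB.const 6))).add (PB.const 3))
  obtain ⟨k, hk⟩ := hPB
  refine ⟨k, K + K' + 10, fun B p => code [] 2 B p ++ loopCode 1 2 3
    (p + (code [] 2 B p).length) (code' [1] 4 B (p + (code [] 2 B p).length + 3) ++
      -- Register 4 receives the answer and register 5 the address, `B` plus the loop counter in
      -- register 1.
      [.ask 4, .const 5 B, .add 5 5 1, .store 5 4]), ?_⟩
  intro B p M L x a e hB hM hpc hqe hm
  rw [Seg.append] at hM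
  obtain ⟨hM1, hM3⟩ := hM
  obtain ⟨s, hs, ρ, g1, h1, h2⟩ := hc [] 2 B p M L (x, a) e (by simp) (by omega) hM1 hpc rfl hm
  replace g1 : Go M L x _ _ _ := g1
  set p' := p + (code [] 2 B p).length with hq
  set P := code' [1] 4 B (p' + 3) with hP
  obtain ⟨u, hu, e', g3, hpc', hfr, hqu, hou⟩ := Go.loop (L := L) (x := x) (by omega)
    (by omega) (by omega) hM3 (fun k e' =>
      (∀ j, e'.reg (B + j) =
        (fill (fun a i => bitWord (l (x, a)) (g ((x, a), i)) ∈ L) a k j).toNat) ∧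
      e'.query = [] ∧ e'.out = e.out)
    (T (x, a)) ((x.length + T (x, a) + 2) ^ k' + 4) (by
      rintro k e1 e2 ⟨i2, i3, i4⟩ j1 j2 j3
      refine ⟨fun r => ?_, by rw [j1, i3], by rw [j2, i4]⟩
      rw [j3 _ (by omega) (by omega), i2 r]) (by
      rintro k hk ⟨pc1, reg1, query1, out1⟩ hpc1 hi1 hb1 ⟨i2, i3, i4⟩
      simp only at hpc1 hi1 hb1 i2 i3 i4
      subst i3
      rw [loopCode, Seg.append, Seg.append, Seg.append] at hM3
      obtain ⟨-, ⟨hM3, hM4, hM5, hM6, hM7, -⟩, -⟩ := hM3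
      obtain ⟨s2, hs2, ρ2, g4, h6⟩ := hc' [1] 4 B (p' + 3) M L
        ((x, fill (fun a i => bitWord (l (x, a)) (g ((x, a), i)) ∈ L) a k), k)
        ⟨pc1, reg1, [], out1⟩ (by simp) (by omega) hM3
        hpc1 (by simp [vars, hi1]) i2
      have hs3 := hs2.trans (hτ' _)
      have hs4 : s2 ≤ (x.length + T (x, a) + 2) ^ k' :=
        hs3.trans (Nat.pow_le_pow_left (by simp [Ctx.size, inp, vars]; omega) _)
      refine ⟨s2 + 4, by omega, _,
        g4.trans (Go.cons hM4 (by simp) (Go.cons (i := .const 5 B) ?_ (by simp) (Go.cons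
          (i := .add 5 5 1) ?_ (by simp) (Go.cons (i := .store 5 4) ?_ (by simp)
          (Go.refl _))))), ?_⟩
      · simpa [exec, Config.set, Config.emit] using hM5
      · simpa [exec, Config.set, Config.emit] using hM6
      · simpa [exec, Config.set, Config.emit] using hM7
      have h7 : ρ2 1 = k := (h6 _ (by omega)).trans hi1
      have h8 : ρ2 2 = T (x, a) := (h6 _ (by omega)).trans hb1
      have h9 : ∀ j, ρ2 (B + j) = _ := fun r => (h6 _ (by omega)).trans (i2 r)
      have h10 : ∀ r < 6, r ≠ B + k := by omega
      refine ⟨?_, ?_, ?_, ?_, ?_, ?_⟩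
      · simp [exec, Config.set, Config.emit, hP, add_assoc]
      · simp [exec, Config.set, Config.emit, h7, h10]
      · simp [exec, Config.set, Config.emit, h7, h8, h10]
      · intro j
        by_cases hj : j = k
        · subst hj
          simp [exec, Config.set, Config.emit, h7, fill, Bool.toNat]
          split_ifs with h <;> simp [h]
        · have h11 : B + j ≠ 5 := by omega
          have h12 : B + j ≠ 4 := by omega
          simp [exec, Config.set, Config.emit, h7, fill, hj, h11, h12, h9]
      · simp [exec, Config.set, Config.emit]
      · simp [exec, Config.set, Config.emit, i4])
    { e with pc := p', reg := ρ } rfl (by simp [h1])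
    ⟨fun r => (h2 _ (by omega)).trans (hm r), hqe, rfl⟩
  have hk' := hk (x, a)
  simp only [Ctx.size, inp, vars, List.sum_nil, add_zero] at hk'
  refine ⟨s + u, by omega, e'.reg, ?_, hfr⟩
  convert g1.trans g3 using 1
  obtain ⟨pc', reg', query', out'⟩ := e'
  simp only at hpc' hqu hou
  subst hpc' hqu hou
  simp only [List.length_append, Config.mk.injEq, and_true, hqe]
  rw [← hq, ← hP]
  omega

/-- Set the registers `0, …, B - 1` to `0`. -/
def clearCode (B : ℕ) : List Instr := (List.range B).map fun r => .const r 0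

theorem clear_phase {B p : ℕ} {M : Program} {L : Language Bool} {x : List Bool} {e : Config}
    (hM : Seg M p (clearCode B)) (hpc : e.pc = p) :
    Go M L x e B { e with pc := p + B, reg := fun r => if r < B then 0 else e.reg r } := by
  induction B with
  | zero => subst hpc; exact Go.refl _
  | succ B ih =>
    rw [clearCode, List.range_succ, List.map_append, Seg.append] at hM
    refine (ih hM.1).trans (Go.cons (i := .const B 0) (by simpa using hM.2.1) (by simp) ?_)
    convert Go.refl _ using 1
    simp only [exec, Config.set, Config.mk.injEq, and_true]
    refine ⟨rfl, ?_⟩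
    funext r
    by_cases h : r = B
    · subst h; simp
    · simp only [Function.update_of_ne h]
      split_ifs <;> first | rfl | omega

/-- The configuration at the beginning of a round. -/
def roundConfig (B : ℕ) (a : ℕ → Bool) : Config :=
  ⟨0, fun r => if r < B then 0 else (a (r - B)).toNat, [], []⟩

/-- The program is one endless cycle: fill the array, test `h`, write and output a word, clear the
registers below `B`, restart. Clearing makes the next configuration a function of the array alone.
-/
theorem exists_roundMachine {T l h N : Base → ℕ} {g : Base × ℕ → ℕ → ℕ} {o : Base → ℕ → ℕ}
    (hT : PF T) (hl : PF l) (hg : PF (fun c : (Base × ℕ) × ℕ => g c.1 c.2)) (hh : PF h) (hN : PF N)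
    (ho : PF (fun c : Base × ℕ => o c.1 c.2)) :
    ∃ (M : Program) (B k : ℕ), ∀ (L : Language Bool) (x : List Bool) (a b : ℕ → Bool),
      fill (fun a i => bitWord (l (x, a)) (g ((x, a), i)) ∈ L) a (T (x, a)) = b →
      (h (x, b) = 0 → ∃ s ≤ (x.length + 2) ^ k, ∃ e, Go M L x (roundConfig B a) s e ∧
        Halted M e) ∧
      (h (x, b) ≠ 0 → ∃ s ≤ (x.length + 2) ^ k, ∃ e, Go M L x (roundConfig B a) s e ∧
        Outputs M e (bitWord (N (x, b)) (o (x, b))) ∧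
        ∃ u ≤ (x.length + 2) ^ k, Go M L x (step M L x e) u (roundConfig B b)) := by
  obtain ⟨k1, K1, code1, hc1⟩ := fill_phase hT hl hg
  obtain ⟨-, τ2, K2, code2, ⟨k2, hτ2⟩, hc2⟩ := hh
  obtain ⟨τ3, K3, code3, ⟨k3, hτ3⟩, hc3⟩ := hN.emit ho false
  set B := K1 + K2 + K3 + 1 with hB
  set P1 := code1 B 0
  set P2 := code2 [] 0 B P1.length
  set P3 := code3 [] 0 B (P1.length + P2.length + 1)
  -- The target of the first jump is the length of the program, so jumping there halts. The final
  -- `jz 0 0` always jumps, register 0 having just been cleared.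
  set M : Program := P1 ++ (P2 ++ (.jz 0 (P1.length + P2.length + 1 + P3.length + 1 + B + 1) ::
    (P3 ++ (.output :: (clearCode B ++ [.jz 0 0]))))) with hM
  have hlen : M.length = P1.length + P2.length + 1 + P3.length + 1 + B + 1 := by
    simp [hM, clearCode]; omega
  have hS : Seg M 0 M := Seg.self _
  nth_rewrite 2 [hM] at hS
  rw [Seg.append, Seg.append] at hS
  obtain ⟨hS1, hS2, hS3, hS4⟩ := hS
  rw [Seg.append] at hS4
  obtain ⟨hS4, hS5, hS6⟩ := hS4
  rw [Seg.append] at hS6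
  obtain ⟨hS6, hS7, -⟩ := hS6
  have hcl : (clearCode B).length = B := by simp [clearCode]
  simp only [zero_add, hcl] at hS1 hS2 hS3 hS4 hS5 hS6 hS7
  obtain ⟨k, hk⟩ : PB (fun c : Base => (size c + 2) ^ k1 + (size c + 2) ^ k2 + (size c + 2) ^ k3 +
      (B + 3)) :=
    ((((PB.size.add (PB.const 2)).pow k1).add ((PB.size.add (PB.const 2)).pow k2)).add
      ((PB.size.add (PB.const 2)).pow k3)).add (PB.const (B + 3))
  refine ⟨M, B, k, fun L x a b hab => ?_⟩
  have hk := hk (x, b)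
  have e2 := hτ2 (x, b)
  have e3 := hτ3 (x, b)
  simp only [size, inp, vars, List.sum_nil, add_zero] at hk e2 e3
  obtain ⟨s1, hs1, ρ1, g1, h1⟩ := hc1 B 0 M L x a (roundConfig B a) (by omega) hS1 rfl rfl
    (by simp [roundConfig])
  rw [hab] at h1
  obtain ⟨s2, hs2, ρ2, g2, h2, h2'⟩ := hc2 [] 0 B P1.length M L (x, b)
    ⟨P1.length, ρ1, [], []⟩ (by simp) (by omega) hS2 rfl rfl h1
  have g12 : Go M L x _ _ _ := (Go.trans (by simpa [roundConfig] using g1) (by exact g2))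
  constructor
  · intro h0
    refine ⟨s1 + s2 + 1, by omega, _, g12.trans (Go.cons hS3 (by simp) (Go.refl _)), ?_⟩
    simp [Halted, exec, h2, h0, hlen]
  · intro h0
    obtain ⟨s3, hs3, ρ3, g3, h3⟩ := hc3 [] 0 B (P1.length + P2.length + 1) M L (x, b)
      ⟨P1.length + P2.length + 1, ρ2, [], []⟩ (by simp) (by omega) hS4 rfl rfl
      (fun j => (h2' _ (by omega)).trans (h1 j))
    have e0 : exec L x ⟨P1.length + P2.length, ρ2, [], []⟩
        (.jz 0 (P1.length + P2.length + 1 + P3.length + 1 + B + 1)) =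
        ⟨P1.length + P2.length + 1, ρ2, [], []⟩ := by
      have : ρ2 0 ≠ 0 := by rwa [h2]
      simp [exec, this]
    have g123 := g12.trans (Go.cons hS3 (by simp) (t := s3) (by erw [e0]; exact g3))
    refine ⟨s1 + s2 + (s3 + 1), by omega, _, g123, ⟨hS5, by simp [Config.emit]⟩, ?_⟩
    refine ⟨B + 1, by omega, ?_⟩
    rw [step_eq (i := .output) (by exact hS5)]
    refine (clear_phase (by exact hS6) rfl).trans (Go.cons hS7 (by simp) ?_)
    convert Go.refl _ using 1
    have : (0 : ℕ) < B := by omega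
    simp only [roundConfig, exec, this, if_true, Config.emit, Config.mk.injEq, and_true, true_and,
      cond_false]
    funext r
    split_ifs with hr
    · rfl
    · obtain ⟨j, rfl⟩ := Nat.exists_eq_add_of_le (not_lt.1 hr)
      rw [h3 _ (by omega)]
      simp only [Nat.add_sub_cancel_left]
      exact ((h2' _ (by omega)).trans (h1 j)).symm

/-! ## Enumeration with polynomial delay -/

section
variable {M : Program} {L : Language Bool} {x : List Bool}

theorem Quiet.not_outputs {c : Config} (h : Quiet M c) (y : List Bool) : ¬ Outputs M c y := by
  obtain ⟨i, h1, h2⟩ := h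
  rintro ⟨h3, -⟩
  rw [h1] at h3
  exact h2 (Option.some.inj h3)

theorem Halted.iterate {c : Config} (h : Halted M c) (t : ℕ) : (step M L x)^[t] c = c := by
  have : step M L x c = c := by
    unfold Halted at h
    simp [step, h]
  exact Function.iterate_fixed this t

/-- Locates outputs and halting: neither occurs during a quiet run, so both can be shifted to its
end. -/
theorem Go.quiet_or {c e : Config} {s : ℕ} (h : Go M L x c s e) (t : ℕ) :
    (t < s ∧ Quiet M ((step M L x)^[t] c)) ∨
      ∃ u, t = s + u ∧ (step M L x)^[t] c = (step M L x)^[u] e := by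
  by_cases ht : t < s
  · exact Or.inl ⟨ht, h.2 t ht⟩
  · refine Or.inr ⟨t - s, by omega, ?_⟩
    rw [← h.1, ← Function.iterate_add_apply]
    congr 1
    omega

variable (M L x) in
/-- Starting in the configuration `c`, the machine outputs the words of a list, with delays less
than `d`, and halts. -/
def Produces (d : ℕ) : Config → List (List Bool) → Prop
  | c, [] => ∃ s < d, ∃ e, Go M L x c s e ∧ Halted M e
  | c, w :: ws => ∃ s < d, ∃ e, Go M L x c s e ∧ Outputs M e w ∧ Produces d (step M L x e) ws

theorem Produces.mem_iff {d : ℕ} {ws : List (List Bool)} {c : Config}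
    (h : Produces M L x d c ws) (y : List Bool) :
    y ∈ ws ↔ ∃ t, Outputs M ((step M L x)^[t] c) y := by
  induction ws generalizing c with
  | nil =>
    obtain ⟨s, -, e, g, he⟩ := h
    simp only [List.not_mem_nil, false_iff, not_exists]
    intro t ho
    rcases g.quiet_or t with ⟨-, hq⟩ | ⟨u, -, hu⟩
    · exact hq.not_outputs y ho
    · rw [hu, he.iterate] at ho
      have := ho.1
      rw [he] at this
      cases this
  | cons w ws ih =>
    obtain ⟨s, -, e, g, hw, h⟩ := h
    rw [List.mem_cons, ih h]
    constructor
    · rintro (rfl | ⟨t, ht⟩)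
      · exact ⟨s, by rwa [g.1]⟩
      · refine ⟨t + 1 + s, ?_⟩
        rwa [Function.iterate_add_apply, g.1, Function.iterate_succ_apply]
    · rintro ⟨t, ho⟩
      rcases g.quiet_or t with ⟨-, hq⟩ | ⟨u, -, hu⟩
      · exact (hq.not_outputs y ho).elim
      · rw [hu] at ho
        cases u with
        | zero => exact Or.inl (ho.2.symm.trans hw.2)
        | succ u => exact Or.inr ⟨u, by rwa [Function.iterate_succ_apply] at ho⟩

theorem Produces.unique {d : ℕ} {ws : List (List Bool)} {c : Config}
    (h : Produces M L x d c ws) (hws : ws.Nodup) (y : List Bool) (t t' : ℕ)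
    (ht : Outputs M ((step M L x)^[t] c) y) (ht' : Outputs M ((step M L x)^[t'] c) y) :
    t = t' := by
  induction ws generalizing c t t' with
  | nil => exact absurd ((h.mem_iff y).2 ⟨t, ht⟩) (by simp)
  | cons w ws ih =>
    obtain ⟨s, -, e, g, hw, h⟩ := h
    rw [List.nodup_cons] at hws
    rcases g.quiet_or t with ⟨-, hq⟩ | ⟨u, rfl, hu⟩
    · exact (hq.not_outputs y ht).elim
    rcases g.quiet_or t' with ⟨-, hq⟩ | ⟨u', rfl, hu'⟩
    · exact (hq.not_outputs y ht').elim
    rw [hu] at ht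
    rw [hu'] at ht'
    have key : ∀ v, Outputs M ((step M L x)^[v + 1] e) y → y ≠ w := by
      rintro v hv rfl
      exact hws.1 ((h.mem_iff y).2 ⟨v, by rwa [Function.iterate_succ_apply] at hv⟩)
    cases u with
    | zero =>
      cases u' with
      | zero => rfl
      | succ u' => exact absurd (ht.2.symm.trans hw.2) (key u' ht')
    | succ u =>
      cases u' with
      | zero => exact absurd (ht'.2.symm.trans hw.2) (key u ht)
      | succ u' =>
        rw [Function.iterate_succ_apply] at ht ht'
        rw [ih h hws.2 u u' ht ht']

theorem Produces.halts {d : ℕ} {ws : List (List Bool)} {c : Config}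
    (h : Produces M L x d c ws) : ∃ t, Halted M ((step M L x)^[t] c) := by
  induction ws generalizing c with
  | nil =>
    obtain ⟨s, -, e, g, he⟩ := h
    exact ⟨s, by rwa [g.1]⟩
  | cons w ws ih =>
    obtain ⟨s, -, e, g, hw, h⟩ := h
    obtain ⟨t, ht⟩ := ih h
    refine ⟨t + 1 + s, ?_⟩
    rwa [Function.iterate_add_apply, g.1, Function.iterate_succ_apply]

theorem Produces.delay {d : ℕ} {ws : List (List Bool)} {c : Config}
    (h : Produces M L x d c ws) (t : ℕ) : ∃ t', t ≤ t' ∧ t' < t + d ∧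
      (Halted M ((step M L x)^[t'] c) ∨ ∃ y, Outputs M ((step M L x)^[t'] c) y) := by
  induction ws generalizing c t with
  | nil =>
    obtain ⟨s, hs, e, g, he⟩ := h
    refine ⟨max s t, by omega, by omega, Or.inl ?_⟩
    rcases g.quiet_or (max s t) with ⟨hq, -⟩ | ⟨u, -, hu⟩
    · omega
    · rwa [hu, he.iterate]
  | cons w ws ih =>
    obtain ⟨s, hs, e, g, hw, h⟩ := h
    by_cases hts : t ≤ s
    · exact ⟨s, hts, by omega, Or.inr ⟨w, by rwa [g.1]⟩⟩
    · obtain ⟨t', h1, h2, h3⟩ := ih h (t - s - 1)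
      refine ⟨t' + 1 + s, by omega, by omega, ?_⟩
      rwa [Function.iterate_add_apply, g.1, Function.iterate_succ_apply]

theorem Produces.enumerates {d : ℕ} {ws : List (List Bool)} {S : Set (List Bool)}
    (h : Produces M L x d Config.init ws) (hws : ws.Nodup) (hS : ∀ y, y ∈ S ↔ y ∈ ws) :
    EnumeratesWithDelay M L x S d :=
  ⟨fun y => (hS y).trans (h.mem_iff y), h.unique hws, h.halts, h.delay⟩

/-! ### Growth of registers and oracle questions -/

theorem step_reg_lt {b : ℕ} (hM : ∀ r k, Instr.const r k ∈ M → k < 2 ^ b) (hx : x.length < 2 ^ b)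
    {c : Config} (hc : ∀ r, c.reg r < 2 ^ b) (r : ℕ) : (step M L x c).reg r < 2 ^ (b + 1) := by
  have h0 : ∀ r, c.reg r < 2 ^ (b + 1) := fun r => (hc r).trans (Nat.pow_lt_pow_succ (by omega))
  have h1 : 1 < 2 ^ (b + 1) := Nat.one_lt_two_pow (by omega)
  have hset : ∀ q v, v < 2 ^ (b + 1) → (c.set q v).reg r < 2 ^ (b + 1) := by
    intro q v hv
    simp only [Config.set, Function.update_apply]
    split_ifs
    exacts [hv, h0 r]
  cases hi : M[c.pc]? with
  | none => simpa [step, hi] using h0 r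
  | some i =>
    rw [step_eq hi]
    have h2 : 2 ^ (b + 1) = 2 ^ b + 2 ^ b := by rw [pow_succ]; omega
    cases i with
    | const q k =>
      exact hset _ _ (h2 ▸ (hM q k (List.mem_of_getElem? hi)).trans_le (Nat.le_add_left _ _))
    | add q a a' => exact hset _ _ (by have := hc a; have := hc a'; omega)
    | sub q a a' => exact hset _ _ (by have := h0 a; omega)
    | load q a => exact hset _ _ (h0 _)
    | store a a' => exact hset _ _ (h0 _)
    | inputLength q => exact hset _ _ (by omega)
    | input q a => exact hset _ _ (by split_ifs <;> omega)
    | ask q => exact hset _ _ (by split_ifs <;> omega)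
    | _ => exact h0 r

theorem step_query_length (c : Config) :
    (step M L x c).query.length ≤ c.query.length + 1 := by
  cases hi : M[c.pc]? with
  | none => simp [step, hi]
  | some i =>
    rw [step_eq hi]
    cases i <;> simp [exec, Config.set]

/-- Only addition can create a value above the common bound, and it at most doubles that bound;
every step therefore costs one bit. -/
theorem iterate_reg_lt {b : ℕ} (hM : ∀ r k, Instr.const r k ∈ M → k < 2 ^ b)
    (hx : x.length < 2 ^ b) {c : Config} (hc : ∀ r, c.reg r < 2 ^ b) (s r : ℕ) :
    ((step M L x)^[s] c).reg r < 2 ^ (b + s) := by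
  induction s generalizing r with
  | zero => exact hc r
  | succ s ih =>
    rw [Function.iterate_succ_apply']
    have h : 2 ^ b ≤ 2 ^ (b + s) := Nat.pow_le_pow_right (by omega) (by omega)
    exact step_reg_lt (b := b + s) (fun r k hk => (hM r k hk).trans_le h) (hx.trans_le h) ih r

theorem iterate_query_length (c : Config) (s : ℕ) :
    ((step M L x)^[s] c).query.length ≤ c.query.length + s := by
  induction s with
  | zero => simp
  | succ s ih =>
    rw [Function.iterate_succ_apply']
    exact (step_query_length _).trans (by omega)

theorem exists_const_bound (M : Program) :
    ∃ K, ∀ r k, Instr.const r k ∈ M → k < 2 ^ K := by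
  induction M with
  | nil => exact ⟨0, by simp⟩
  | cons i M ih =>
    obtain ⟨K, hK⟩ := ih
    have : ∃ K', ∀ r k, Instr.const r k = i → k < 2 ^ K' := by
      cases i with
      | const r k => exact ⟨k, by rintro _ _ ⟨⟩; exact Nat.lt_two_pow_self⟩
      | _ => exact ⟨0, by simp⟩
    obtain ⟨K', hK'⟩ := this
    refine ⟨K + K', fun r k hk => ?_⟩
    rcases List.mem_cons.1 hk with hk | hk
    · exact (hK' r k hk).trans_le (Nat.pow_le_pow_right (by omega) (by omega))
    · exact (hK r k hk).trans_le (Nat.pow_le_pow_right (by omega) (by omega))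

end

/-- The machine with round function `nxt`, halting condition `h` and output function `out` outputs
a list of words when it is started with the array `a`. -/
def Rounds (nxt : (ℕ → Bool) → ℕ → Bool) (h : (ℕ → Bool) → ℕ) (out : (ℕ → Bool) → List Bool) :
    (ℕ → Bool) → List (List Bool) → Prop
  | a, [] => h (nxt a) = 0
  | a, w :: ws => h (nxt a) ≠ 0 ∧ out (nxt a) = w ∧ Rounds nxt h out (nxt a) ws

/-- With D bounding each half of a round (before and after the output), two halves separate
consecutive outputs. Registers and questions are controlled by restarting the count at each round,
where all registers are at most 1 and the question is empty. -/
theorem mem_Del_of_rounds {C : Set (Language Bool)} {L : Language Bool} (hL : L ∈ C)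
    {T l h N : Base → ℕ} {g : Base × ℕ → ℕ → ℕ} {o : Base → ℕ → ℕ}
    (hT : PF T) (hl : PF l) (hg : PF (fun c : (Base × ℕ) × ℕ => g c.1 c.2)) (hh : PF h) (hN : PF N)
    (ho : PF (fun c : Base × ℕ => o c.1 c.2)) {E : EnumProblem}
    (hE : ∀ x, ∃ ws : List (List Bool), ws.Nodup ∧ (∀ y, y ∈ E x ↔ y ∈ ws) ∧
      Rounds (fun a => fill (fun a i => bitWord (l (x, a)) (g ((x, a), i)) ∈ L) a (T (x, a)))
        (fun a => h (x, a)) (fun a => bitWord (N (x, a)) (o (x, a))) (fun _ => false) ws) :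
    E ∈ Del C := by
  obtain ⟨M, B, k, hM⟩ := exists_roundMachine hT hl hg hh hN ho
  obtain ⟨K, hK⟩ := exists_const_bound M
  refine ⟨L, hL, M, Polynomial.C 2 * (Polynomial.X + Polynomial.C 2) ^ k + Polynomial.X +
    Polynomial.C (K + 2), fun x => ?_⟩
  have hp : (Polynomial.C 2 * (Polynomial.X + Polynomial.C 2) ^ k + Polynomial.X +
    Polynomial.C (K + 2) : Polynomial ℕ).eval x.length =
      2 * (x.length + 2) ^ k + x.length + (K + 2) := by
    simp only [Polynomial.eval_add, Polynomial.eval_mul, Polynomial.eval_pow, Polynomial.eval_C,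
      Polynomial.eval_X]
  set D := (x.length + 2) ^ k
  rw [hp]
  set nxt : (ℕ → Bool) → ℕ → Bool :=
    fun a => fill (fun a i => bitWord (l (x, a)) (g ((x, a), i)) ∈ L) a (T (x, a))
  have hM1 := fun a => hM L x a (nxt a) rfl
  have hinit : Config.init = roundConfig B (fun _ => false) := by
    simp [Config.init, roundConfig]
  have hpos : 1 ≤ D := Nat.one_le_pow _ _ (by omega)
  refine ⟨?_, ?_⟩
  · obtain ⟨ws, hws, hS, hR⟩ := hE x
    refine Produces.enumerates ?_ hws hS
    -- The start `c` lies up to D steps before the round, to account for the clearing that follows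
    -- the previous output.
    have key : ∀ (ws : List (List Bool)) (a : ℕ → Bool), Rounds nxt (fun a => h (x, a))
        (fun a => bitWord (N (x, a)) (o (x, a))) a ws → ∀ c, ∀ u ≤ D,
        Go M L x c u (roundConfig B a) →
        Produces M L x (2 * D + x.length + (K + 2)) c ws := by
      intro ws
      induction ws with
      | nil =>
        intro a ha c u hu g
        obtain ⟨s, hs, e, g', he⟩ := (hM1 a).1 ha
        exact ⟨u + s, by omega, e, g.trans g', he⟩
      | cons w ws ih =>
        rintro a ⟨ha, hw, hr⟩ c u hu g
        obtain ⟨s, hs, e, g', he, v, hv, g''⟩ := (hM1 a).2 ha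
        exact ⟨u + s, by omega, e, g.trans g', hw ▸ he, ih _ hr _ v hv g''⟩
    exact key ws _ hR _ 0 (by omega) (hinit ▸ Go.refl _)
  -- For an arbitrary array a round halts or reaches the next round; the extra step is the output
  -- instruction itself.
  have hround : ∀ a, ∃ s ≤ 2 * D + 1, Halted M ((step M L x)^[s] (roundConfig B a)) ∨
      1 ≤ s ∧ ∃ b, (step M L x)^[s] (roundConfig B a) = roundConfig B b := by
    intro a
    by_cases ha : h (x, nxt a) = 0
    · obtain ⟨s, hs, e, g', he⟩ := (hM1 a).1 ha
      exact ⟨s, by omega, Or.inl (by rwa [g'.1])⟩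
    · obtain ⟨s, hs, e, g', he, v, hv, g''⟩ := (hM1 a).2 ha
      refine ⟨v + 1 + s, by omega, Or.inr ⟨by omega, nxt a, ?_⟩⟩
      rw [Function.iterate_add_apply, g'.1, Function.iterate_succ_apply, g''.1]
  choose σ hσ hσ' using hround
  -- Every configuration of the whole run is only a few steps away from the start of some round.
  have hrun : ∀ t, ∃ a, ∃ s ≤ σ a, run M L x t = (step M L x)^[s] (roundConfig B a) := by
    intro t
    induction t with
    | zero => exact ⟨_, 0, by omega, hinit⟩
    | succ t ih =>
      obtain ⟨a, s, hs, ih⟩ := ih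
      have hst : run M L x (t + 1) = (step M L x)^[s + 1] (roundConfig B a) := by
        rw [Function.iterate_succ_apply', ← ih]
        exact Function.iterate_succ_apply' _ _ _
      rcases hs.lt_or_eq with hs | rfl
      · exact ⟨a, s + 1, hs, hst⟩
      rcases hσ' a with hh | ⟨h1, b, hb⟩
      · refine ⟨a, σ a, le_rfl, ?_⟩
        have := hh.iterate (L := L) (x := x) 1
        rw [hst, Function.iterate_succ_apply']
        exact this
      · rcases Nat.eq_zero_or_pos (σ b) with h0 | h0
        · refine ⟨b, 0, by omega, ?_⟩
          rcases hσ' b with hh | ⟨h1, -⟩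
          · rw [h0] at hh
            rw [hst, Function.iterate_succ_apply', hb]
            exact hh.iterate 1
          · omega
        · refine ⟨b, 1, h0, ?_⟩
          rw [hst, Function.iterate_succ_apply', hb]
          rfl
  constructor
  · rintro t q ⟨-, rfl⟩
    obtain ⟨a, s, hs, he⟩ := hrun t
    rw [he]
    refine (iterate_query_length _ s).trans ?_
    have := hσ a
    simp [roundConfig]
    omega
  · intro t r
    obtain ⟨a, s, hs, he⟩ := hrun t
    rw [he]
    have h2 : ∀ m ≤ K + x.length + 1, 2 ^ m ≤ 2 ^ (K + x.length + 1) :=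
      fun m hm => Nat.pow_le_pow_right (by omega) hm
    refine (iterate_reg_lt (b := K + x.length + 1)
      (fun r k hk => (hK r k hk).trans_le (h2 _ (by omega)))
      (Nat.lt_two_pow_self.trans_le (h2 _ (by omega))) ?_ s r).trans_le
      (Nat.pow_le_pow_right (by omega) ?_)
    · intro r
      have h3 := h2 1 (by omega)
      simp only [roundConfig]
      split_ifs
      · omega
      · have := Bool.toNat_le (a (r - B))
        omega
    · have := hσ a
      omega

/-! ## Derived functions and predicates -/

section
variable {Γ : Type} [Ctx Γ]

theorem PF.congr {f g : Γ → ℕ} (hf : PF f) (h : ∀ c, g c = f c) : PF g := by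
  rwa [funext h]

theorem PF.mul {f g : Γ → ℕ} (hf : PF f) (hg : PF g) : PF (fun c => f c * g c) :=
  (PF.sum hf (g := fun c _ => g c) hg.weaken).congr fun c => by simp

theorem PF.pow {f : Γ → ℕ} (hf : PF f) (k : ℕ) : PF (fun c => f c ^ k) := by
  induction k with
  | zero => exact (PF.const 1).congr fun c => by simp
  | succ k ih => exact (ih.mul hf).congr fun c => by rw [pow_succ]

theorem PF.list_sum {ι : Type*} (l : List ι) {f : ι → Γ → ℕ} (hf : ∀ i ∈ l, PF (f i)) :
    PF (fun c => (l.map fun i => f i c).sum) := by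
  induction l with
  | nil => exact (PF.const 0).congr fun c => by simp
  | cons i l ih =>
    exact ((hf i (by simp)).add (ih fun j hj => hf j (by simp [hj]))).congr fun c => by simp

theorem PF.fintype_sum {k : ℕ} {f : Fin k → Γ → ℕ} (hf : ∀ i, PF (f i)) :
    PF (fun c => ∑ i, f i c) :=
  (PF.list_sum (List.finRange k) fun i _ => hf i).congr fun c => by
    rw [← List.sum_toFinset _ (List.nodup_finRange k)]; simp

open Classical in
/-- The predicates on a context which are decidable in polynomial time. -/
def PP (p : Γ → Prop) : Prop := PF (fun c => if p c then 1 else 0)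

theorem PP.congr {p q : Γ → Prop} (hp : PP p) (h : ∀ c, q c ↔ p c) : PP q := by
  rwa [funext fun c => propext (h c)]

theorem PP.lt {f g : Γ → ℕ} (hf : PF f) (hg : PF g) : PP (fun c => f c < g c) :=
  -- With truncated subtraction, 1 - (1 - d) is 0 for d = 0 and 1 for d > 0.
  ((PF.const 1).sub ((PF.const 1).sub (hg.sub hf))).congr fun c => by
    split_ifs <;> omega

theorem PP.le {f g : Γ → ℕ} (hf : PF f) (hg : PF g) : PP (fun c => f c ≤ g c) :=
  (PP.lt hf (hg.add (PF.const 1))).congr fun c => by omega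

theorem PP.not {p : Γ → Prop} (hp : PP p) : PP (fun c => ¬ p c) :=
  ((PF.const 1).sub hp).congr fun c => by by_cases h : p c <;> simp [h]

theorem PP.and {p q : Γ → Prop} (hp : PP p) (hq : PP q) : PP (fun c => p c ∧ q c) :=
  (PF.mul hp hq).congr fun c => by by_cases h : p c <;> by_cases h' : q c <;> simp [h, h']

theorem PP.or {p q : Γ → Prop} (hp : PP p) (hq : PP q) : PP (fun c => p c ∨ q c) :=
  (hp.not.and hq.not).not.congr fun c => by tauto

theorem PP.imp {p q : Γ → Prop} (hp : PP p) (hq : PP q) : PP (fun c => p c → q c) :=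
  (hp.not.or hq).congr fun c => by tauto

theorem PP.iff {p q : Γ → Prop} (hp : PP p) (hq : PP q) : PP (fun c => p c ↔ q c) :=
  ((hp.imp hq).and (hq.imp hp)).congr fun c => by tauto

theorem PP.eq {f g : Γ → ℕ} (hf : PF f) (hg : PF g) : PP (fun c => f c = g c) :=
  ((PP.le hf hg).and (PP.le hg hf)).congr fun c => by omega

theorem PP.bex {b : Γ → ℕ} {p : Γ → ℕ → Prop} (hb : PF b) (hp : PP (fun c : Γ × ℕ => p c.1 c.2)) :
    PP (fun c => ∃ i < b c, p c i) := by
  classical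
  refine (PP.lt (PF.const 0) (PF.sum hb (g := fun c i => if p c i then 1 else 0) ?_)).congr
    fun c => ?_
  · exact PF.congr hp fun c => by congr
  · rw [Finset.sum_pos_iff]
    simp only [Finset.mem_range]
    refine exists_congr fun i => and_congr_right fun _ => ?_
    split_ifs with h <;> simp [h]

theorem PP.ball {b : Γ → ℕ} {p : Γ → ℕ → Prop} (hb : PF b)
    (hp : PP (fun c : Γ × ℕ => p c.1 c.2)) : PP (fun c => ∀ i < b c, p c i) :=
  (PP.bex hb (p := fun c i => ¬ p c i) hp.not).not.congr fun c => by push Not; rfl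

theorem PP.list_forall {ι : Type*} (l : List ι) {p : ι → Γ → Prop} (hp : ∀ i ∈ l, PP (p i)) :
    PP (fun c => ∀ i ∈ l, p i c) := by
  induction l with
  | nil => exact (PP.le (PF.const 0) (PF.const 0)).congr fun c => by simp
  | cons i l ih =>
    exact ((hp i (by simp)).and (ih fun j hj => hp j (by simp [hj]))).congr fun c => by simp

theorem PP.fin_forall {k : ℕ} {p : Fin k → Γ → Prop} (hp : ∀ i, PP (p i)) :
    PP (fun c => ∀ i, p i c) :=
  (PP.list_forall (List.finRange k) fun i _ => hp i).congr fun c => by simp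

theorem PP.finset_forall (s : Finset ℕ) {p : ℕ → Γ → Prop} (hp : ∀ i ∈ s, PP (p i)) :
    PP (fun c => ∀ i ∈ s, p i c) :=
  (PP.list_forall s.toList fun i hi => hp i (by simpa using hi)).congr fun c => by simp

theorem PP.bit {f : Γ → ℕ} (hf : PF f) : PP (fun c => (inp c)[f c]? = some true) :=
  hf.bit.congr fun c => by congr

open Classical in
theorem PF.ite {p : Γ → Prop} {f g : Γ → ℕ} (hp : PP p) (hf : PF f) (hg : PF g) :
    PF (fun c => if p c then f c else g c) :=
  ((PF.mul hp hf).add (PF.mul hp.not hg)).congr fun c => by by_cases h : p c <;> simp [h]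

/-- The quotient counts the i < f with (i + 1) * g ≤ f. The guard 0 < g reproduces division by zero
giving 0. -/
theorem PF.div {f g : Γ → ℕ} (hf : PF f) (hg : PF g) : PF (fun c => f c / g c) := by
  classical
  refine (PF.sum hf (g := fun c i => if 0 < g c ∧ (i + 1) * g c ≤ f c then 1 else 0) ?_).congr ?_
  · exact PF.congr ((PP.lt (PF.const 0) hg.weaken).and
      (PP.le ((PF.var.add (PF.const 1)).mul hg.weaken) hf.weaken)) fun c => by congr
  · intro c
    rw [← Finset.sum_filter, ← Finset.card_eq_sum_ones]
    rcases Nat.eq_zero_or_pos (g c) with h | h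
    · simp [h]
    · have : (Finset.range (f c)).filter (fun i => 0 < g c ∧ (i + 1) * g c ≤ f c) =
          Finset.range (f c / g c) := by
        ext i
        simp only [Finset.mem_filter, Finset.mem_range, h, true_and, ← Nat.le_div_iff_mul_le h]
        have := Nat.div_le_self (f c) (g c)
        omega
      rw [this, Finset.card_range]

theorem PF.mod {f g : Γ → ℕ} (hf : PF f) (hg : PF g) : PF (fun c => f c % g c) :=
  (hf.sub (hg.mul (hf.div hg))).congr fun c => by
    have := Nat.mod_add_div (f c) (g c)
    omega

theorem PF.var₁ : PF (fun c : (Γ × ℕ) × ℕ => c.1.2) := PF.var.weaken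

theorem PF.var₂ : PF (fun c : ((Γ × ℕ) × ℕ) × ℕ => c.1.1.2) := PF.var₁.weaken

open Classical in
/-- The length of the longest prefix of `true`s in the bits `p 0, …, p (b - 1)`. -/
noncomputable def leading (b : ℕ) (p : ℕ → Prop) : ℕ :=
  ∑ i ∈ Finset.range b, if ∀ j < i + 1, p j then 1 else 0

theorem PF.leading {b : Γ → ℕ} {p : Γ → ℕ → Prop} (hb : PF b)
    (hp : PP (fun c : (Γ × ℕ) × ℕ => p c.1.1 c.2)) : PF (fun c => leading (b c) (p c)) := by
  classical
  refine PF.sum hb (g := fun c i => if ∀ j < i + 1, p c j then 1 else 0) ?_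
  exact PF.congr (PP.ball (p := fun (c : Γ × ℕ) j => p c.1 j) (PF.var.add (PF.const 1)) hp)
    fun c => by congr

theorem leading_eq {b n : ℕ} {p : ℕ → Prop} (hn : n < b) (h : ∀ j < n, p j) (h' : ¬ p n) :
    leading b p = n := by
  classical
  rw [leading, ← Finset.sum_filter, ← Finset.card_eq_sum_ones]
  have : (Finset.range b).filter (fun i => ∀ j < i + 1, p j) = Finset.range n := by
    ext i
    simp only [Finset.mem_filter, Finset.mem_range]
    constructor
    · rintro ⟨-, h1⟩
      by_contra hi
      exact h' (h1 n (by omega))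
    · exact fun hi => ⟨by omega, fun j hj => h j (by omega)⟩
  rw [this, Finset.card_range]

end

/-! ## The sequence of oracle answers in one round -/

theorem fill_of_le (P : (ℕ → Bool) → ℕ → Prop) (a : ℕ → Bool) {k j : ℕ} (h : k ≤ j) :
    fill P a k j = a j := by
  induction k with
  | zero => rfl
  | succ k ih => rw [fill, Function.update_of_ne (by omega), ih (by omega)]

/-- Bit j is written in pass j only, from the array as it was before that pass. -/
theorem fill_of_lt (P : (ℕ → Bool) → ℕ → Prop) (a : ℕ → Bool) {k j : ℕ} (h : j < k) :
    fill P a k j = true ↔ P (fill P a j) j := by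
  induction k with
  | zero => omega
  | succ k ih =>
    rw [fill]
    by_cases hj : j = k
    · subst hj; simp
    · rw [Function.update_of_ne hj, ih (by omega)]

theorem fill_of_lt_of_le (P : (ℕ → Bool) → ℕ → Prop) (a : ℕ → Bool) {k l j : ℕ} (h : j < k)
    (hk : k ≤ l) : fill P a k j = fill P a l j := by
  rw [Bool.eq_iff_iff, fill_of_lt P a h, fill_of_lt P a (h.trans_le hk)]

/-- The number of ones among the first `N` bits. -/
def ones (N : ℕ) (z : ℕ → Bool) : ℕ := ∑ j ∈ Finset.range N, (z j).toNat

theorem ones_le (N : ℕ) (z : ℕ → Bool) : ones N z ≤ N := by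
  refine (Finset.sum_le_card_nsmul _ _ 1 fun j _ => Bool.toNat_le _).trans ?_
  simp

/-- The part of the oracle question number `i` for the array `a` that concerns a solution `z`. The
array consists of the maximum number of ones in unary, the new solution, and the last solution. -/
def Extends (N : ℕ) (a z : ℕ → Bool) (i : ℕ) : Prop :=
  (i < N ∧ i < ones N z) ∨
  (N ≤ i ∧ i < 2 * N ∧ ones N a ≤ ones N z ∧ (∀ j < i - N, (z j = true ↔ a (N + j) = true)) ∧
    z (i - N) = true ∧ ((∀ j < N, ¬ a (2 * N + j) = true) ∨ ∃ p < N, ¬ z p = true ∧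
      a (2 * N + p) = true ∧ ∀ q < p, (z q = true ↔ a (2 * N + q) = true))) ∨
  (2 * N ≤ i ∧ a (i - N) = true)

/-- The `N` bits of the array `a` from position `o` on. -/
def block (N : ℕ) (a : ℕ → Bool) (o : ℕ) : Fin N → Bool := fun j => a (o + j)

/-- The word `z` precedes the word `y` lexicographically. -/
def LexLT {N : ℕ} (z y : Fin N → Bool) : Prop := toLex z < toLex y

theorem lexLT_iff {N : ℕ} {z y : Fin N → Bool} :
    LexLT z y ↔ ∃ p, z p = false ∧ y p = true ∧ ∀ q < p, z q = y q := by
  change (∃ i, (∀ j, j < i → z j = y j) ∧ z i < y i) ↔ _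
  refine exists_congr fun p => ?_
  rw [Bool.lt_iff]
  tauto

variable {N : ℕ} {S : Set (Fin N → Bool)}

/-- The nonzero words in `S` with a maximum number of ones that precede `y`, if `y` is nonzero. -/
def Candidate (S : Set (Fin N → Bool)) (y z : Fin N → Bool) : Prop :=
  z ∈ S ∧ (∃ j, z j = true) ∧
    (∀ z' ∈ S, ∑ j, (z' j).toNat ≤ ∑ j, (z j).toNat) ∧ ((∀ j, y j = false) ∨ LexLT z y)

theorem ones_eq_sum (z : ℕ → Bool) : ones N z = ∑ j, (block N z 0 j).toNat := by
  simp [ones, block, Finset.sum_range]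

/-- The extension of a word by `false`s. -/
def extend (z : Fin N → Bool) : ℕ → Bool := fun j => if h : j < N then z ⟨j, h⟩ else false

theorem block_extend (z : Fin N → Bool) : block N (extend z) 0 = z := by
  funext j
  simp [block, extend]

/-- The truth values of the oracle questions for the set `S`. -/
def Answer (S : Set (Fin N → Bool)) (a : ℕ → Bool) (i : ℕ) : Prop :=
  ∃ z : ℕ → Bool, block N z 0 ∈ S ∧ Extends N a z i

section
variable {P : (ℕ → Bool) → ℕ → Prop}

theorem round_ones (hP : ∀ a, ∀ i < 3 * N, P a i ↔ Answer S a i) (a : ℕ → Bool)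
    {j : ℕ} (hj : j < N) :
    fill P a (3 * N) j = true ↔ ∃ z : ℕ → Bool, block N z 0 ∈ S ∧ j < ones N z := by
  rw [fill_of_lt _ _ (by omega), hP _ _ (by omega)]
  refine exists_congr fun z => and_congr_right fun hz => ?_
  constructor
  · rintro (h | h | h)
    · exact h.2
    · omega
    · omega
  · exact fun h => Or.inl ⟨hj, h⟩

/-- After N passes the first block is the maximum in unary: bit j says that some member of S has
more than j ones. Writing a number m ≤ N as the count of j < m (`hcount`) allows both inequalities
to be checked bit by bit, without naming a maximum. -/
theorem ones_fill_le_iff (hP : ∀ a, ∀ i < 3 * N, P a i ↔ Answer S a i) (a : ℕ → Bool)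
    {z : ℕ → Bool} {k : ℕ} (hk : N ≤ k)
    (hk' : k ≤ 3 * N) : ones N (fill P a k) ≤ ones N z ↔
      ∀ z' ∈ S, ∑ j, (z' j).toNat ≤ ∑ j, (block N z 0 j).toNat := by
  have h0 : ones N (fill P a k) = ones N (fill P a (3 * N)) :=
    Finset.sum_congr rfl fun j hj => by
      have := Finset.mem_range.1 hj
      rw [fill_of_lt_of_le P a (by omega) hk']
  have hcount : ∀ m ≤ N, m = ∑ j ∈ Finset.range N, (decide (j < m)).toNat := by
    intro m hm
    have : ∀ j, (decide (j < m)).toNat = if j < m then 1 else 0 := by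
      intro j; split_ifs with h <;> simp [h]
    simp only [this]
    rw [← Finset.sum_filter, ← Finset.card_eq_sum_ones]
    have : (Finset.range N).filter (· < m) = Finset.range m := by
      ext i; simp; omega
    rw [this, Finset.card_range]
  rw [h0]
  constructor
  · intro h z' hz'
    rw [← ones_eq_sum, ← block_extend z', ← ones_eq_sum]
    refine le_trans ?_ h
    rw [hcount _ (ones_le N (extend z'))]
    refine Finset.sum_le_sum fun j hj => ?_
    by_cases hj' : j < ones N (extend z')
    · rw [(round_ones hP a (Finset.mem_range.1 hj)).2 ⟨extend z', by rwa [block_extend], hj'⟩]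
      simp [hj']
    · simp [hj']
  · intro h
    rw [hcount _ (ones_le N z)]
    refine Finset.sum_le_sum fun j hj => ?_
    by_cases hj' : fill P a (3 * N) j = true
    · obtain ⟨z', hz', hlt⟩ := (round_ones hP a (Finset.mem_range.1 hj)).1 hj'
      have := h _ hz'
      rw [← ones_eq_sum, ← ones_eq_sum] at this
      simp [hlt.trans_le this, Bool.toNat_le]
    · simp [hj']

/-- When bit N + p is asked, the bits before it have their final values and the last block is still
untouched. The middle clause of `Extends` then says precisely that a candidate continues the prefix
with a one. -/
theorem round_bit (hP : ∀ a, ∀ i < 3 * N, P a i ↔ Answer S a i) (a : ℕ → Bool)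
    (p : Fin N) :
    block N (fill P a (3 * N)) N p = true ↔ ∃ z, Candidate S (block N a (2 * N)) z ∧
      (∀ q < p, z q = block N (fill P a (3 * N)) N q) ∧ z p = true := by
  have hp := p.2
  have hN : ∀ q : ℕ, q < p → fill P a (N + p) (N + q) = fill P a (3 * N) (N + q) :=
    fun q hq => fill_of_lt_of_le P a (by omega) (by omega)
  have h2N : ∀ q : ℕ, fill P a (N + p) (2 * N + q) = a (2 * N + q) :=
    fun q => fill_of_le P a (by omega)
  have key : ∀ z : ℕ → Bool, block N z 0 ∈ S → (Extends N (fill P a (N + p)) z (N + p) ↔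
      Candidate S (block N a (2 * N)) (block N z 0) ∧
      (∀ q < p, block N z 0 q = block N (fill P a (3 * N)) N q) ∧ block N z 0 p = true) := by
    intro z hz
    have e1 : (∀ q < (p : ℕ), (z q = true ↔ fill P a (N + p) (N + q) = true)) ↔
        ∀ q < p, block N z 0 q = block N (fill P a (3 * N)) N q := by
      constructor
      · intro h q hq
        have := h q hq
        rw [hN q hq] at this
        simp only [block, zero_add]
        exact Bool.eq_iff_iff.2 this
      · intro h q hq
        have := h ⟨q, hq.trans hp⟩ hq
        simp only [block, zero_add] at this
        rw [hN q hq, this]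
    have e2 : (∀ j < N, ¬ fill P a (N + p) (2 * N + j) = true) ↔
        ∀ j, block N a (2 * N) j = false := by
      constructor
      · intro h j
        have := h j j.2
        rw [h2N] at this
        simpa [block] using this
      · intro h j hj
        have := h ⟨j, hj⟩
        rw [h2N]
        simpa [block] using this
    have e3 : (∃ p' < N, ¬ z p' = true ∧ fill P a (N + p) (2 * N + p') = true ∧
        ∀ q < p', (z q = true ↔ fill P a (N + p) (2 * N + q) = true)) ↔
        LexLT (block N z 0) (block N a (2 * N)) := by
      rw [lexLT_iff]
      constructor
      · rintro ⟨p', hp', h1, h2, h3⟩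
        refine ⟨⟨p', hp'⟩, by simpa [block] using h1, by rw [h2N] at h2; exact h2, ?_⟩
        intro q hq
        have := h3 q hq
        rw [h2N] at this
        simp only [block, zero_add]
        exact Bool.eq_iff_iff.2 this
      · rintro ⟨p', h1, h2, h3⟩
        refine ⟨p', p'.2, by simpa [block] using h1, by rw [h2N]; exact h2, ?_⟩
        intro q hq
        have := h3 ⟨q, hq.trans p'.2⟩ hq
        simp only [block, zero_add] at this
        rw [h2N, this]
    have e4 := ones_fill_le_iff hP a (z := z) (k := N + p) (by omega) (by omega)
    have e5 : z p = block N z 0 p := by simp [block]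
    unfold Extends Candidate
    rw [Nat.add_sub_cancel_left, e1, e2, e3, e4, e5]
    constructor
    · rintro (h | ⟨-, -, h1, h2, h3, h4⟩ | h)
      · omega
      · exact ⟨⟨hz, ⟨p, h3⟩, h1, h4⟩, h2, h3⟩
      · omega
    · rintro ⟨⟨-, -, h1, h4⟩, h2, h3⟩
      exact Or.inr (Or.inl ⟨by omega, by omega, h1, h2, h3, h4⟩)
  have h0 : block N (fill P a (3 * N)) N p = true ↔ P (fill P a (N + p)) (N + p) := by
    rw [block, fill_of_lt P a (by omega)]
  rw [h0, hP _ _ (by omega)]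
  constructor
  · rintro ⟨z, hz, h⟩
    exact ⟨_, (key z hz).1 h⟩
  · rintro ⟨z, hz, h⟩
    refine ⟨extend z, by rw [block_extend]; exact hz.1, ?_⟩
    rw [key _ (by rw [block_extend]; exact hz.1), block_extend]
    exact ⟨hz, h⟩

theorem round_of_forall_not (hP : ∀ a, ∀ i < 3 * N, P a i ↔ Answer S a i) (a : ℕ → Bool)
    (h : ∀ z, ¬ Candidate S (block N a (2 * N)) z) (p : Fin N) :
    block N (fill P a (3 * N)) N p = false := by
  by_contra hp
  rw [Bool.not_eq_false, round_bit hP a] at hp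
  obtain ⟨z, hz, -⟩ := hp
  exact h z hz

/-- If there are candidates then the new solution is the last one of them. -/
theorem round_of_max (hP : ∀ a, ∀ i < 3 * N, P a i ↔ Answer S a i) (a : ℕ → Bool)
    {m : Fin N → Bool} (hm : Candidate S (block N a (2 * N)) m)
    (hmax : ∀ z, Candidate S (block N a (2 * N)) z → ¬ LexLT m z) :
    block N (fill P a (3 * N)) N = m := by
  funext p
  induction p using WellFoundedLT.induction with
  | ind p ih =>
    rw [Bool.eq_iff_iff, round_bit hP a]
    constructor
    · rintro ⟨z, hz, h1, h2⟩
      by_contra hp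
      rw [Bool.not_eq_true] at hp
      -- A candidate with the prefix of `m` and a one where `m` has a zero would be larger than `m`.
      exact hmax z hz (lexLT_iff.2 ⟨p, hp, h2, fun q hq => by rw [h1 q hq, ih q hq]⟩)
    · exact fun hp => ⟨m, hm, fun q hq => (ih q hq).symm, hp⟩

/-- Even copying goes through the oracle, which keeps the round uniform. Such a question still asks
for some member of S, so S must be nonempty. -/
theorem round_copy (hP : ∀ a, ∀ i < 3 * N, P a i ↔ Answer S a i) (a : ℕ → Bool)
    {z : Fin N → Bool} (hz : z ∈ S) :
    block N (fill P a (3 * N)) (2 * N) = block N (fill P a (3 * N)) N := by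
  funext p
  have hp := p.2
  have h1 : fill P a (2 * N + p) (2 * N + p - N) = fill P a (3 * N) (N + p) := by
    rw [fill_of_lt_of_le P a (by omega) (show 2 * N + (p : ℕ) ≤ 3 * N by omega)]
    congr 1
    omega
  rw [Bool.eq_iff_iff, block, fill_of_lt P a (by omega), hP _ _ (by omega)]
  constructor
  · rintro ⟨z', hz', h | h | h⟩
    · omega
    · omega
    · exact h1.symm.trans h.2
  · exact fun h => ⟨extend z, by rwa [block_extend], Or.inr (Or.inr ⟨by omega, h1.trans h⟩)⟩

/-- The rounds yield all candidates. -/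
theorem exists_rounds (hP : ∀ a, ∀ i < 3 * N, P a i ↔ Answer S a i) (a : ℕ → Bool)
    {h : (ℕ → Bool) → ℕ} {out : (ℕ → Bool) → List Bool}
    (hh : ∀ a, h a = 0 ↔ ∀ j, block N a N j = false) (hout : ∀ a, out a = List.ofFn (block N a N)) :
    ∃ ws : List (Fin N → Bool), ws.Nodup ∧ (∀ z, z ∈ ws ↔ Candidate S (block N a (2 * N)) z) ∧
      Rounds (fun a => fill P a (3 * N)) h out a (ws.map List.ofFn) := by
  classical
  obtain ⟨n, hn⟩ : ∃ n, n = (Finset.univ.filter (Candidate S (block N a (2 * N)))).card := ⟨_, rfl⟩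
  -- Induction on the number of remaining candidates; each productive round removes exactly one.
  induction n using Nat.strong_induction_on generalizing a with
  | _ n ih =>
    by_cases hne : ∃ z, Candidate S (block N a (2 * N)) z
    · have hne' : (Finset.univ.filter (fun z : Lex (Fin N → Bool) =>
          Candidate S (block N a (2 * N)) (ofLex z))).Nonempty := by
        obtain ⟨z, hz⟩ := hne
        exact ⟨toLex z, by simpa using hz⟩
      obtain ⟨m, hm, hmax⟩ := Finset.exists_max_image _ id hne'
      simp only [Finset.mem_filter, Finset.mem_univ, true_and, id] at hm hmax
      have hround := round_of_max hP a hm fun z hz => not_lt.2 (hmax (toLex z) hz)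
      have hcopy := round_copy hP a hm.1
      set b := fill P a (3 * N) with hb
      -- The new last solution `m` is nonzero, so the order condition is now in force. As `m` was
      -- the largest candidate of a linear order, the candidates below it are the old ones other
      -- than `m`.
      have hcand : ∀ z, Candidate S (block N b (2 * N)) z ↔
          Candidate S (block N a (2 * N)) z ∧ z ≠ ofLex m := by
        intro z
        rw [hcopy, hround]
        constructor
        · rintro ⟨h1, h2, h3, h4 | h4⟩
          · obtain ⟨j, hj⟩ := hm.2.1
            rw [h4 j] at hj
            cases hj
          · refine ⟨⟨h1, h2, h3, hm.2.2.2.imp_right fun h5 => ?_⟩, ?_⟩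
            · exact lt_trans h4 h5
            · intro hzm
              rw [hzm] at h4
              exact lt_irrefl _ h4
        · rintro ⟨⟨h1, h2, h3, h4⟩, h5⟩
          refine ⟨h1, h2, h3, Or.inr ?_⟩
          exact lt_of_le_of_ne (hmax (toLex z) ⟨h1, h2, h3, h4⟩)
            fun h => h5 (congrArg ofLex h)
      have hlt : (Finset.univ.filter (Candidate S (block N b (2 * N)))).card < n := by
        rw [hn]
        refine Finset.card_lt_card ⟨fun z hz => ?_, fun hsub => ?_⟩
        · simp only [Finset.mem_filter, Finset.mem_univ, true_and] at hz ⊢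
          exact ((hcand z).1 hz).1
        · have := hsub (x := ofLex m) (by simpa using hm)
          simp only [Finset.mem_filter, Finset.mem_univ, true_and] at this
          exact ((hcand _).1 this).2 rfl
      obtain ⟨ws, h1, h2, h3⟩ := ih _ hlt b rfl
      refine ⟨ofLex m :: ws, ?_, ?_, ?_, ?_, h3⟩
      · rw [List.nodup_cons]
        exact ⟨fun h => ((hcand _).1 ((h2 _).1 h)).2 rfl, h1⟩
      · intro z
        rw [List.mem_cons, h2, hcand]
        constructor
        · rintro (rfl | h)
          exacts [hm, h.1]
        · intro h
          by_cases hz : z = ofLex m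
          exacts [Or.inl hz, Or.inr ⟨h, hz⟩]
      · obtain ⟨j, hj⟩ := hm.2.1
        rw [Ne, hh]
        intro h
        have := h j
        change block N b N j = false at this
        rw [hround, hj] at this
        cases this
      · rw [hout]
        change List.ofFn (block N b N) = _
        rw [hround]
    · refine ⟨[], List.nodup_nil, fun z => ?_, ?_⟩
      · simpa using fun h => hne ⟨z, h⟩
      · exact (hh _).2 (round_of_forall_not hP a (not_exists.1 hne))

end

/-! ## Certificates for satisfaction -/

variable {σ : Vocabulary}

/-- All variables of the formula are less than `m`. -/
def Formula.VarsLT (m : ℕ) : Formula σ → Prop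
  | .eq x y => x < m ∧ y < m
  | .neq x y => x < m ∧ y < m
  | .rel _ xs => ∀ l, xs l < m
  | .nrel _ xs => ∀ l, xs l < m
  | .and φ ψ => φ.VarsLT m ∧ ψ.VarsLT m
  | .or φ ψ => φ.VarsLT m ∧ ψ.VarsLT m
  | .ex x φ => x < m ∧ φ.VarsLT m
  | .all x φ => x < m ∧ φ.VarsLT m
  | .dep xs ys => (∀ l, xs l < m) ∧ ∀ l, ys l < m
  | .inc xs ys => (∀ l, xs l < m) ∧ ∀ l, ys l < m
  | .indep xs ys zs => (∀ l, xs l < m) ∧ (∀ l, ys l < m) ∧ ∀ l, zs l < m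

theorem Formula.VarsLT.mono {m m' : ℕ} (h : m ≤ m') {φ : Formula σ} (hφ : φ.VarsLT m) :
    φ.VarsLT m' := by
  induction φ with
  | eq | neq => exact ⟨hφ.1.trans_le h, hφ.2.trans_le h⟩
  | rel | nrel => exact fun l => (hφ l).trans_le h
  | and φ ψ ih ih' => exact ⟨ih hφ.1, ih' hφ.2⟩
  | or φ ψ ih ih' => exact ⟨ih hφ.1, ih' hφ.2⟩
  | ex x φ ih => exact ⟨hφ.1.trans_le h, ih hφ.2⟩
  | all x φ ih => exact ⟨hφ.1.trans_le h, ih hφ.2⟩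
  | dep | inc => exact ⟨fun l => (hφ.1 l).trans_le h, fun l => (hφ.2 l).trans_le h⟩
  | indep => exact ⟨fun l => (hφ.1 l).trans_le h, fun l => (hφ.2.1 l).trans_le h,
      fun l => (hφ.2.2 l).trans_le h⟩

theorem exists_forall_lt {k : ℕ} (xs : Fin k → ℕ) : ∃ m, ∀ l, xs l < m :=
  ⟨∑ l, xs l + 1, fun l =>
    Nat.lt_succ_of_le (Finset.single_le_sum (fun _ _ => Nat.zero_le _) (Finset.mem_univ l))⟩

theorem Formula.exists_varsLT (φ : Formula σ) : ∃ m, φ.VarsLT m := by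
  have two : ∀ {k l : ℕ} (xs : Fin k → ℕ) (ys : Fin l → ℕ),
      ∃ m, (∀ l, xs l < m) ∧ ∀ l, ys l < m := by
    intro k l xs ys
    obtain ⟨m, hm⟩ := exists_forall_lt xs
    obtain ⟨m', hm'⟩ := exists_forall_lt ys
    exact ⟨m + m', fun l => (hm l).trans_le (by omega), fun l => (hm' l).trans_le (by omega)⟩
  induction φ with
  | eq x y | neq x y => exact ⟨x + y + 1, by omega, by omega⟩
  | rel i xs | nrel i xs => exact exists_forall_lt xs
  | and φ ψ ih ih' | or φ ψ ih ih' =>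
    obtain ⟨m, hm⟩ := ih
    obtain ⟨m', hm'⟩ := ih'
    exact ⟨m + m', hm.mono (by omega), hm'.mono (by omega)⟩
  | ex x φ ih | all x φ ih =>
    obtain ⟨m, hm⟩ := ih
    exact ⟨m + x + 1, by omega, hm.mono (by omega)⟩
  | dep xs ys => exact two xs ys
  | inc xs ys => exact two xs ys
  | indep xs ys zs =>
    obtain ⟨m, hm, hm'⟩ := two xs ys
    obtain ⟨m', hm''⟩ := exists_forall_lt zs
    exact ⟨m + m', fun l => (hm l).trans_le (by omega), fun l => (hm' l).trans_le (by omega),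
      fun l => (hm'' l).trans_le (by omega)⟩

theorem Formula.VarsLT.free_lt {m : ℕ} {φ : Formula σ} (hφ : φ.VarsLT m) :
    ∀ x ∈ φ.free, x < m := by
  have tup : ∀ {k : ℕ} {xs : Fin k → ℕ}, (∀ l, xs l < m) → ∀ x ∈ tupleVars xs, x < m := by
    intro k xs h x hx
    obtain ⟨l, -, rfl⟩ := Finset.mem_image.1 hx
    exact h l
  induction φ with
  | eq x y | neq x y =>
    intro z hz
    simp only [Formula.free, Finset.mem_insert, Finset.mem_singleton] at hz
    obtain ⟨h1, h2⟩ := hφ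
    rcases hz with rfl | rfl <;> assumption
  | rel i xs | nrel i xs => exact tup hφ
  | and φ ψ ih ih' | or φ ψ ih ih' =>
    intro x hx
    rcases Finset.mem_union.1 hx with hx | hx
    exacts [ih hφ.1 x hx, ih' hφ.2 x hx]
  | ex y φ ih | all y φ ih =>
    exact fun x hx => ih hφ.2 x (Finset.mem_of_mem_erase hx)
  | dep xs ys =>
    intro x hx
    rcases Finset.mem_union.1 hx with hx | hx
    exacts [tup hφ.1 x hx, tup hφ.2 x hx]
  | inc xs ys =>
    intro x hx
    rcases Finset.mem_union.1 hx with hx | hx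
    exacts [tup hφ.1 x hx, tup hφ.2 x hx]
  | indep xs ys zs =>
    intro x hx
    rcases Finset.mem_union.1 hx with hx | hx
    · rcases Finset.mem_union.1 hx with hx | hx
      exacts [tup hφ.1 x hx, tup hφ.2.1 x hx]
    · exact tup hφ.2.2 x hx

/-- The number of additional teams in a certificate for a formula. -/
def Formula.nodes : Formula σ → ℕ
  | .and φ ψ => φ.nodes + ψ.nodes
  | .or φ ψ => 2 + φ.nodes + ψ.nodes
  | .ex _ φ => 1 + φ.nodes
  | .all _ φ => 1 + φ.nodes
  | _ => 0

section
variable {A : Type*} (𝔄 : Structure σ A)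

/-- The teams `X o, X (o + 1), …` certify that the team `X ν` satisfies the formula. -/
def Certifies (X : ℕ → Set (Assignment A)) : Formula σ → ℕ → ℕ → Prop
  | .and φ ψ, ν, o => Certifies X φ ν o ∧ Certifies X ψ ν (o + φ.nodes)
  | .or φ ψ, ν, o => X o ∪ X (o + 1) = X ν ∧ Certifies X φ o (o + 2) ∧
      Certifies X ψ (o + 1) (o + 2 + φ.nodes)
  | .ex x φ, ν, o => ((∀ s ∈ X ν, ∃ t ∈ X o, ∃ a, t = s.subst a x) ∧
      ∀ t ∈ X o, ∃ s ∈ X ν, ∃ a, t = s.subst a x) ∧ Certifies X φ o (o + 1)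
  | .all x φ, ν, o => (∀ t, t ∈ X o ↔ ∃ s ∈ X ν, ∃ a, t = s.subst a x) ∧
      Certifies X φ o (o + 1)
  | φ, ν, _ => Sat 𝔄 φ (X ν)

variable {𝔄}

theorem Certifies.sat {X : ℕ → Set (Assignment A)} {φ : Formula σ} {ν o : ℕ}
    (h : Certifies 𝔄 X φ ν o) : Sat 𝔄 φ (X ν) := by
  induction φ generalizing ν o with
  | and φ ψ ih ih' => exact ⟨ih h.1, ih' h.2⟩
  | or φ ψ ih ih' => exact ⟨_, _, h.1, ih h.2.1, ih' h.2.2⟩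
  | ex x φ ih =>
    obtain ⟨⟨h1, h2⟩, h3⟩ := h
    refine ⟨fun s => {a | s.subst a x ∈ X o}, fun s hs => ?_, ?_⟩
    · obtain ⟨t, ht, a, rfl⟩ := h1 s hs
      exact ⟨a, ht⟩
    · convert ih h3
      ext t
      constructor
      · rintro ⟨s, hs, a, ha, rfl⟩
        exact ha
      · intro ht
        obtain ⟨s, hs, a, rfl⟩ := h2 t ht
        exact ⟨s, hs, a, ht, rfl⟩
  | all x φ ih =>
    obtain ⟨h1, h3⟩ := h
    have : duplicate (X ν) x = X o := by
      ext t
      exact (h1 t).symm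
    exact (congrArg _ this).mpr (ih h3)
  | _ => exact h

/-- A certificate for a formula reads only team ν and the `nodes` teams from o on; this locality is
what permits gluing certificates of subformulas. -/
theorem Certifies.congr {X Y : ℕ → Set (Assignment A)} {φ : Formula σ} {ν o : ℕ}
    (h : Certifies 𝔄 X φ ν o) (hν : X ν = Y ν) (ho : ∀ μ, o ≤ μ → μ < o + φ.nodes → X μ = Y μ) :
    Certifies 𝔄 Y φ ν o := by
  induction φ generalizing ν o with
  | and φ ψ ih ih' =>
    simp only [Formula.nodes] at ho
    exact ⟨ih h.1 hν fun μ h1 h2 => ho μ h1 (by omega),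
      ih' h.2 hν fun μ h1 h2 => ho μ (by omega) (by omega)⟩
  | or φ ψ ih ih' =>
    simp only [Formula.nodes] at ho
    refine ⟨?_, ih h.2.1 (ho _ (by omega) (by omega)) fun μ h1 h2 => ho μ (by omega) (by omega),
      ih' h.2.2 (ho _ (by omega) (by omega)) fun μ h1 h2 => ho μ (by omega) (by omega)⟩
    rw [← hν, ← ho _ (by omega) (by omega), ← ho _ (by omega) (by omega)]
    exact h.1
  | ex x φ ih =>
    simp only [Formula.nodes] at ho
    refine ⟨?_, ih h.2 (ho _ (by omega) (by omega)) fun μ h1 h2 => ho μ (by omega) (by omega)⟩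
    rw [← hν, ← ho _ (by omega) (by omega)]
    exact h.1
  | all x φ ih =>
    simp only [Formula.nodes] at ho
    refine ⟨?_, ih h.2 (ho _ (by omega) (by omega)) fun μ h1 h2 => ho μ (by omega) (by omega)⟩
    rw [← hν, ← ho _ (by omega) (by omega)]
    exact h.1
  | _ =>
    unfold Certifies at h ⊢
    rwa [← hν]

/-- All assignments in `X` have their domain in `{0, …, m - 1}`. -/
def SupportedIn (m : ℕ) (X : Set (Assignment A)) : Prop := ∀ s ∈ X, ∀ x, m ≤ x → s x = none

theorem SupportedIn.subst {m : ℕ} {X : Set (Assignment A)} (h : SupportedIn m X) {s : Assignment A}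
    (hs : s ∈ X) {x : ℕ} (hx : x < m) (a : A) (y : ℕ) (hy : m ≤ y) : s.subst a x y = none := by
  rw [Assignment.subst, Function.update_of_ne (by omega)]
  exact h s hs y hy

/-- The semantic witnesses themselves are recorded. Subformulas use disjoint index ranges, and ν < o
keeps the given team apart from them, so the families can be merged by cases on the index. -/
theorem exists_certifies {m : ℕ} {φ : Formula σ} (hφ : φ.VarsLT m) {X : Set (Assignment A)}
    (hX : SupportedIn m X) (h : Sat 𝔄 φ X) {ν o : ℕ} (hν : ν < o) :
    ∃ Y : ℕ → Set (Assignment A), (∀ μ, SupportedIn m (Y μ)) ∧ Y ν = X ∧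
      Certifies 𝔄 Y φ ν o := by
  induction φ generalizing X ν o with
  | and φ ψ ih ih' =>
    obtain ⟨Y, h1, h2, h3⟩ := ih hφ.1 hX h.1 hν
    obtain ⟨Z, k1, k2, k3⟩ := ih' hφ.2 hX h.2 (ν := ν) (o := o + φ.nodes) (by omega)
    refine ⟨fun μ => if μ < o + φ.nodes then Y μ else Z μ, fun μ => ?_, ?_, h3.congr ?_ ?_,
      k3.congr ?_ ?_⟩
    · beta_reduce
      split_ifs
      exacts [h1 μ, k1 μ]
    · beta_reduce
      rw [if_pos (by omega), h2]
    · rw [if_pos (by omega)]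
    · intro μ _ h5
      rw [if_pos h5]
    · rw [if_pos (by omega), h2, k2]
    · intro μ h5 _
      rw [if_neg (by omega)]
  | or φ ψ ih ih' =>
    obtain ⟨Y', Z', rfl, h, k⟩ := h
    obtain ⟨Y, h1, h2, h3⟩ := ih hφ.1 (fun s hs => hX s (Or.inl hs)) h (ν := o) (o := o + 2)
      (by omega)
    obtain ⟨Z, k1, k2, k3⟩ := ih' hφ.2 (fun s hs => hX s (Or.inr hs)) k (ν := o + 1)
      (o := o + 2 + φ.nodes) (by omega)
    -- The left part needs no case of its own: it is `Y o`.
    refine ⟨fun μ => if μ = ν then Y' ∪ Z' else if μ = o + 1 then Z' else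
      if μ < o + 2 + φ.nodes then Y μ else Z μ, fun μ => ?_, ?_, ?_, h3.congr ?_ ?_, k3.congr ?_ ?_⟩
    · beta_reduce
      split_ifs
      exacts [hX, fun s hs => hX s (Or.inr hs), h1 μ, k1 μ]
    · beta_reduce
      rw [if_pos rfl]
    · beta_reduce
      rw [if_neg (by omega), if_neg (by omega), if_pos (by omega), if_neg (by omega), if_pos rfl,
        if_pos rfl, h2]
    · rw [if_neg (by omega), if_neg (by omega), if_pos (by omega)]
    · intro μ h4 h5
      rw [if_neg (by omega), if_neg (by omega), if_pos (by omega)]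
    · rw [if_neg (by omega), if_pos rfl, k2]
    · intro μ h4 h5
      rw [if_neg (by omega), if_neg (by omega), if_neg (by omega)]
  | ex x φ ih =>
    obtain ⟨F, hF, h⟩ := h
    obtain ⟨Y, h1, h2, h3⟩ := ih hφ.2 (by
      rintro _ ⟨s, hs, a, -, rfl⟩
      exact hX.subst hs hφ.1 a) h (ν := o) (o := o + 1) (by omega)
    refine ⟨fun μ => if μ = ν then X else Y μ, fun μ => ?_, ?_, ?_, h3.congr ?_ ?_⟩
    · beta_reduce
      split_ifs
      exacts [hX, h1 μ]
    · beta_reduce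
      rw [if_pos rfl]
    · beta_reduce
      rw [if_pos rfl, if_neg (by omega), h2]
      refine ⟨fun s hs => ?_, ?_⟩
      · obtain ⟨a, ha⟩ := hF s hs
        exact ⟨_, ⟨s, hs, a, ha, rfl⟩, a, rfl⟩
      · rintro t ⟨s, hs, a, -, rfl⟩
        exact ⟨s, hs, a, rfl⟩
    · rw [if_neg (by omega)]
    · intro μ h4 h5
      rw [if_neg (by omega)]
  | all x φ ih =>
    obtain ⟨Y, h1, h2, h3⟩ := ih hφ.2 (by
      rintro _ ⟨s, hs, a, rfl⟩
      exact hX.subst hs hφ.1 a) h (ν := o) (o := o + 1) (by omega)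
    refine ⟨fun μ => if μ = ν then X else Y μ, fun μ => ?_, ?_, ?_, h3.congr ?_ ?_⟩
    · beta_reduce
      split_ifs
      exacts [hX, h1 μ]
    · beta_reduce
      rw [if_pos rfl]
    · beta_reduce
      rw [if_pos rfl, if_neg (by omega), h2]
      exact fun t => Iff.rfl
    · rw [if_neg (by omega)]
    · intro μ h4 h5
      rw [if_neg (by omega)]
  | _ => exact ⟨fun _ => X, fun _ => hX, rfl, h⟩

end

/-! ## Assignments as numbers -/

/-- Digit number `x` of `j` in base `b`. -/
def dig (b j x : ℕ) : ℕ := j / b ^ x % b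

theorem dig_le (n j x : ℕ) : dig (n + 1) j x ≤ n := Nat.lt_succ_iff.1 (Nat.mod_lt _ (by omega))

/-- The value of a variable coded by a digit: `0` codes `none`, and `a + 1` codes `a`. -/
def digitValue (n d : ℕ) : Option (Fin n) :=
  if h : 1 ≤ d ∧ d ≤ n then some ⟨d - 1, by omega⟩ else none

theorem digitValue_inj {n d d' : ℕ} (hd : d ≤ n) (hd' : d' ≤ n) :
    digitValue n d = digitValue n d' ↔ d = d' := by
  unfold digitValue
  split_ifs with h h' h' <;> simp <;> omega

theorem digitValue_eq_some {n d : ℕ} (a : Fin n) :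
    digitValue n d = some a ↔ d = a + 1 := by
  unfold digitValue
  have := a.2
  split_ifs with h <;> simp [Fin.ext_iff] <;> omega

/-- The assignment with code `j`, whose domain is a subset of `{0, …, m - 1}`. -/
def asg (n m j : ℕ) : Assignment (Fin n) :=
  fun x => if x < m then digitValue n (dig (n + 1) j x) else none

section
variable {n m : ℕ}

theorem asg_apply {x : ℕ} (hx : x < m) (j : ℕ) :
    asg n m j x = digitValue n (dig (n + 1) j x) := if_pos hx

theorem asg_eq_iff {x y : ℕ} (hx : x < m) (hy : y < m) (j j' : ℕ) :
    asg n m j x = asg n m j' y ↔ dig (n + 1) j x = dig (n + 1) j' y := by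
  rw [asg_apply hx, asg_apply hy, digitValue_inj (dig_le _ _ _) (dig_le _ _ _)]

theorem asg_comp_iff {k : ℕ} {xs ys : Fin k → ℕ} (hx : ∀ l, xs l < m) (hy : ∀ l, ys l < m)
    (j j' : ℕ) : asg n m j ∘ xs = asg n m j' ∘ ys ↔
      ∀ l, dig (n + 1) j (xs l) = dig (n + 1) j' (ys l) := by
  rw [funext_iff]
  exact forall_congr' fun l => asg_eq_iff (hx l) (hy l) j j'

theorem asg_eq_some_iff {x : ℕ} (hx : x < m) (j : ℕ) (a : Fin n) :
    asg n m j x = some a ↔ dig (n + 1) j x = a + 1 := by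
  rw [asg_apply hx, digitValue_eq_some]

theorem asg_supported (j : ℕ) (x : ℕ) (hx : m ≤ x) : asg n m j x = none := if_neg (by omega)

theorem dig_finFunctionFinEquiv {b : ℕ} (c : Fin m → Fin b) (x : Fin m) :
    dig b (finFunctionFinEquiv c) x = c x := by
  have := congrArg Fin.val (congrFun (finFunctionFinEquiv.symm_apply_apply c) x)
  rw [← this]
  rfl

theorem exists_asg {s : Assignment (Fin n)} (hs : ∀ x, m ≤ x → s x = none) :
    ∃ j < (n + 1) ^ m, asg n m j = s := by
  let c : Fin m → Fin (n + 1) := fun x => (s x).elim 0 Fin.succ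
  refine ⟨finFunctionFinEquiv c, (finFunctionFinEquiv c).2, ?_⟩
  funext x
  by_cases hx : x < m
  · rw [asg_apply hx, dig_finFunctionFinEquiv c ⟨x, hx⟩]
    simp only [c]
    cases h : s x with
    | none => simp [digitValue]
    | some a => simp [digitValue]
  · rw [hs x (by omega), asg_supported _ _ (by omega)]

theorem asg_injective {j j' : ℕ} (hj : j < (n + 1) ^ m) (hj' : j' < (n + 1) ^ m)
    (h : asg n m j = asg n m j') : j = j' := by
  have : finFunctionFinEquiv.symm (⟨j, hj⟩ : Fin ((n + 1) ^ m)) =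
      finFunctionFinEquiv.symm ⟨j', hj'⟩ := by
    funext x
    exact Fin.ext ((asg_eq_iff x.2 x.2 j j').1 (congrFun h x))
  exact congrArg Fin.val (finFunctionFinEquiv.symm.injective this)

/-- The assignment with code `t` arises from that with code `s` by changing the value of `x`. -/
def Varies (n m s t x : ℕ) : Prop :=
  1 ≤ dig (n + 1) t x ∧ ∀ y ∈ (Finset.range m).erase x, dig (n + 1) t y = dig (n + 1) s y

theorem varies_iff {x : ℕ} (hx : x < m) (s t : ℕ) :
    (∃ a, asg n m t = (asg n m s).subst a x) ↔ Varies n m s t x := by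
  constructor
  · rintro ⟨a, ha⟩
    constructor
    · have := congrFun ha x
      rw [Assignment.subst, Function.update_self, asg_eq_some_iff hx] at this
      omega
    · intro y hy
      simp only [Finset.mem_erase, Finset.mem_range] at hy
      have := congrFun ha y
      rwa [Assignment.subst, Function.update_of_ne hy.1, asg_eq_iff hy.2 hy.2] at this
  · rintro ⟨h1, h2⟩
    have h3 := dig_le n t x
    refine ⟨⟨dig (n + 1) t x - 1, by omega⟩, ?_⟩
    funext y
    by_cases hy : y = x
    · subst hy
      rw [Assignment.subst, Function.update_self, asg_eq_some_iff hx]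
      simp only
      omega
    · rw [Assignment.subst, Function.update_of_ne hy]
      by_cases hym : y < m
      · exact (asg_eq_iff hym hym _ _).2 (h2 y (by simp [hy, hym]))
      · rw [asg_supported _ _ (by omega), asg_supported _ _ (by omega)]

variable (n m) in
/-- The set of assignments with codes in `w`. -/
def codedTeam (w : ℕ → Prop) : Set (Assignment (Fin n)) :=
  {s | ∃ j < (n + 1) ^ m, w j ∧ asg n m j = s}

theorem forall_codedTeam {w : ℕ → Prop} {p : Assignment (Fin n) → Prop} :
    (∀ s ∈ codedTeam n m w, p s) ↔ ∀ j < (n + 1) ^ m, w j → p (asg n m j) := by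
  constructor
  · exact fun h j hj hw => h _ ⟨j, hj, hw, rfl⟩
  · rintro h s ⟨j, hj, hw, rfl⟩
    exact h j hj hw

theorem exists_codedTeam {w : ℕ → Prop} {p : Assignment (Fin n) → Prop} :
    (∃ s ∈ codedTeam n m w, p s) ↔ ∃ j < (n + 1) ^ m, w j ∧ p (asg n m j) := by
  constructor
  · rintro ⟨s, ⟨j, hj, hw, rfl⟩, hp⟩
    exact ⟨j, hj, hw, hp⟩
  · rintro ⟨j, hj, hw, hp⟩
    exact ⟨_, ⟨j, hj, hw, rfl⟩, hp⟩

theorem asg_mem_codedTeam {w : ℕ → Prop} {j : ℕ} (hj : j < (n + 1) ^ m) :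
    asg n m j ∈ codedTeam n m w ↔ w j := by
  constructor
  · rintro ⟨j', hj', hw, h⟩
    rwa [← asg_injective hj' hj h]
  · exact fun hw => ⟨j, hj, hw, rfl⟩

theorem codedTeam_mem {X : Set (Assignment (Fin n))} (hX : SupportedIn m X) :
    codedTeam n m (fun j => asg n m j ∈ X) = X := by
  ext s
  constructor
  · rintro ⟨j, -, hw, rfl⟩
    exact hw
  · intro hs
    obtain ⟨j, hj, rfl⟩ := exists_asg (hX s hs)
    exact ⟨j, hj, hs, rfl⟩

/-! ## Numerical certificates -/

variable {σ : Vocabulary}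

/-- The tuple `xs` has values under the assignment with code `j`, and they form the tuple number
`∑ l, a l * n ^ l` with the property `p`. -/
def TupleIn (n : ℕ) (p : ℕ → Prop) {k : ℕ} (xs : Fin k → ℕ) (j : ℕ) : Prop :=
  (∀ l, 1 ≤ dig (n + 1) j (xs l)) ∧ p (∑ l, (dig (n + 1) j (xs l) - 1) * n ^ (l : ℕ))

theorem tupleIn_iff {k : ℕ} {xs : Fin k → ℕ} (hx : ∀ l, xs l < m) (j : ℕ) (p : ℕ → Prop)
    (R : Set (Fin k → Fin n)) (hp : ∀ a : Fin k → Fin n, p (∑ l, a l * n ^ (l : ℕ)) ↔ a ∈ R) :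
    (∃ a ∈ R, asg n m j ∘ xs = some ∘ a) ↔ TupleIn n p xs j := by
  have key : ∀ a : Fin k → Fin n, asg n m j ∘ xs = some ∘ a ↔
      ∀ l, dig (n + 1) j (xs l) = a l + 1 := by
    intro a
    rw [funext_iff]
    exact forall_congr' fun l => asg_eq_some_iff (hx l) j (a l)
  simp only [key]
  constructor
  · rintro ⟨a, ha, h⟩
    refine ⟨fun l => by rw [h l]; omega, ?_⟩
    simp only [h, Nat.add_sub_cancel]
    exact (hp a).2 ha
  · rintro ⟨h1, h2⟩
    have h3 : ∀ l, dig (n + 1) j (xs l) - 1 < n := fun l => by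
      have := h1 l
      have := dig_le n j (xs l)
      omega
    refine ⟨fun l => ⟨_, h3 l⟩, (hp _).1 h2, fun l => ?_⟩
    have := h1 l
    simp only
    omega

/-- The numerical form of `Certifies`, for a structure on `{0, …, n - 1}` with relations `R` and
teams with codes `W`. -/
def Verifies (n m : ℕ) (R : ℕ → ℕ → Prop) (W : ℕ → ℕ → Prop) : Formula σ → ℕ → ℕ → Prop
  | .eq x y, ν, _ => ∀ j < (n + 1) ^ m, W ν j → dig (n + 1) j x = dig (n + 1) j y
  | .neq x y, ν, _ => ∀ j < (n + 1) ^ m, W ν j → ¬ dig (n + 1) j x = dig (n + 1) j y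
  | .rel i xs, ν, _ => ∀ j < (n + 1) ^ m, W ν j → TupleIn n (R i) xs j
  | .nrel i xs, ν, _ => ∀ j < (n + 1) ^ m, W ν j → TupleIn n (fun a => ¬ R i a) xs j
  | .and φ ψ, ν, o => Verifies n m R W φ ν o ∧ Verifies n m R W ψ ν (o + φ.nodes)
  | .or φ ψ, ν, o => (∀ j < (n + 1) ^ m, (W o j ∨ W (o + 1) j ↔ W ν j)) ∧
      Verifies n m R W φ o (o + 2) ∧ Verifies n m R W ψ (o + 1) (o + 2 + φ.nodes)
  | .ex x φ, ν, o =>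
      ((∀ s < (n + 1) ^ m, W ν s → ∃ t < (n + 1) ^ m, W o t ∧ Varies n m s t x) ∧
        ∀ t < (n + 1) ^ m, W o t → ∃ s < (n + 1) ^ m, W ν s ∧ Varies n m s t x) ∧
      Verifies n m R W φ o (o + 1)
  | .all x φ, ν, o =>
      (∀ t < (n + 1) ^ m, (W o t ↔ ∃ s < (n + 1) ^ m, W ν s ∧ Varies n m s t x)) ∧
      Verifies n m R W φ o (o + 1)
  | .dep xs ys, ν, _ => ∀ s < (n + 1) ^ m, W ν s → ∀ t < (n + 1) ^ m, W ν t →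
      (∀ l, dig (n + 1) s (xs l) = dig (n + 1) t (xs l)) →
      ∀ l, dig (n + 1) s (ys l) = dig (n + 1) t (ys l)
  | .inc xs ys, ν, _ => ∀ s < (n + 1) ^ m, W ν s → ∃ t < (n + 1) ^ m, W ν t ∧
      ∀ l, dig (n + 1) s (xs l) = dig (n + 1) t (ys l)
  | .indep xs ys zs, ν, _ => ∀ s < (n + 1) ^ m, W ν s → ∀ t < (n + 1) ^ m, W ν t →
      (∀ l, dig (n + 1) s (zs l) = dig (n + 1) t (zs l)) →
      ∃ u < (n + 1) ^ m, W ν u ∧ (∀ l, dig (n + 1) u (xs l) = dig (n + 1) s (xs l)) ∧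
        (∀ l, dig (n + 1) u (ys l) = dig (n + 1) t (ys l)) ∧
        ∀ l, dig (n + 1) u (zs l) = dig (n + 1) s (zs l)

/-- Every assignment supported below m has exactly one code below (n + 1) ^ m, so quantifiers over
teams become bounded quantifiers over codes and equality of values becomes equality of digits. -/
theorem verifies_iff (𝔄 : Structure σ (Fin n)) {R : ℕ → ℕ → Prop}
    (hR : ∀ (i : Fin σ.numRel) (a : Fin (σ.arity i) → Fin n),
      R i (∑ l, a l * n ^ (l : ℕ)) ↔ a ∈ 𝔄.rel i) (W : ℕ → ℕ → Prop)
    {φ : Formula σ} (hφ : φ.VarsLT m) (ν o : ℕ) :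
    Certifies 𝔄 (fun μ => codedTeam n m (W μ)) φ ν o ↔ Verifies n m R W φ ν o := by
  induction φ generalizing ν o with
  | eq x y =>
    simp only [Certifies, Verifies, Sat, forall_codedTeam, asg_eq_iff hφ.1 hφ.2]
  | neq x y =>
    simp only [Certifies, Verifies, Sat, forall_codedTeam, ne_eq, asg_eq_iff hφ.1 hφ.2]
  | rel i xs =>
    simp only [Certifies, Verifies, Sat, forall_codedTeam]
    exact forall_congr' fun j => imp_congr_right fun _ => imp_congr_right fun _ =>
      tupleIn_iff hφ j _ _ (hR i)
  | nrel i xs =>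
    simp only [Certifies, Verifies, Sat, forall_codedTeam]
    exact forall_congr' fun j => imp_congr_right fun _ => imp_congr_right fun _ =>
      -- A negated relation literal also requires all values to be defined, so it is membership in
      -- the complement.
      tupleIn_iff hφ j _ (𝔄.rel i)ᶜ fun a => not_congr (hR i a)
  | and φ ψ ih ih' => simp only [Certifies, Verifies, ih hφ.1, ih' hφ.2]
  | or φ ψ ih ih' =>
    simp only [Certifies, Verifies, ih hφ.1, ih' hφ.2]
    refine and_congr_left fun _ => ?_
    constructor
    · intro h j hj
      rw [← asg_mem_codedTeam (w := W o) hj, ← asg_mem_codedTeam (w := W (o + 1)) hj,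
        ← asg_mem_codedTeam (w := W ν) hj, ← h]
      rfl
    · intro h
      ext s
      constructor
      · rintro (⟨j, hj, hw, rfl⟩ | ⟨j, hj, hw, rfl⟩)
        · exact ⟨j, hj, (h j hj).1 (Or.inl hw), rfl⟩
        · exact ⟨j, hj, (h j hj).1 (Or.inr hw), rfl⟩
      · rintro ⟨j, hj, hw, rfl⟩
        rcases (h j hj).2 hw with hw | hw
        · exact Or.inl ⟨j, hj, hw, rfl⟩
        · exact Or.inr ⟨j, hj, hw, rfl⟩
  | ex x φ ih =>
    simp only [Certifies, Verifies, ih hφ.2, forall_codedTeam, exists_codedTeam,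
      varies_iff hφ.1]
  | all x φ ih =>
    simp only [Certifies, Verifies, ih hφ.2]
    refine and_congr_left fun _ => ?_
    constructor
    · intro h j hj
      rw [← asg_mem_codedTeam (w := W o) hj, h, exists_codedTeam]
      simp only [varies_iff hφ.1]
    · intro h t
      constructor
      · rintro ⟨j, hj, hw, rfl⟩
        rw [exists_codedTeam]
        simp only [varies_iff hφ.1]
        exact (h j hj).1 hw
      · rintro ⟨_, ⟨s, hs, hw, rfl⟩, a, rfl⟩
        -- Because x < m, the changed assignment is still supported below m and hence has a code.
        obtain ⟨j, hj, hja⟩ := exists_asg (m := m) (s := (asg n m s).subst a x) fun y hy => by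
          rw [Assignment.subst, Function.update_of_ne (by have := hφ.1; omega)]
          exact asg_supported _ _ hy
        rw [← hja, asg_mem_codedTeam hj, h j hj]
        exact ⟨s, hs, hw, (varies_iff hφ.1 _ _).1 ⟨a, hja⟩⟩
  | dep xs ys =>
    simp only [Certifies, Verifies, Sat, forall_codedTeam, asg_comp_iff hφ.1 hφ.1,
      asg_comp_iff hφ.2 hφ.2]
  | inc xs ys =>
    simp only [Certifies, Verifies, Sat, forall_codedTeam, exists_codedTeam,
      asg_comp_iff hφ.1 hφ.2]
  | indep xs ys zs =>
    simp only [Certifies, Verifies, Sat, forall_codedTeam, exists_codedTeam,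
      asg_comp_iff hφ.1 hφ.1, asg_comp_iff hφ.2.1 hφ.2.1, asg_comp_iff hφ.2.2 hφ.2.2]

end

/-! ## Verification in polynomial time -/

section

variable {σ : Vocabulary} {n : List Bool → ℕ} {R W : List Bool → ℕ → ℕ → Prop}

theorem PF.dig {Γ : Type} [Ctx Γ] {b f : Γ → ℕ} (hb : PF b) (hf : PF f) (x : ℕ) :
    PF (fun c => dig (b c) (f c) x) :=
  (hf.div (hb.pow x)).mod hb

theorem PP.varies {Γ : Type} [Ctx Γ] {f s t : Γ → ℕ} (hf : PF f) (hs : PF s) (ht : PF t)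
    (m x : ℕ) : PP (fun c => Varies (f c) m (s c) (t c) x) :=
  (PP.le (PF.const 1) ((hf.add (PF.const 1)).dig ht x)).and
    (PP.finset_forall _ fun y _ => PP.eq ((hf.add (PF.const 1)).dig ht y)
      ((hf.add (PF.const 1)).dig hs y))

theorem PF.tupleCode {Γ : Type} [Ctx Γ] {f s : Γ → ℕ} (hf : PF f) (hs : PF s) {k : ℕ}
    (xs : Fin k → ℕ) :
    PF (fun c => ∑ l, (TeamEnum.dig (f c + 1) (s c) (xs l) - 1) * f c ^ (l : ℕ)) :=
  PF.fintype_sum fun l =>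
    ((((hf.add (PF.const 1)).dig hs (xs l))).sub (PF.const 1)).mul (hf.pow _)

theorem PP.tupleIn {Γ : Type} [Ctx Γ] {f s : Γ → ℕ} {p : Γ → ℕ → Prop} (hf : PF f) (hs : PF s)
    {k : ℕ} (xs : Fin k → ℕ) (hp : PP (fun c =>
      p c (∑ l, (dig (f c + 1) (s c) (xs l) - 1) * f c ^ (l : ℕ)))) :
    PP (fun c => TupleIn (f c) (p c) xs (s c)) :=
  (PP.fin_forall fun l => PP.le (PF.const 1) ((hf.add (PF.const 1)).dig hs (xs l))).and hp

/-- With φ and m fixed, (n + 1) ^ m is polynomial and the recursion on φ takes place outside the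
machine. The hypotheses range over all contexts because the same functions of the input are used
beneath varying numbers of loop counters. -/
theorem PP.verifies
    (hn : ∀ {Γ : Type} [Ctx Γ], PF (fun c : Γ => n (inp c)))
    (hR : ∀ {Γ : Type} [Ctx Γ] (i : ℕ) {f : Γ → ℕ}, PF f → PP (fun c => R (inp c) i (f c)))
    (hW : ∀ {Γ : Type} [Ctx Γ] (μ : ℕ) {f : Γ → ℕ}, PF f → PP (fun c => W (inp c) μ (f c)))
    (m : ℕ) (φ : Formula σ) (ν o : ℕ) {Γ : Type} [Ctx Γ] :
    PP (fun c : Γ => Verifies (n (inp c)) m (R (inp c)) (W (inp c)) φ ν o) := by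
  have hM : ∀ {Γ : Type} [Ctx Γ], PF (fun c : Γ => (n (inp c) + 1) ^ m) :=
    fun {Γ} _ => (hn.add (PF.const 1)).pow m
  have hd : ∀ {Γ : Type} [Ctx Γ] {f : Γ → ℕ} (x : ℕ), PF f →
      PF (fun c : Γ => dig (n (inp c) + 1) (f c) x) :=
    fun {Γ} _ f x hf => (hn.add (PF.const 1)).dig hf x
  have htup : ∀ {Γ : Type} [Ctx Γ] {f g : Γ → ℕ} {k : ℕ} (xs ys : Fin k → ℕ), PF f → PF g →
      PP (fun c : Γ => ∀ l, dig (n (inp c) + 1) (f c) (xs l) =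
        dig (n (inp c) + 1) (g c) (ys l)) :=
    fun {Γ} _ f g k xs ys hf hg => PP.fin_forall fun l => PP.eq (hd _ hf) (hd _ hg)
  induction φ generalizing ν o with
  | eq x y =>
    exact PP.ball hM (PP.imp (hW ν PF.var) (PP.eq (hd x PF.var) (hd y PF.var)))
  | neq x y =>
    exact PP.ball hM (PP.imp (hW ν PF.var) (PP.eq (hd x PF.var) (hd y PF.var)).not)
  | rel i xs =>
    exact PP.ball hM (PP.imp (hW ν PF.var)
      (PP.tupleIn hn PF.var xs (hR i (PF.tupleCode hn PF.var xs))))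
  | nrel i xs =>
    exact PP.ball hM (PP.imp (hW ν PF.var)
      (PP.tupleIn hn PF.var xs (hR i (PF.tupleCode hn PF.var xs)).not))
  | and φ ψ ih ih' => exact (ih _ _).and (ih' _ _)
  | or φ ψ ih ih' =>
    exact (PP.ball hM (PP.iff ((hW o PF.var).or (hW (o + 1) PF.var)) (hW ν PF.var))).and
      ((ih _ _).and (ih' _ _))
  | ex x φ ih =>
    refine PP.and (PP.and ?_ ?_) (ih _ _)
    · exact PP.ball hM (PP.imp (hW ν PF.var) (PP.bex hM ((hW o PF.var).and
        (PP.varies hn PF.var₁ PF.var m x))))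
    · exact PP.ball hM (PP.imp (hW o PF.var) (PP.bex hM ((hW ν PF.var).and
        (PP.varies hn PF.var PF.var₁ m x))))
  | all x φ ih =>
    refine PP.and ?_ (ih _ _)
    exact PP.ball hM (PP.iff (hW o PF.var) (PP.bex hM ((hW ν PF.var).and
      (PP.varies hn PF.var PF.var₁ m x))))
  | dep xs ys =>
    exact PP.ball hM (PP.imp (hW ν PF.var) (PP.ball hM (PP.imp (hW ν PF.var)
      (PP.imp (htup xs xs PF.var₁ PF.var) (htup ys ys PF.var₁ PF.var)))))
  | inc xs ys =>
    exact PP.ball hM (PP.imp (hW ν PF.var) (PP.bex hM (PP.and (hW ν PF.var)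
      (htup xs ys PF.var₁ PF.var))))
  | indep xs ys zs =>
    exact PP.ball hM (PP.imp (hW ν PF.var) (PP.ball hM (PP.imp (hW ν PF.var)
      (PP.imp (htup zs zs PF.var₁ PF.var) (PP.bex hM (PP.and (hW ν PF.var)
        (PP.and (htup xs xs PF.var PF.var₂) (PP.and (htup ys ys PF.var PF.var₁)
          (htup zs zs PF.var PF.var₂)))))))))

end

/-! ## Words that encode structures -/

theorem leading_spec {b : ℕ} {p : ℕ → Prop} (h : leading b p < b) :
    (∀ j < leading b p, p j) ∧ ¬ p (leading b p) := by
  classical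
  by_cases hp : ∃ j, j < b ∧ ¬ p j
  · have h1 := Nat.find_spec hp
    have h2 : ∀ j < Nat.find hp, p j := fun j hj => by
      by_contra hj'
      exact Nat.find_min hp hj ⟨hj.trans h1.1, hj'⟩
    rw [leading_eq h1.1 h2 h1.2]
    exact ⟨h2, h1.2⟩
  · push Not at hp
    have : leading b p = b := by
      rw [leading, Finset.sum_congr rfl (g := fun _ => 1)]
      · simp
      · intro i hi
        rw [if_pos]
        intro j hj
        have := Finset.mem_range.1 hi
        exact hp j (by omega)
    omega

theorem getElem?_flatten (l : List (List Bool)) {i k : ℕ} {s : List Bool} (hi : l[i]? = some s)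
    (hk : k < s.length) : l.flatten[((l.map List.length).take i).sum + k]? = s[k]? := by
  induction l generalizing i with
  | nil => simp at hi
  | cons r l ih =>
    cases i with
    | zero =>
      obtain rfl : r = s := by simpa using hi
      simp [List.getElem?_append_left hk]
    | succ i =>
      have := ih (by simpa using hi)
      simp only [List.map_cons, List.take_succ_cons, List.sum_cons, List.flatten_cons]
      rw [add_assoc, List.getElem?_append_right (by omega), Nat.add_sub_cancel_left, this]

theorem exists_flatten_ofFn {m : ℕ} (f : Fin m → ℕ) (l : List Bool) (hl : l.length = ∑ i, f i) :
    ∃ g : Fin m → List Bool, (∀ i, (g i).length = f i) ∧ l = (List.ofFn g).flatten := by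
  induction m generalizing l with
  | zero => exact ⟨fun _ => [], fun i => i.elim0, by simpa using hl⟩
  | succ m ih =>
    rw [Fin.sum_univ_succ] at hl
    obtain ⟨g, hg, h⟩ := ih (fun i => f i.succ) (l.drop (f 0)) (by simp [hl])
    refine ⟨Fin.cons (l.take (f 0)) g, fun i => ?_, ?_⟩
    · refine Fin.cases ?_ (fun i => ?_) i
      · simp [hl]
      · simpa using hg i
    · rw [List.ofFn_succ, List.flatten_cons]
      simp only [Fin.cons_zero, Fin.cons_succ]
      rw [← h, List.take_append_drop]

theorem exists_encodeRel {n k : ℕ} {l : List Bool} (hl : l.length = n ^ k) :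
    ∃ R : Set (Fin k → Fin n), encodeRel R = l := by
  refine ⟨{a | l[(finFunctionFinEquiv a : ℕ)]? = some true}, ?_⟩
  refine List.ext_getElem (by rw [encodeRel_length, hl]) fun i h1 h2 => ?_
  simp only [encodeRel, List.getElem_ofFn, Set.mem_ofPred_eq, Equiv.apply_symm_apply]
  rw [List.getElem?_eq_getElem h2]
  simp

theorem encodeRel_getElem? {n k : ℕ} (R : Set (Fin k → Fin n)) (a : Fin k → Fin n) :
    (encodeRel R)[(finFunctionFinEquiv a : ℕ)]? = some true ↔ a ∈ R := by
  have h := (finFunctionFinEquiv a).2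
  rw [List.getElem?_eq_getElem (by rw [encodeRel_length]; exact h)]
  simp only [encodeRel, List.getElem_ofFn, Fin.eta, Equiv.symm_apply_apply]
  simp

variable (σ : Vocabulary)

/-- The length of the encodings of the relations number `0, …, i - 1` of a structure on
`{0, …, n - 1}`. -/
def relOffset (n i : ℕ) : ℕ := (((List.ofFn σ.arity).take i).map (n ^ ·)).sum

/-- The length of the encoding of a structure on `{0, …, n - 1}`. -/
def structureLength (n : ℕ) : ℕ := n + 1 + ((List.ofFn σ.arity).map (n ^ ·)).sum

variable {σ}

theorem length_encodeStructure {n : ℕ} (𝔄 : Structure σ (Fin n)) :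
    (encodeStructure 𝔄).length = structureLength σ n := by
  simp [encodeStructure, structureLength, List.length_flatten, List.map_ofFn, Function.comp_def,
    encodeRel_length]
  omega

theorem encodeStructure_rel {n : ℕ} (𝔄 : Structure σ (Fin n)) (i : Fin σ.numRel)
    (a : Fin (σ.arity i) → Fin n) :
    (encodeStructure 𝔄)[n + 1 + relOffset σ n i + ∑ l, a l * n ^ (l : ℕ)]? = some true ↔
      a ∈ 𝔄.rel i := by
  have h1 : ∑ l, (a l : ℕ) * n ^ (l : ℕ) = (finFunctionFinEquiv a : ℕ) :=
    (finFunctionFinEquiv_apply_val a).symm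
  have h2 : relOffset σ n i = (((List.ofFn fun i => encodeRel (𝔄.rel i)).map List.length).take
      i).sum := by
    simp [relOffset, List.map_take, List.map_ofFn, Function.comp_def, encodeRel_length]
  rw [encodeStructure, List.getElem?_append_right (by simp; omega), h1, h2]
  have h3 : n + 1 + (((List.ofFn fun i => encodeRel (𝔄.rel i)).map List.length).take i).sum +
      (finFunctionFinEquiv a : ℕ) - (List.replicate n true ++ [false]).length =
      (((List.ofFn fun i => encodeRel (𝔄.rel i)).map List.length).take i).sum +
      (finFunctionFinEquiv a : ℕ) := by
    simp; omega
  rw [h3, getElem?_flatten _ (s := encodeRel (𝔄.rel i)) (by simp)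
    (by rw [encodeRel_length]; exact (finFunctionFinEquiv a).2), encodeRel_getElem?]

theorem encodeStructure_head {n : ℕ} (𝔄 : Structure σ (Fin n)) :
    (∀ j < n, (encodeStructure 𝔄)[j]? = some true) ∧ (encodeStructure 𝔄)[n]? = some false := by
  rw [encodeStructure]
  refine ⟨fun j hj => ?_, ?_⟩
  · rw [List.append_assoc, List.getElem?_append_left (by simpa using hj)]
    simp [hj]
  · rw [List.append_assoc, List.getElem?_append_right (by simp)]
    simp

/-- The size of the universe, read off the encoding of a structure. -/
noncomputable def universeSize (x : List Bool) : ℕ :=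
  leading x.length fun j => x[j]? = some true

theorem universeSize_encodeStructure {n : ℕ} (𝔄 : Structure σ (Fin n)) :
    universeSize (encodeStructure 𝔄) = n := by
  obtain ⟨h1, h2⟩ := encodeStructure_head 𝔄
  refine leading_eq ?_ h1 (by simp [h2])
  rw [length_encodeStructure, structureLength]
  omega

/-- Being an encoding is a condition on the length alone: it forces the initial run of `true`s to be
ended by a `false`, and the remaining bits, cut into pieces of the right lengths, are arbitrary
relations. -/
theorem exists_encodeStructure {x : List Bool}
    (hx : x.length = structureLength σ (universeSize x)) :
    ∃ 𝔄 : Structure σ (Fin (universeSize x)), x = encodeStructure 𝔄 := by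
  have hlt : universeSize x < x.length := by
    rw [hx, structureLength]
    omega
  obtain ⟨h1, h2⟩ := leading_spec hlt
  change (∀ j < universeSize x, _) at h1
  change ¬ x[universeSize x]? = some true at h2
  generalize universeSize x = n at *
  have h3 : x.take (n + 1) = List.replicate n true ++ [false] := by
    refine List.ext_getElem? fun j => ?_
    rcases lt_trichotomy j n with hj | rfl | hj
    · rw [List.getElem?_take_of_lt (by omega), h1 j hj, List.getElem?_append_left (by simpa)]
      simp [hj]
    · rw [List.getElem?_take_of_lt (by omega), List.getElem?_append_right (by simp)]
      rw [List.getElem?_eq_getElem hlt] at h2 ⊢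
      simpa using h2
    · rw [List.getElem?_eq_none (by simp; omega), List.getElem?_eq_none (by simp; omega)]
  obtain ⟨g, hg, h4⟩ := exists_flatten_ofFn (fun i => n ^ σ.arity i) (x.drop (n + 1)) (by
    rw [List.length_drop, hx, structureLength, List.map_ofFn, List.sum_ofFn]
    simp)
  choose R hR using fun i => exists_encodeRel (hg i)
  refine ⟨⟨R⟩, ?_⟩
  rw [encodeStructure, ← h3]
  simp only [hR]
  rw [← h4, List.take_append_drop]

/-! ## Words that encode teams -/

section
variable {n : ℕ} (D : Finset ℕ)

/-- The assignment with domain `D` and values `a`. -/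
def ofTuple (a : Fin D.card → Fin n) : Assignment (Fin n) :=
  fun x => if h : x ∈ D then some (a ((D.orderIsoOfFin rfl).symm ⟨x, h⟩)) else none

/-- The team with domain `D` and characteristic word `z`. -/
def teamOf (z : Fin (n ^ D.card) → Bool) : Set (Assignment (Fin n)) :=
  ofTuple D '' {a | z (finFunctionFinEquiv a) = true}

variable {D}

theorem ofTuple_comp (a : Fin D.card → Fin n) : ofTuple D a ∘ D.orderEmbOfFin rfl = some ∘ a := by
  funext i
  have h := Finset.orderEmbOfFin_mem D rfl i
  simp only [Function.comp, ofTuple, dif_pos h]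
  congr 2
  rw [OrderIso.symm_apply_eq]
  rfl

theorem eq_ofTuple_iff {s : Assignment (Fin n)} {a : Fin D.card → Fin n} :
    s = ofTuple D a ↔ s ∘ D.orderEmbOfFin rfl = some ∘ a ∧ ∀ x ∉ D, s x = none := by
  constructor
  · rintro rfl
    exact ⟨ofTuple_comp a, fun x hx => by simp [ofTuple, hx]⟩
  · rintro ⟨h1, h2⟩
    funext x
    by_cases hx : x ∈ D
    · have : x ∈ Set.range (D.orderEmbOfFin rfl) := by simpa using hx
      obtain ⟨i, rfl⟩ := this
      exact (congrFun h1 i).trans (congrFun (ofTuple_comp a) i).symm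
    · rw [h2 x hx]
      simp [ofTuple, hx]

theorem ofTuple_injective : Function.Injective (ofTuple D : (Fin D.card → Fin n) → _) := by
  intro a b h
  have := (ofTuple_comp a).symm.trans ((congrArg (· ∘ D.orderEmbOfFin rfl) h).trans
    (ofTuple_comp b))
  funext i
  exact Option.some.inj (congrFun this i)

theorem isTeam_teamOf (z : Fin (n ^ D.card) → Bool) : IsTeam D (teamOf D z) := by
  rintro _ ⟨a, -, rfl⟩ x
  by_cases hx : x ∈ D <;> simp [ofTuple, hx]

theorem ncard_teamOf (z : Fin (n ^ D.card) → Bool) :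
    (teamOf D z).ncard = ∑ j, (z j).toNat := by
  rw [teamOf, Set.ncard_image_of_injective _ ofTuple_injective]
  have : {a : Fin D.card → Fin n | z (finFunctionFinEquiv a) = true} =
      finFunctionFinEquiv.symm '' {j | z j = true} := by
    rw [Equiv.image_symm_eq_preimage]
    rfl
  rw [this, Set.ncard_image_of_injective _ finFunctionFinEquiv.symm.injective,
    Set.ncard_eq_toFinset_card', Set.toFinset_ofPred, Finset.card_eq_sum_ones, Finset.sum_filter]
  exact Finset.sum_congr rfl fun j _ => by cases z j <;> rfl

theorem encodeTeam_teamOf (z : Fin (n ^ D.card) → Bool) :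
    encodeTeam D (teamOf D z) = List.ofFn z := by
  unfold encodeTeam encodeRel
  congr 1
  funext j
  rw [Bool.eq_iff_iff]
  simp only [decide_eq_true_eq]
  constructor
  · rintro ⟨_, ⟨a, ha, rfl⟩, h⟩
    rw [ofTuple_comp] at h
    have : a = finFunctionFinEquiv.symm j := by
      funext i
      exact Option.some.inj (congrFun h i)
    subst this
    simpa using ha
  · intro h
    exact ⟨_, ⟨finFunctionFinEquiv.symm j, by simpa using h, rfl⟩, ofTuple_comp _⟩

open Classical in
theorem IsTeam.exists_teamOf {X : Set (Assignment (Fin n))} (hX : IsTeam D X) :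
    ∃ z : Fin (n ^ D.card) → Bool, teamOf D z = X := by
  refine ⟨fun j => decide (ofTuple D (finFunctionFinEquiv.symm j) ∈ X), ?_⟩
  ext s
  constructor
  · rintro ⟨a, ha, rfl⟩
    simpa using ha
  · intro hs
    have hD : ∀ i, ∃ a, s (D.orderEmbOfFin rfl i) = some a := fun i =>
      Option.isSome_iff_exists.1 ((hX s hs _).2 (Finset.orderEmbOfFin_mem D rfl i))
    choose a ha using hD
    have h : s = ofTuple D a := eq_ofTuple_iff.2 ⟨funext ha, fun x hx => by
      have := mt (hX s hs x).1 hx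
      simpa using this⟩
    exact ⟨a, by simpa [← h] using hs, h.symm⟩

/-- The words of the satisfying teams. -/
def satWords (φ : Formula σ) (𝔄 : Structure σ (Fin n)) : Set (Fin (n ^ φ.free.card) → Bool) :=
  {z | Sat 𝔄 φ (teamOf φ.free z)}

/-- Nonempty teams correspond to nonzero words and cardinality to the number of ones. Taking the
zero word as previous solution makes the order condition vacuous. -/
theorem mem_ECardMaxSat_iff (φ : Formula σ) (𝔄 : Structure σ (Fin n)) (y : List Bool) :
    y ∈ ECardMaxSat φ (encodeStructure 𝔄) ↔
      ∃ z, Candidate (satWords φ 𝔄) (fun _ => false) z ∧ y = List.ofFn z := by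
  have key : ∀ z, Candidate (satWords φ 𝔄) (fun _ => false) z ↔
      IsMaxCardTeam φ 𝔄 (teamOf φ.free z) := by
    intro z
    have hne : (∃ j, z j = true) ↔ teamOf φ.free z ≠ ∅ := by
      rw [teamOf, ← Set.nonempty_iff_ne_empty, Set.image_nonempty]
      constructor
      · rintro ⟨j, hj⟩
        exact ⟨finFunctionFinEquiv.symm j, by simpa using hj⟩
      · rintro ⟨a, ha⟩
        exact ⟨_, ha⟩
    constructor
    · rintro ⟨h1, h2, h3, -⟩
      refine ⟨isTeam_teamOf z, h1, hne.1 h2, fun X' hX' hlt hsat => ?_⟩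
      obtain ⟨z', rfl⟩ := hX'.exists_teamOf
      rw [ncard_teamOf, ncard_teamOf] at hlt
      exact absurd (h3 z' hsat) (by omega)
    · rintro ⟨-, h1, h2, h3⟩
      refine ⟨h1, hne.2 h2, fun z' hz' => ?_, Or.inl fun _ => rfl⟩
      by_contra hlt
      rw [← ncard_teamOf, ← ncard_teamOf, not_le] at hlt
      exact h3 _ (isTeam_teamOf z') hlt hz'
  constructor
  · rintro ⟨n', 𝔅, X, h, hX, rfl⟩
    have := encodeStructure_injective (a₁ := ⟨n, 𝔄⟩) (a₂ := ⟨n', 𝔅⟩) h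
    obtain ⟨rfl, h⟩ := Sigma.mk.inj this
    obtain rfl := eq_of_heq h
    obtain ⟨z, rfl⟩ := hX.1.exists_teamOf
    exact ⟨z, (key z).2 hX, encodeTeam_teamOf z⟩
  · rintro ⟨z, hz, rfl⟩
    exact ⟨n, 𝔄, _, rfl, (key z).1 hz, (encodeTeam_teamOf z).symm⟩

/-- The number `j` codes an assignment in the team with domain `D` and characteristic word `z`. -/
def CodesMember (n m : ℕ) (D : Finset ℕ) (z : ℕ → Prop) (j : ℕ) : Prop :=
  (∀ x ∈ Finset.range m \ D, dig (n + 1) j x = 0) ∧ TupleIn n z (D.orderEmbOfFin rfl) j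

theorem asg_mem_teamOf_iff {m : ℕ} (hD : ∀ x ∈ D, x < m) (z : Fin (n ^ D.card) → Bool)
    (z' : ℕ → Prop) (hz : ∀ k, z' k.1 ↔ z k = true) (j : ℕ) :
    asg n m j ∈ teamOf D z ↔ CodesMember n m D z' j := by
  have h1 := tupleIn_iff (xs := D.orderEmbOfFin rfl)
    (fun l => hD _ (Finset.orderEmbOfFin_mem D rfl l)) j z'
    {a | z (finFunctionFinEquiv a) = true} fun a => by
      rw [← finFunctionFinEquiv_apply_val]
      exact hz _
  have h2 : (∀ x ∉ D, asg n m j x = none) ↔ ∀ x ∈ Finset.range m \ D, dig (n + 1) j x = 0 := by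
    have h3 : ∀ x < m, asg n m j x = none ↔ dig (n + 1) j x = 0 := by
      intro x hx
      have := dig_le n j x
      rw [asg_apply hx, digitValue]
      split_ifs with h
      · simp; omega
      · simp; omega
    constructor
    · intro h x hx
      simp only [Finset.mem_sdiff, Finset.mem_range] at hx
      exact (h3 x hx.1).1 (h x hx.2)
    · intro h x hx
      by_cases hxm : x < m
      · exact (h3 x hxm).2 (h x (by simp [hx, hxm]))
      · exact asg_supported _ _ (by omega)
  rw [CodesMember, ← h1, ← h2]
  constructor
  · rintro ⟨a, ha, h⟩
    obtain ⟨h3, h4⟩ := eq_ofTuple_iff.1 h.symm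
    exact ⟨h4, a, ha, h3⟩
  · rintro ⟨h4, a, ha, h3⟩
    exact ⟨a, ha, (eq_ofTuple_iff.2 ⟨h3, h4⟩).symm⟩

end

/-! ## The verifier -/

theorem pairWord_even (q w : List Bool) {j : ℕ} (hj : j < q.length) :
    (pairWord q w)[2 * j]? = q[j]? := by
  induction q generalizing j with
  | nil => simp at hj
  | cons b q ih =>
    have h : pairWord (b :: q) w = b :: b :: pairWord q w := by simp [pairWord]
    cases j with
    | zero => simp [h]
    | succ j =>
      rw [h, show 2 * (j + 1) = 2 * j + 1 + 1 by ring, List.getElem?_cons_succ,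
        List.getElem?_cons_succ, List.getElem?_cons_succ, ih (by simpa using hj)]

theorem pairWord_snd (q w : List Bool) (k : ℕ) :
    (pairWord q w)[2 * q.length + 2 + k]? = w[k]? := by
  rw [pairWord, List.getElem?_append_right]
  · congr 1
    simp [List.length_flatMap]
    omega
  · simp [List.length_flatMap]
    omega

/-- Needed because the question and the certificate transmit only finitely many bits of the array
and of the solution. -/
theorem Extends.congr {N i : ℕ} {a a' z z' : ℕ → Bool} (hi : i < 3 * N)
    (ha : ∀ j < 3 * N, a j = a' j) (hz : ∀ j < N, z j = z' j) (h : Extends N a z i) :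
    Extends N a' z' i := by
  have h1 : ones N a = ones N a' := Finset.sum_congr rfl fun j hj => by
    rw [ha j (by have := Finset.mem_range.1 hj; omega)]
  have h2 : ones N z = ones N z' := Finset.sum_congr rfl fun j hj => by
    rw [hz j (Finset.mem_range.1 hj)]
  rcases h with h | ⟨h3, h4, h5, h6, h7, h8⟩ | h
  · exact Or.inl ⟨h.1, h2 ▸ h.2⟩
  · refine Or.inr (Or.inl ⟨h3, h4, h1 ▸ h2 ▸ h5, fun j hj => ?_, ?_, ?_⟩)
    · rw [← hz j (by omega), ← ha _ (by omega)]
      exact h6 j hj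
    · rwa [← hz _ (by omega)]
    · refine h8.imp (fun h j hj => ?_) ?_
      · rw [← ha _ (by omega)]
        exact h j hj
      · rintro ⟨p, hp, h9, h10, h11⟩
        refine ⟨p, hp, by rwa [← hz p hp], by rwa [← ha _ (by omega)], fun q hq => ?_⟩
        rw [← hz q (by omega), ← ha _ (by omega)]
        exact h11 q hq
  · refine Or.inr (Or.inr ⟨h.1, ?_⟩)
    rw [← ha _ (by omega)]
    exact h.2

section
variable {σ : Vocabulary}

theorem PF.structureLength {Γ : Type} [Ctx Γ] {f : Γ → ℕ} (hf : PF f) :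
    PF (fun c => structureLength σ (f c)) :=
  (hf.add (PF.const 1)).add (PF.list_sum _ fun k _ => hf.pow k)

theorem PF.relOffset {Γ : Type} [Ctx Γ] {f : Γ → ℕ} (hf : PF f) (i : ℕ) :
    PF (fun c => relOffset σ (f c) i) :=
  PF.list_sum _ fun k _ => hf.pow k

theorem PF.ones {Γ : Type} [Ctx Γ] {N : Γ → ℕ} {a : Γ → ℕ → Bool} (hN : PF N)
    (ha : PP (fun c : Γ × ℕ => a c.1 c.2 = true)) : PF (fun c => ones (N c) (a c)) := by
  classical
  refine PF.sum hN (g := fun c j => (a c j).toNat) (PF.congr ha fun c => ?_)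
  by_cases h : a c.1 c.2 = true <;> simp [h]

theorem PP.extends {N i : List Bool → ℕ} {a z : List Bool → ℕ → Bool}
    (hN : ∀ {Γ : Type} [Ctx Γ], PF (fun c : Γ => N (inp c)))
    (hi : ∀ {Γ : Type} [Ctx Γ], PF (fun c : Γ => i (inp c)))
    (ha : ∀ {Γ : Type} [Ctx Γ] {f : Γ → ℕ}, PF f → PP (fun c => a (inp c) (f c) = true))
    (hz : ∀ {Γ : Type} [Ctx Γ] {f : Γ → ℕ}, PF f → PP (fun c => z (inp c) (f c) = true))
    {Γ : Type} [Ctx Γ] :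
    PP (fun c : Γ => Extends (N (inp c)) (a (inp c)) (z (inp c)) (i (inp c))) := by
  have h2N : ∀ {Γ : Type} [Ctx Γ], PF (fun c : Γ => 2 * N (inp c)) :=
    fun {Γ} _ => (PF.const 2).mul hN
  have hsub : ∀ {Γ : Type} [Ctx Γ], PF (fun c : Γ => i (inp c) - N (inp c)) :=
    fun {Γ} _ => hi.sub hN
  refine PP.or ((PP.lt hi hN).and (PP.lt hi (PF.ones hN (hz PF.var)))) (PP.or ?_
    ((PP.le h2N hi).and (ha hsub)))
  refine (PP.le hN hi).and ((PP.lt hi h2N).and ((PP.le (PF.ones hN (ha PF.var))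
    (PF.ones hN (hz PF.var))).and (PP.and ?_ ((hz hsub).and (PP.or ?_ ?_)))))
  · exact PP.ball hsub (PP.iff (hz PF.var) (ha (hN.add PF.var)))
  · exact PP.ball hN (ha (h2N.add PF.var)).not
  · exact PP.bex hN ((hz PF.var).not.and ((ha (h2N.add PF.var)).and
      (PP.ball PF.var (PP.iff (hz PF.var) (ha (h2N.add PF.var))))))

/-- The size of the universe, read off a word which consists of an oracle question and a
certificate. -/
noncomputable def pairSize (v : List Bool) : ℕ :=
  leading v.length fun j => v[2 * j]? = some true

theorem PF.pairSize {Γ : Type} [Ctx Γ] : PF (fun c : Γ => pairSize (inp c)) :=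
  PF.leading PF.length (PP.bit ((PF.const 2).mul PF.var))

variable (φ : Formula σ) (m : ℕ)

/-- The length of the oracle questions about a structure on `{0, …, n - 1}`: the encoding of the
structure, the array, and the index of the question in unary. -/
def questionLength (n : ℕ) : ℕ := structureLength σ n + 2 * (3 * n ^ φ.free.card)

/-- A relation of the structure, read off the pair of a question and a certificate. -/
def pairRel (σ : Vocabulary) (v : List Bool) (i k : ℕ) : Prop :=
  v[2 * (pairSize v + 1 + relOffset σ (pairSize v) i + k)]? = some true

/-- The array, read off the pair of a question and a certificate. -/
noncomputable def pairArray (σ : Vocabulary) (v : List Bool) (j : ℕ) : Bool :=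
  decide (v[2 * (structureLength σ (pairSize v) + j)]? = some true)

/-- The index of the question, read off the pair of a question and a certificate. -/
noncomputable def pairIndex (v : List Bool) : ℕ :=
  ones (3 * pairSize v ^ φ.free.card) fun j =>
    pairArray σ v (3 * pairSize v ^ φ.free.card + j)

/-- The set number `μ` of the certificate, read off the pair of a question and a certificate. -/
def pairSet (v : List Bool) (μ j : ℕ) : Prop :=
  v[2 * questionLength φ (pairSize v) + 2 + (μ * (pairSize v + 1) ^ m + j)]? = some true

/-- The solution is the last set of the certificate. -/
noncomputable def pairSolution (v : List Bool) (j : ℕ) : Bool :=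
  decide (v[2 * questionLength φ (pairSize v) + 2 +
    ((1 + φ.nodes) * (pairSize v + 1) ^ m + j)]? = some true)

/-- The condition that the verifier checks. -/
def Accepts (v : List Bool) : Prop :=
  Verifies (pairSize v) m (pairRel σ v) (pairSet φ m v) φ 0 1 ∧
  (∀ j < (pairSize v + 1) ^ m, (pairSet φ m v 0 j ↔
    CodesMember (pairSize v) m φ.free (fun k => pairSolution φ m v k = true) j)) ∧
  Extends (pairSize v ^ φ.free.card) (pairArray σ v) (pairSolution φ m v) (pairIndex φ v)

theorem PF.questionLength {Γ : Type} [Ctx Γ] {f : Γ → ℕ} (hf : PF f) :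
    PF (fun c => questionLength φ (f c)) :=
  hf.structureLength.add ((PF.const 2).mul ((PF.const 3).mul (hf.pow _)))

theorem PP.accepts {Γ : Type} [Ctx Γ] : PP (fun c : Γ => Accepts φ m (inp c)) := by
  have hset : ∀ {Γ : Type} [Ctx Γ] (μ : ℕ) {f : Γ → ℕ}, PF f →
      PP (fun c => pairSet φ m (inp c) μ (f c)) := fun {Γ} _ μ f hf =>
    PP.bit ((((PF.const 2).mul (PF.questionLength φ PF.pairSize)).add (PF.const 2)).add
      (((PF.const μ).mul ((PF.pairSize.add (PF.const 1)).pow m)).add hf))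
  have hsol : ∀ {Γ : Type} [Ctx Γ] {f : Γ → ℕ}, PF f →
      PP (fun c => pairSolution φ m (inp c) (f c) = true) := fun {Γ} _ f hf =>
    (hset (1 + φ.nodes) hf).congr fun c => decide_eq_true_iff
  have harr : ∀ {Γ : Type} [Ctx Γ] {f : Γ → ℕ}, PF f →
      PP (fun c => pairArray σ (inp c) (f c) = true) := fun {Γ} _ f hf =>
    (PP.bit ((PF.const 2).mul (PF.pairSize.structureLength.add hf))).congr
      fun c => decide_eq_true_iff
  have hT : ∀ {Γ : Type} [Ctx Γ], PF (fun c : Γ => 3 * pairSize (inp c) ^ φ.free.card) :=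
    fun {Γ} _ => (PF.const 3).mul (PF.pairSize.pow _)
  have hidx : ∀ {Γ : Type} [Ctx Γ], PF (fun c : Γ => pairIndex φ (inp c)) := fun {Γ} _ =>
    PF.ones (N := fun c => 3 * pairSize (inp c) ^ φ.free.card)
      (a := fun c j => pairArray σ (inp c) (3 * pairSize (inp c) ^ φ.free.card + j)) hT
      (harr (hT.add PF.var))
  refine PP.and (PP.verifies PF.pairSize (fun i f hf => ?_) hset m φ 0 1) (PP.and ?_ ?_)
  · exact PP.bit ((PF.const 2).mul
      (((PF.pairSize.add (PF.const 1)).add (PF.pairSize.relOffset i)).add hf))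
  · refine PP.ball ((PF.pairSize.add (PF.const 1)).pow m) (PP.iff (hset 0 PF.var)
      (PP.and ?_ (PP.tupleIn PF.pairSize PF.var _ (hsol (PF.tupleCode PF.pairSize PF.var _)))))
    exact PP.finset_forall _ fun x _ =>
      PP.eq ((PF.pairSize.add (PF.const 1)).dig PF.var x) (PF.const 0)
  · exact PP.extends (N := fun v => pairSize v ^ φ.free.card) (PF.pairSize.pow _) hidx harr hsol

/-- The words that are accepted by the verifier. -/
def verifierLanguage : Language Bool := {v | Accepts φ m v}

theorem verifierLanguage_mem_PTIME : verifierLanguage φ m ∈ PTIME := by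
  classical
  have h : verifierLanguage φ m = {v | (if Accepts φ m v then 1 else 0) ≠ 0} := by
    ext v
    change Accepts φ m v ↔ (if Accepts φ m v then 1 else 0) ≠ 0
    split_ifs with h <;> simp [h]
  rw [h]
  exact (PP.accepts (Γ := Base) φ m).ptime

/-- The oracle. -/
def oracle : Language Bool :=
  {q | ∃ w : List Bool, w.length ≤ (φ.nodes + 2) * (q.length + 1) ^ m ∧
    pairWord q w ∈ verifierLanguage φ m}

theorem oracle_mem_NP : oracle φ m ∈ NP := by
  refine ⟨verifierLanguage φ m, verifierLanguage_mem_PTIME φ m,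
    Polynomial.C (φ.nodes + 2) * (Polynomial.X + 1) ^ m, fun q => ?_⟩
  simp only [Polynomial.eval_mul, Polynomial.eval_pow, Polynomial.eval_add, Polynomial.eval_C,
    Polynomial.eval_X, Polynomial.eval_one]
  rfl

/-! ## Oracle questions -/

/-- The bits of the oracle question number `i` about the word `x` and the array `a`, where the
solutions have length `N`. -/
noncomputable def questionBit (N : ℕ) (x : List Bool) (a : ℕ → Bool) (i j : ℕ) : ℕ :=
  open Classical in
  if j < x.length then (if x[j]? = some true then 1 else 0) else
  if j < x.length + 3 * N then (a (j - x.length)).toNat else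
  if j < x.length + 3 * N + i then 1 else 0

/-- The oracle question number `i` about the word `x` and the array `a`. -/
noncomputable def question (N : ℕ) (x : List Bool) (a : ℕ → Bool) (i : ℕ) : List Bool :=
  bitWord (x.length + 2 * (3 * N)) (questionBit N x a i)

theorem question_length (N : ℕ) (x : List Bool) (a : ℕ → Bool) (i : ℕ) :
    (question N x a i).length = x.length + 2 * (3 * N) := by
  simp [question, bitWord]

theorem pairWord_question {N : ℕ} {x : List Bool} {a : ℕ → Bool} {i j : ℕ} (w : List Bool)
    (hj : j < x.length + 2 * (3 * N)) :
    (pairWord (question N x a i) w)[2 * j]? = some true ↔ questionBit N x a i j ≠ 0 := by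
  rw [pairWord_even _ _ (by rwa [question_length]), question, bitWord]
  simp [hj]

section
variable {n : ℕ} (𝔄 : Structure σ (Fin n)) (a : ℕ → Bool) (i : ℕ) (w : List Bool)

theorem pairSize_question (N : ℕ) :
    pairSize (pairWord (question N (encodeStructure 𝔄) a i) w) = n := by
  obtain ⟨h1, h2⟩ := encodeStructure_head 𝔄
  have hlen := length_encodeStructure 𝔄
  have hn : n < (encodeStructure 𝔄).length := by
    rw [hlen, structureLength]
    omega
  refine leading_eq ?_ (fun j hj => ?_) ?_
  · simp [pairWord, List.length_flatMap, question_length]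
    omega
  · rw [pairWord_question w (by omega), questionBit, if_pos (by omega), if_pos (h1 j hj)]
    simp
  · rw [pairWord_question w (by omega), questionBit, if_pos (by omega), if_neg (by simp [h2])]
    simp

/-- In the structure whose relations are all full, the bit at this position is `true`, so the
position lies inside the word. -/
theorem position_lt {n : ℕ} (i : Fin σ.numRel) (a : Fin (σ.arity i) → Fin n) :
    n + 1 + relOffset σ n i + ∑ l, a l * n ^ (l : ℕ) < structureLength σ n := by
  have := (encodeStructure_rel (⟨fun _ => Set.univ⟩ : Structure σ (Fin n)) i a).2 trivial
  rw [← length_encodeStructure (⟨fun _ => Set.univ⟩ : Structure σ (Fin n))]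
  exact (List.getElem?_eq_some_iff.1 this).1

theorem pairRel_question (N : ℕ) (k : Fin σ.numRel) (b : Fin (σ.arity k) → Fin n) :
    pairRel σ (pairWord (question N (encodeStructure 𝔄) a i) w) k (∑ l, b l * n ^ (l : ℕ)) ↔
      b ∈ 𝔄.rel k := by
  have h := position_lt k b
  rw [← length_encodeStructure 𝔄] at h
  rw [pairRel, pairSize_question, pairWord_question w (by omega), questionBit, if_pos h,
    ← encodeStructure_rel]
  split_ifs with h <;> simp [h]

theorem pairArray_question {N j : ℕ} (hj : j < 3 * N) :
    pairArray σ (pairWord (question N (encodeStructure 𝔄) a i) w) j = a j := by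
  rw [Bool.eq_iff_iff, pairArray, decide_eq_true_iff, pairSize_question,
    ← length_encodeStructure 𝔄, pairWord_question w (by omega), questionBit, if_neg (by omega),
    if_pos (by omega), Nat.add_sub_cancel_left]
  cases a j <;> simp

theorem pairIndex_question (hi : i < 3 * n ^ φ.free.card) :
    pairIndex φ (pairWord (question (n ^ φ.free.card) (encodeStructure 𝔄) a i) w) = i := by
  rw [pairIndex, pairSize_question, ones]
  generalize n ^ φ.free.card = N at *
  have : ∀ j ∈ Finset.range (3 * N),
      (pairArray σ (pairWord (question N (encodeStructure 𝔄) a i) w) (3 * N + j)).toNat =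
      if j < i then 1 else 0 := by
    intro j hj
    have hj := Finset.mem_range.1 hj
    rw [pairArray, pairSize_question, ← length_encodeStructure 𝔄]
    have : ((pairWord (question N (encodeStructure 𝔄) a i) w)[2 *
        ((encodeStructure 𝔄).length + (3 * N + j))]? = some true) ↔ j < i := by
      rw [pairWord_question w (by omega), questionBit, if_neg (by omega), if_neg (by omega)]
      split_ifs with h
      · simp; omega
      · simp; omega
    simp only [this]
    split_ifs with h <;> simp [h]
  rw [Finset.sum_congr rfl this, ← Finset.sum_filter, ← Finset.card_eq_sum_ones]
  have : (Finset.range (3 * N)).filter (· < i) = Finset.range i := by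
    ext j
    simp
    omega
  rw [this, Finset.card_range]

theorem pairWord_question_snd (k : ℕ) :
    (pairWord (question (n ^ φ.free.card) (encodeStructure 𝔄) a i) w)[2 * questionLength φ n + 2 +
      k]? = w[k]? := by
  have h := pairWord_snd (question (n ^ φ.free.card) (encodeStructure 𝔄) a i) w k
  rw [question_length, length_encodeStructure] at h
  exact h

variable {φ m}

/-- A certificate consists of blocks of length (n + 1) ^ m: block 0 is the team itself, blocks 1 to
`φ.nodes` are the auxiliary teams, and the next block begins with the characteristic word of the
solution. The question has a fixed length because its unary index is padded, so the certificate
starts at a position computable from n. -/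
theorem accepts_iff (hφ : φ.VarsLT m) (hi : i < 3 * n ^ φ.free.card) :
    Accepts φ m (pairWord (question (n ^ φ.free.card) (encodeStructure 𝔄) a i) w) ↔
      Certifies 𝔄 (fun μ => codedTeam n m fun j => w[μ * (n + 1) ^ m + j]? = some true) φ 0 1 ∧
      (∀ j < (n + 1) ^ m, (w[j]? = some true ↔ CodesMember n m φ.free
        (fun k => w[(1 + φ.nodes) * (n + 1) ^ m + k]? = some true) j)) ∧
      Extends (n ^ φ.free.card) a
        (fun k => decide (w[(1 + φ.nodes) * (n + 1) ^ m + k]? = some true)) i := by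
  have h1 : pairSet φ m (pairWord (question (n ^ φ.free.card) (encodeStructure 𝔄) a i) w) =
      fun μ j => w[μ * (n + 1) ^ m + j]? = some true := by
    funext μ j
    rw [pairSet, pairSize_question, pairWord_question_snd]
  have h2 : pairSolution φ m (pairWord (question (n ^ φ.free.card) (encodeStructure 𝔄) a i) w) =
      fun k => decide (w[(1 + φ.nodes) * (n + 1) ^ m + k]? = some true) := by
    funext k
    rw [pairSolution, pairSize_question, pairWord_question_snd]
  rw [Accepts, pairSize_question, h1, h2, pairIndex_question φ 𝔄 a i w hi,
    ← verifies_iff 𝔄 (pairRel_question 𝔄 a i w _) _ hφ]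
  refine and_congr_right fun _ => and_congr ?_ ?_
  · simp only [zero_mul, zero_add, decide_eq_true_eq]
  · exact ⟨fun h => h.congr hi (fun j hj => pairArray_question 𝔄 a i w hj) fun _ _ => rfl,
      fun h => h.congr hi (fun j hj => (pairArray_question 𝔄 a i w hj).symm) fun _ _ => rfl⟩

theorem codedTeam_congr {w w' : ℕ → Prop} (h : ∀ j < (n + 1) ^ m, (w j ↔ w' j)) :
    codedTeam n m w = codedTeam n m w' := by
  ext s
  exact exists_congr fun j => and_congr_right fun hj => and_congr_left fun _ => h j hj

theorem IsTeam.supportedIn {A : Type*} {D : Finset ℕ} {X : Set (Assignment A)} (hX : IsTeam D X)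
    (hD : ∀ x ∈ D, x < m) : SupportedIn m X := by
  intro s hs x hx
  have := mt (hX s hs x).1 fun h => absurd (hD x h) (by omega)
  simpa using this

/-- Soundness comes from `Certifies.sat`: block 0 is forced to be the team of the solution word. For
completeness the witnessing teams from `exists_certifies` are written out; a solution fits into one
block since N ≤ (n + 1) ^ m. -/
theorem mem_oracle_iff (hφ : φ.VarsLT m) (hi : i < 3 * n ^ φ.free.card) :
    question (n ^ φ.free.card) (encodeStructure 𝔄) a i ∈ oracle φ m ↔
      Answer (satWords φ 𝔄) a i := by
  classical
  have hD := hφ.free_lt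
  have hNM : n ^ φ.free.card ≤ (n + 1) ^ m := by
    have : φ.free.card ≤ m := by
      rw [← Finset.card_range m]
      exact Finset.card_le_card fun x hx => Finset.mem_range.2 (hD x hx)
    exact (Nat.pow_le_pow_left (by omega) _).trans (Nat.pow_le_pow_right (by omega) this)
  have hsupp : ∀ z, SupportedIn m (teamOf (n := n) φ.free z) :=
    fun z => (isTeam_teamOf z).supportedIn hD
  constructor
  · rintro ⟨w, -, hw⟩
    obtain ⟨h1, h2, h3⟩ := (accepts_iff 𝔄 a i w hφ hi).1 hw
    refine ⟨_, ?_, h3⟩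
    have h4 := h1.sat
    simp only [zero_mul, zero_add] at h4
    have h5 := codedTeam_congr fun j hj => (h2 j hj).trans (asg_mem_teamOf_iff hD
      (block (n ^ φ.free.card)
        (fun k => decide (w[(1 + φ.nodes) * (n + 1) ^ m + k]? = some true)) 0) _
      (fun k => by simp [block]) j).symm
    rw [h5, codedTeam_mem (hsupp _)] at h4
    exact h4
  · rintro ⟨z, hz, h3⟩
    obtain ⟨Y, hY, hY0, hc⟩ := exists_certifies hφ (hsupp _) hz (ν := 0) (o := 1) (by omega)
    set K := (n + 1) ^ m with hK
    have hKpos : 0 < K := Nat.pow_pos (by omega)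
    -- Quotient and remainder by K give the number of the block and the position in it.
    let f : ℕ → Bool := fun k => if k / K = 1 + φ.nodes then z (k % K) else
      decide (asg n m (k % K) ∈ Y (k / K))
    set w : List Bool := (List.range ((φ.nodes + 2) * K)).map f with hw
    have hwf : ∀ μ ≤ 1 + φ.nodes, ∀ j < K, w[μ * K + j]? =
        some (if μ = 1 + φ.nodes then z j else decide (asg n m j ∈ Y μ)) := by
      intro μ hμ j hj
      have h4 : μ * K + j < (φ.nodes + 2) * K := by nlinarith
      have h5 : (μ * K + j) / K = μ := by
        rw [add_comm, Nat.add_mul_div_right _ _ hKpos, Nat.div_eq_of_lt hj, zero_add]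
      have h6 : (μ * K + j) % K = j := by
        rw [add_comm, Nat.add_mul_mod_self_right, Nat.mod_eq_of_lt hj]
      simp [hw, h4, f, h5, h6]
    have hwY : ∀ μ < 1 + φ.nodes, ∀ j < K, (w[μ * K + j]? = some true ↔ asg n m j ∈ Y μ) := by
      intro μ hμ j hj
      rw [hwf μ hμ.le j hj, if_neg hμ.ne]
      simp
    have hwz : ∀ j < K, w[(1 + φ.nodes) * K + j]? = some (z j) := by
      intro j hj
      rw [hwf _ le_rfl j hj, if_pos rfl]
    refine ⟨w, ?_, (accepts_iff 𝔄 a i w hφ hi).2 ⟨?_, ?_, ?_⟩⟩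
    · rw [hw, List.length_map, List.length_range, question_length, length_encodeStructure]
      refine Nat.mul_le_mul_left _ (Nat.pow_le_pow_left ?_ _)
      rw [structureLength]
      omega
    · have hcoded : ∀ μ < 1 + φ.nodes,
          codedTeam n m (fun j => w[μ * K + j]? = some true) = Y μ := fun μ hμ =>
        (codedTeam_congr (hwY μ hμ)).trans (codedTeam_mem (hY μ))
      exact hc.congr (hcoded 0 (by omega)).symm fun μ _ hμ => (hcoded μ hμ).symm
    · intro j hj
      have h4 := hwY 0 (by omega) j hj
      rw [zero_mul, zero_add] at h4
      rw [h4, hY0]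
      exact asg_mem_teamOf_iff hD _ _ (fun k => by
        rw [hwz _ (k.2.trans_le hNM)]
        simp [block]) j
    · refine h3.congr hi (fun _ _ => rfl) fun j hj => ?_
      rw [hwz j (hj.trans_le hNM)]
      simp

end

/-! ## The main theorem -/

/-- The length of the solutions, and `0` if the word encodes no structure. -/
noncomputable def solutionLength (x : List Bool) : ℕ :=
  open Classical in
  if x.length = structureLength σ (universeSize x) then universeSize x ^ φ.free.card else 0

theorem solutionLength_encodeStructure {n : ℕ} (𝔄 : Structure σ (Fin n)) :
    solutionLength φ (encodeStructure 𝔄) = n ^ φ.free.card := by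
  rw [solutionLength, universeSize_encodeStructure, if_pos (length_encodeStructure 𝔄)]

theorem PF.universeSize {Γ : Type} [Ctx Γ] : PF (fun c : Γ => universeSize (inp c)) :=
  PF.leading PF.length (PP.bit PF.var)

theorem PF.solutionLength {Γ : Type} [Ctx Γ] : PF (fun c : Γ => solutionLength φ (inp c)) :=
  PF.congr (PF.ite (PP.eq PF.length (PF.structureLength (σ := σ) PF.universeSize))
    (PF.universeSize.pow φ.free.card) (PF.const 0)) fun c => by
      unfold TeamEnum.solutionLength
      congr

theorem PF.questionBit {N : Base → ℕ} (hN : PF N) :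
    PF (fun c : (Base × ℕ) × ℕ => questionBit (N c.1.1) c.1.1.1 c.1.1.2 c.1.2 c.2) := by
  have h3N : PF (fun c : (Base × ℕ) × ℕ => (inp c).length + 3 * N c.1.1) :=
    PF.length.add ((PF.const 3).mul hN.weaken.weaken)
  refine PF.congr (PF.ite (PP.lt PF.var PF.length) (PF.bit PF.var) (PF.ite (PP.lt PF.var h3N)
    (PF.mem (PF.var.sub PF.length)) (PF.ite (PP.lt PF.var (h3N.add PF.var₁)) (PF.const 1)
    (PF.const 0)))) fun c => ?_
  unfold TeamEnum.questionBit
  congr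

theorem ECardMaxSat_mem_DelNP : ECardMaxSat φ ∈ Del NP := by
  obtain ⟨m, hφ⟩ := φ.exists_varsLT
  have hN : PF (fun c : Base => solutionLength φ c.1) := PF.solutionLength φ
  have hbit : PF (fun c : Base × ℕ => (c.1.2 (solutionLength φ c.1.1 + c.2)).toNat) :=
    PF.mem (hN.weaken.add PF.var)
  refine mem_Del_of_rounds (oracle_mem_NP φ m) ((PF.const 3).mul hN)
    (l := fun c => c.1.length + 2 * (3 * solutionLength φ c.1))
    (g := fun c j => questionBit (solutionLength φ c.1.1) c.1.1 c.1.2 c.2 j)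
    (h := fun c => ∑ j ∈ Finset.range (solutionLength φ c.1),
      (c.2 (solutionLength φ c.1 + j)).toNat)
    (o := fun c j => (c.2 (solutionLength φ c.1 + j)).toNat)
    (PF.length.add ((PF.const 2).mul ((PF.const 3).mul hN))) (PF.questionBit hN)
    (PF.sum hN hbit) hN hbit fun x => ?_
  by_cases hx : ∃ (n : ℕ) (𝔄 : Structure σ (Fin n)), x = encodeStructure 𝔄
  · obtain ⟨n, 𝔄, rfl⟩ := hx
    simp only [solutionLength_encodeStructure]
    obtain ⟨ws, h1, h2, h3⟩ := exists_rounds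
      (P := fun a i => question (n ^ φ.free.card) (encodeStructure 𝔄) a i ∈ oracle φ m)
      (fun a i hi => mem_oracle_iff 𝔄 a i hφ hi) (fun _ => false)
      (h := fun a => ∑ j ∈ Finset.range (n ^ φ.free.card), (a (n ^ φ.free.card + j)).toNat)
      (out := fun a => bitWord (n ^ φ.free.card) fun j => (a (n ^ φ.free.card + j)).toNat)
      (fun a => by
        rw [Finset.sum_range fun j => (a (n ^ φ.free.card + j)).toNat, Finset.sum_eq_zero_iff]
        simp [block])
      (fun a => by
        refine List.ext_getElem (by simp [bitWord]) fun j _ _ => ?_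
        simp [bitWord, block])
    refine ⟨ws.map List.ofFn, h1.map List.ofFn_injective, fun y => ?_, h3⟩
    rw [mem_ECardMaxSat_iff, List.mem_map]
    exact exists_congr fun z => and_congr (h2 z).symm eq_comm
  -- For a word that encodes no structure the array has length 0, so the first round asks nothing
  -- and halts.
  · have h0 : solutionLength φ x = 0 := by
      rw [solutionLength, if_neg]
      exact fun h => hx ⟨_, exists_encodeStructure h⟩
    refine ⟨[], List.nodup_nil, fun y => ?_, ?_⟩
    · simp only [List.not_mem_nil, iff_false]
      rintro ⟨n, 𝔄, -, h, -⟩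
      exact hx ⟨n, 𝔄, h⟩
    · simp [Rounds, h0]

end

end TeamEnum

/-- For every vocabulary `σ` and every fixed formula `φ` of `FO(⊥, dep, ⊆)` over `σ`, the problem of
enumerating the nonempty satisfying teams of maximum cardinality is in `DelNP`. -/
theorem mainTheorem7 (σ : TeamEnum.Vocabulary) (φ : TeamEnum.Formula σ) :
    TeamEnum.ECardMaxSat φ ∈ TeamEnum.Del TeamEnum.NP :=
  TeamEnum.ECardMaxSat_mem_DelNP φ
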